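/- Let $d\in(-\tfrac12,\tfrac12)\setminus\{0\}$, let $\phi$ be a polynomial with real coefficients, $\phi(0)=1$ and no zeros in the closed unit disk, and let $q\ge 0$ be an integer. Let $\mathrm{Li}_{-2d-1}$ be the polylogarithm, i.e. the holomorphic extension of $\sum_{k\ge1}k^{2d+1}z^k$ to $\mathbb C\setminus[1,\infty)$, $$\mathrm{Li}_{-2d-1}(z)=\Gamma(2+2d)\sum_{k\in\mathbb Z}(-\log z+2\pi i k)^{-2-2d}$$ (principal branches), and put $$Q(z)=\tfrac1{4\pi}(z^{-1}-2+z)\big(\mathrm{Li}_{-2d-1}(z)+\mathrm{Li}_{-2d-1}(z^{-1})\big),\quad z\in\mathbb C\setminus[0,\infty).$$ For a function $F$, let $F^{\pm}(t)$ denote the limit of $F(z)$ as $z\to t\in\mathbb R$ from the upper ($+$) or lower ($-$) half-plane. Let $$X_0(z)=\exp\Big(\frac1\pi\int_0^1\frac{\arg Q^+(\tau)}{\tau-z}\,d\tau\Big),\quad z\in\mathbb C\setminus[0,1],\qquad \arg\in(-\pi,\pi],$$ let $X(z)=z^{-1}X_0(z)$ if $d>0$ and $X(z)=X_0(z)$ if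 $d<0$, and, for $s>0$, $$h(s)=\frac1{2i\sin(\pi d)}\,\frac{\phi(e^s)}{\phi(e^{-s})}\Big(\frac{X(e^s)}{X^+(e^{-s})}-\frac{X(e^s)}{X^-(e^{-s})}\Big)e^{-2qs}.$$ (a) Each of the equations $$q_1(t)=\frac{\sin(\pi d)}\pi\int_0^\infty\frac{e^{-r}}{r+t}q_1(r)\,dr+1,\qquad p_1(t)=-\frac{\sin(\pi d)}\pi\int_0^\infty\frac{e^{-r}}{r+t}p_1(r)\,dr+1,\qquad t>0,$$ has a unique real solution with $q_1-1\in L^2(0,\infty)$, respectively $p_1-1\in L^2(0,\infty)$, and the integrals $$\lambda_0=\int_0^\infty q_1(\tau)e^{-\tau}\,d\tau,\qquad \mu_0=\int_0^\infty p_1(\tau)e^{-\tau}\,d\tau$$ converge absolutely. (b) For every $j\in\{0,\dots,q+1\}$ and all sufficiently large $n$, each of the equations $$u_{j,n}(t)=\frac{\sin(\pi d)}\pi\int_0^\infty\frac{h(s)e^{-ns}}{e^{s+t}-1}u_{j,n}(s)\,ds+e^{jt},\qquad w_{j,n}(t)=-\frac{\sin(\pi d)}\pi\int_0^\infty\frac{h(s)e^{-ns}}{e^{s+t}-1}w_{j,n}(s)\,ds+e^{jt},\qquad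 t>0,$$ has a unique real solution with $u_{j,n}(t)-e^{jt}\in L^2(0,\infty)$, respectively $w_{j,n}(t)-e^{jt}\in L^2(0,\infty)$. (c) For every $j\in\{0,\dots,q+1\}$ and every fixed $z\in\mathbb C\setminus[0,1]$, the functions $$S_{j,n}(z)=\frac{\sin(\pi d)}\pi\int_0^\infty\frac{h(s)e^{-ns}}{ze^s-1}u_{j,n}(s)\,ds+z^j,\qquad D_{j,n}(z)=-\frac{\sin(\pi d)}\pi\int_0^\infty\frac{h(s)e^{-ns}}{ze^s-1}w_{j,n}(s)\,ds+z^j$$ (whose integrals converge absolutely for all sufficiently large $n$, with a threshold that does not depend on $z$) satisfy, as $n\to\infty$, $$S_{j,n}(z)=z^j+\frac{\sin(\pi d)}\pi\,\frac{\lambda_0}{z-1}\,n^{-1}+O(n^{-2}),\qquad D_{j,n}(z)=z^j-\frac{\sin(\pi d)}\pi\,\frac{\mu_0}{z-1}\,n^{-1}+O(n^{-2}).$$ -/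

import Mathlib

open MeasureTheory Filter Topology Asymptotics

noncomputable section

namespace FGN

/-- The boundary value `F⁺(t)`: the limit of `F(z)` as `z → t` from the upper half-plane. -/
def limPlus (F : ℂ → ℂ) (t : ℝ) : ℂ :=
  limUnder (𝓝[{z : ℂ | 0 < z.im}] (t : ℂ)) F

/-- The boundary value `F⁻(t)`: the limit of `F(z)` as `z → t` from the lower half-plane. -/
def limMinus (F : ℂ → ℂ) (t : ℝ) : ℂ :=
  limUnder (𝓝[{z : ℂ | z.im < 0}] (t : ℂ)) F

/-- The polylogarithm `Li_{-2d-1}(z)` on `ℂ ∖ [1, ∞)`, i.e. the holomorphic extension of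
`∑_{k ≥ 1} k^{2d+1} z^k` from the unit disk, given by the Lindelöf–Wirtinger expansion
`Γ(2+2d) ∑_{k ∈ ℤ} (-log z + 2πik)^{-2-2d}` with principal branches (the series converges
absolutely for `d > -1/2`). -/
def polylog (d : ℝ) (z : ℂ) : ℂ :=
  (Real.Gamma (2 + 2 * d) : ℂ) *
    ∑' k : ℤ, (-Complex.log z + 2 * Real.pi * Complex.I * k) ^ ((-2 - 2 * d : ℝ) : ℂ)

/-- The sectionally holomorphic extension of the spectral density of the fractional Gaussian noise
to `ℂ ∖ [0, ∞)`. -/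
def Q (d : ℝ) (z : ℂ) : ℂ :=
  1 / (4 * Real.pi) * (z⁻¹ - 2 + z) * (polylog d z + polylog d z⁻¹)

/-- `η(t) = arg Q⁺(t) ∈ (-π, π]`. -/
def eta (d : ℝ) (t : ℝ) : ℝ := Complex.arg (limPlus (Q d) t)

/-- `X₀(z) = exp ((1/π) ∫₀¹ η(τ) / (τ - z) dτ)`, for `z ∈ ℂ ∖ [0,1]`. -/
def X₀ (d : ℝ) (z : ℂ) : ℂ :=
  Complex.exp (1 / Real.pi * ∫ τ in (0 : ℝ)..1, (eta d τ : ℂ) / ((τ : ℂ) - z))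

/-- `X(z) = z⁻¹ X₀(z)` if `d > 0` and `X(z) = X₀(z)` if `d < 0`. -/
def X (d : ℝ) (z : ℂ) : ℂ := if 0 < d then z⁻¹ * X₀ d z else X₀ d z

/-- The function `h(s)`, `s > 0`; here `φ` is the AR polynomial and `q` is the degree of the MA
polynomial. Its values are in fact real. -/
def h (d : ℝ) (φ : Polynomial ℝ) (q : ℕ) (s : ℝ) : ℂ :=
  1 / (2 * Complex.I) * (1 / (Real.sin (Real.pi * d) : ℂ)) *
    ((φ.eval (Real.exp s) / φ.eval (Real.exp (-s)) : ℝ) : ℂ) *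
    (X d (Real.exp s) / limPlus (X d) (Real.exp (-s))
      - X d (Real.exp s) / limMinus (X d) (Real.exp (-s))) *
    (Real.exp (-2 * q * s) : ℂ)

/-- `f : (0, ∞) → ℝ` satisfies `f - g ∈ L²(0, ∞)` and solves the integral equation
`f(t) = c ∫₀^∞ K(t, s) f(s) ds + g(t)` for all `t > 0`, the integral being absolutely convergent.
(Values of `f` outside `(0, ∞)` are irrelevant.) -/
def IsSolution (c : ℝ) (K : ℝ → ℝ → ℂ) (g f : ℝ → ℝ) : Prop :=
  MemLp (fun t => f t - g t) 2 (volume.restrict (Set.Ioi 0)) ∧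
  ∀ t : ℝ, 0 < t →
    IntegrableOn (fun s => K t s * (f s : ℂ)) (Set.Ioi 0) ∧
    (f t : ℂ) = c * (∫ s in Set.Ioi (0 : ℝ), K t s * (f s : ℂ)) + (g t : ℂ)

/-- `f` is the only solution, as a function on `(0, ∞)`. -/
def IsUniqueSolution (c : ℝ) (K : ℝ → ℝ → ℂ) (g f : ℝ → ℝ) : Prop :=
  IsSolution c K g f ∧ ∀ f' : ℝ → ℝ, IsSolution c K g f' → Set.EqOn f' f (Set.Ioi 0)

/-- The kernel `h(s) e^{-ns} / (e^{s+t} - 1)`. -/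
def kernel (d : ℝ) (φ : Polynomial ℝ) (q n : ℕ) (t s : ℝ) : ℂ :=
  h d φ q s * (Real.exp (-n * s) : ℂ) / ((Real.exp (s + t) - 1 : ℝ) : ℂ)

/-- The kernel `e^{-r} / (r + t)`. -/
def limitKernel (t r : ℝ) : ℂ := ((Real.exp (-r) / (r + t) : ℝ) : ℂ)

/-- The integrand `h(s) e^{-ns} v(s) / (z e^s - 1)`. -/
def cauchyIntegrand (d : ℝ) (φ : Polynomial ℝ) (q n : ℕ) (v : ℝ → ℝ) (z : ℂ) (s : ℝ) : ℂ :=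
  h d φ q s * (Real.exp (-n * s) : ℂ) / (z * (Real.exp s : ℂ) - 1) * (v s : ℂ)

/-- `S_{j,n}(z)`, given the solution `u = u_{j,n}`. -/
def S (d : ℝ) (φ : Polynomial ℝ) (q j n : ℕ) (u : ℝ → ℝ) (z : ℂ) : ℂ :=
  ((Real.sin (Real.pi * d) / Real.pi : ℝ) : ℂ) *
    (∫ s in Set.Ioi (0 : ℝ), cauchyIntegrand d φ q n u z s) + z ^ j

/-- `D_{j,n}(z)`, given the solution `w = w_{j,n}`. -/
def D (d : ℝ) (φ : Polynomial ℝ) (q j n : ℕ) (w : ℝ → ℝ) (z : ℂ) : ℂ :=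
  -((Real.sin (Real.pi * d) / Real.pi : ℝ) : ℂ) *
    (∫ s in Set.Ioi (0 : ℝ), cauchyIntegrand d φ q n w z s) + z ^ j

/-- `∫₀^∞ f(τ) e^{-τ} dτ`; this is `λ₀` for `f = q₁` and `μ₀` for `f = p₁`. -/
def expMoment (f : ℝ → ℝ) : ℝ := ∫ τ in Set.Ioi (0 : ℝ), f τ * Real.exp (-τ)

end FGN

end

noncomputable section

namespace FGN

open Set
open scoped ENNReal NNReal

/-! The integral operator with kernel 1/(s+t) has norm at most π on L²(0,∞). Hence ±sin(πd)/π times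
any kernel dominated by it has norm at most |sin(πd)| < 1, and existence and uniqueness in (a) and
(b) follow from the contraction principle (`StieltjesBound.exists_uniqueSolution`). The
inhomogeneous terms 1 and e^{jt} are not in L², but the exponential decay of the kernels in s
compensates for this.

For (c), the relevant scale is s ~ 1/n. Since 1/(s+t) is homogeneous of degree -1, dilation by n
turns the limit equation, with solution f = q₁ or p₁, into the equation with kernel e^{-ns}/(s+t)
solved by f(n·). The kernel in (b) differs from this one by a kernel without singularity at s = t =
0, because h(s) = 1 + O(s) and 1/x - 1/(e^x - 1) is bounded. Subtracting the equations, the L² norm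
x of e^{-ns/2}(u - f(n·)) satisfies x ≤ |sin(πd)| x + O(1/n)(x + n^{-1/2}) + O(n^{-3/2}), so x =
O(n^{-3/2}) (`RealSolution.l2norm_sub_le`). One more Cauchy–Schwarz inequality gains n^{-1/2}, which
is the error O(n^{-2}) in S and D; the main term comes from the exact identity ∫ e^{-ns} f(ns) ds =
n⁻¹ ∫ e^{-τ} f(τ) dτ (`norm_cauchy_sub_le`, `isBigO_cauchy`).

It remains to show that h is real with |h(s) - 1| ≤ C s e^{Ks} (`exists_nearOne_h`). Put θ(s) = arg
Q⁺(e^{-s}). By Sokhotski–Plemelj, X^±(e^{-s}) is a positive number times e^{±iθ(s)}, so h is the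
product of -sin θ(s)/sin(πd), the ratio of values of φ, elementary exponentials, and the exponential
of a regularized singular integral of θ (`h_eq`). The Lindelöf–Wirtinger series shows that, up to a
positive factor, Q⁺(e^{-s}) has imaginary part exactly -sin(πd) and real part cos(πd) + O(s^{1+α}),
with α = min(1, 1+2d) (`eta_exp_neg`). Hence θ(s) = -πd + O(s^{1+α}), with local Lipschitz constant
O(s^α) (`exists_argQ_bounds`), and this regularity makes the exponent O(s) on all of (0,∞)
(`HolderBound.exists_exponent_bound`). -/

/-- Lebesgue measure on the half-line `(0, ∞)`. -/
abbrev halfLine : Measure ℝ := volume.restrict (Ioi 0)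

/-! ### The Stieltjes transform on L²(0,∞). -/

lemma ae_halfLine_pos : ∀ᵐ s ∂halfLine, 0 < s := ae_restrict_mem measurableSet_Ioi

/-- The primitive is (2/√t) arctan √(s/t). In the Schur test this says that s^{-1/2} is a
generalized eigenfunction of the kernel with eigenvalue π, which is where the operator norm π comes
from. -/
lemma lintegral_stieltjes_weight {t : ℝ} (ht : 0 < t) :
    ∫⁻ s, ENNReal.ofReal ((√s)⁻¹ / (s + t)) ∂halfLine = ENNReal.ofReal (Real.pi / √t) := by
  have hst : 0 < √t := Real.sqrt_pos.2 ht
  have hlim : Tendsto (fun s : ℝ => 2 / √t * Real.arctan (√s / √t)) atTop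
      (𝓝 (Real.pi / √t)) := by
    have h1 : Tendsto (fun s : ℝ => √s / √t) atTop atTop :=
      Real.tendsto_sqrt_atTop.atTop_div_const hst
    have h2 := (Real.tendsto_arctan_atTop.mono_right nhdsWithin_le_nhds).comp h1
    have h3 : Tendsto (fun s : ℝ => 2 / √t * Real.arctan (√s / √t)) atTop
      (𝓝 (2 / √t * (Real.pi / 2))) := h2.const_mul (2 / √t)
    rwa [show 2 / √t * (Real.pi / 2) = Real.pi / √t by ring] at h3
  have hder : ∀ s ∈ Ioi (0 : ℝ), HasDerivAt (fun s : ℝ => 2 / √t * Real.arctan (√s / √t))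
      ((√s)⁻¹ / (s + t)) s := by
    intro s hs
    have hs' : 0 < s := hs
    have hss : 0 < √s := Real.sqrt_pos.2 hs'
    have h1 := (((Real.hasDerivAt_sqrt hs'.ne').div_const (√t)).arctan).const_mul (2 / √t)
    refine h1.congr_deriv ?_
    have e1 := Real.sq_sqrt hs'.le
    have e2 := Real.sq_sqrt ht.le
    have : s + t = √s ^ 2 + √t ^ 2 := by rw [e1, e2]
    rw [this]
    field_simp
    rw [add_comm]
  have hcont : ContinuousWithinAt (fun s : ℝ => 2 / √t * Real.arctan (√s / √t)) (Ici 0) 0 := by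
    apply Continuous.continuousWithinAt
    fun_prop
  have hpos : ∀ s ∈ Ioi (0 : ℝ), 0 ≤ (√s)⁻¹ / (s + t) := by
    intro s hs
    have hs' : 0 < s := hs
    positivity
  have hint := integrableOn_Ioi_deriv_of_nonneg hcont hder hpos hlim
  have hval := integral_Ioi_of_hasDerivAt_of_nonneg hcont hder hpos hlim
  rw [← ofReal_integral_eq_lintegral_ofReal hint, hval]
  · simp
  · filter_upwards [ae_halfLine_pos] with s hs using hpos s hs

lemma measurable_ofReal_div_add (g : ℝ → ℝ) (hg : Measurable g) :
    Measurable (fun p : ℝ × ℝ => ENNReal.ofReal (g p.2 / (p.2 + p.1))) := by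
  fun_prop

/-- The Hilbert–Schur inequality for the kernel `1 / (s + t)`, in `ℝ≥0∞`-valued form. -/
lemma lintegral_stieltjes_sq_le (f : ℝ → ℝ≥0∞) (hf : AEMeasurable f halfLine) :
    ∫⁻ t, (∫⁻ s, ENNReal.ofReal (1 / (s + t)) * f s ∂halfLine) ^ 2 ∂halfLine
      ≤ ENNReal.ofReal (Real.pi ^ 2) * ∫⁻ s, f s ^ 2 ∂halfLine := by
  -- Cauchy–Schwarz after writing 1/(s+t) as the geometric mean of s^{-1/2}/(s+t) and s^{1/2}/(s+t);
  -- the first factor integrates to π/√t.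
  have key : ∀ t, 0 < t → (∫⁻ s, ENNReal.ofReal (1 / (s + t)) * f s ∂halfLine) ^ 2 ≤
      ENNReal.ofReal (Real.pi / √t) *
        ∫⁻ s, ENNReal.ofReal (√s / (s + t)) * f s ^ 2 ∂halfLine := by
    intro t ht
    have hc : Real.HolderConjugate 2 2 := Real.HolderConjugate.two_two
    have hA : AEMeasurable (fun s : ℝ => ENNReal.ofReal (√((√s)⁻¹ / (s + t)))) halfLine := by
      fun_prop
    have hB : AEMeasurable (fun s : ℝ => ENNReal.ofReal (√(√s / (s + t))) * f s) halfLine := by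
      refine AEMeasurable.mul ?_ hf
      fun_prop
    have hH := ENNReal.lintegral_mul_le_Lp_mul_Lq halfLine hc hA hB
    have e0 : ∫⁻ s, ENNReal.ofReal (1 / (s + t)) * f s ∂halfLine =
        ∫⁻ s, ((fun s : ℝ => ENNReal.ofReal (√((√s)⁻¹ / (s + t)))) *
          (fun s : ℝ => ENNReal.ofReal (√(√s / (s + t))) * f s)) s ∂halfLine := by
      apply lintegral_congr_ae
      filter_upwards [ae_halfLine_pos] with s hs
      have hss : 0 < √s := Real.sqrt_pos.2 hs
      simp only [Pi.mul_apply]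
      rw [← mul_assoc, ← ENNReal.ofReal_mul (Real.sqrt_nonneg _),
        ← Real.sqrt_mul (by positivity)]
      congr 2
      rw [show (√s)⁻¹ / (s + t) * (√s / (s + t)) = (1 / (s + t)) ^ 2 by field_simp,
        Real.sqrt_sq (by positivity)]
    have e1 : ∫⁻ s, (ENNReal.ofReal (√((√s)⁻¹ / (s + t)))) ^ (2 : ℝ) ∂halfLine =
        ENNReal.ofReal (Real.pi / √t) := by
      rw [← lintegral_stieltjes_weight ht]
      apply lintegral_congr_ae
      filter_upwards [ae_halfLine_pos] with s hs
      rw [ENNReal.rpow_two, ← ENNReal.ofReal_pow (Real.sqrt_nonneg _), Real.sq_sqrt (by positivity)]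
    have e2 : ∫⁻ s, (ENNReal.ofReal (√(√s / (s + t))) * f s) ^ (2 : ℝ) ∂halfLine =
        ∫⁻ s, ENNReal.ofReal (√s / (s + t)) * f s ^ 2 ∂halfLine := by
      apply lintegral_congr_ae
      filter_upwards [ae_halfLine_pos] with s hs
      rw [ENNReal.rpow_two, mul_pow, ← ENNReal.ofReal_pow (Real.sqrt_nonneg _),
        Real.sq_sqrt (by positivity)]
    rw [← e0, e1, e2] at hH
    calc _ ≤ _ := pow_le_pow_left' hH 2
      _ = _ := by
        rw [mul_pow, ← ENNReal.rpow_two, ← ENNReal.rpow_two, ← ENNReal.rpow_mul,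
          ← ENNReal.rpow_mul]
        norm_num
  calc _ ≤ ∫⁻ t, ENNReal.ofReal (Real.pi / √t) *
        ∫⁻ s, ENNReal.ofReal (√s / (s + t)) * f s ^ 2 ∂halfLine ∂halfLine := by
        apply lintegral_mono_ae
        filter_upwards [ae_halfLine_pos] with t ht using key t ht
    _ = ∫⁻ t, ∫⁻ s, ENNReal.ofReal (Real.pi / √t) *
        (ENNReal.ofReal (√s / (s + t)) * f s ^ 2) ∂halfLine ∂halfLine := by
        congr 1
        ext t
        rw [lintegral_const_mul' _ _ ENNReal.ofReal_ne_top]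
    _ = ∫⁻ s, ∫⁻ t, ENNReal.ofReal (Real.pi / √t) *
        (ENNReal.ofReal (√s / (s + t)) * f s ^ 2) ∂halfLine ∂halfLine := by
        apply lintegral_lintegral_swap
        refine AEMeasurable.mul (by fun_prop) (AEMeasurable.mul ?_ ?_)
        · exact (measurable_ofReal_div_add _ (by fun_prop)).aemeasurable
        · exact (hf.pow_const 2).comp_snd
    _ = ∫⁻ s, ENNReal.ofReal (Real.pi ^ 2) * f s ^ 2 ∂halfLine := by
        apply lintegral_congr_ae
        filter_upwards [ae_halfLine_pos] with s hs
        have hss : 0 < √s := Real.sqrt_pos.2 hs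
        -- After Tonelli the t-integral is the same weight integral with the roles of s and t
        -- exchanged, and π√s · π/√s = π².
        have : ∀ᵐ t ∂halfLine, ENNReal.ofReal (Real.pi / √t) *
            (ENNReal.ofReal (√s / (s + t)) * f s ^ 2) =
            (ENNReal.ofReal (Real.pi * √s) * f s ^ 2) *
              ENNReal.ofReal ((√t)⁻¹ / (t + s)) := by
          filter_upwards [ae_halfLine_pos] with t ht
          have hst : 0 < √t := Real.sqrt_pos.2 ht
          rw [← mul_assoc, ← ENNReal.ofReal_mul (by positivity), mul_right_comm,
            ← ENNReal.ofReal_mul (by positivity)]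
          congr 2
          rw [add_comm t s]
          field_simp
        rw [lintegral_congr_ae this, lintegral_const_mul _ (by fun_prop),
          lintegral_stieltjes_weight hs, mul_right_comm, ← ENNReal.ofReal_mul (by positivity)]
        congr 2
        field_simp
    _ = _ := lintegral_const_mul' _ _ ENNReal.ofReal_ne_top

lemma eLpNorm_two_eq {E : Type*} [NormedAddCommGroup E] {α : Type*} [MeasurableSpace α]
    (μ : Measure α) (f : α → E) :
    eLpNorm f 2 μ = (∫⁻ s, ‖f s‖ₑ ^ 2 ∂μ) ^ (1 / 2 : ℝ) := by
  rw [eLpNorm_eq_lintegral_rpow_enorm_toReal (by norm_num) (by norm_num)]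
  simp

/-- The Stieltjes transform has norm at most `π` on `L²(0, ∞)`. -/
lemma eLpNorm_le_of_stieltjes {f F : ℝ → ℝ} (hf : AEStronglyMeasurable f halfLine)
    (hF : ∀ t, 0 < t → ‖F t‖ₑ ≤ ∫⁻ s, ENNReal.ofReal (1 / (s + t)) * ‖f s‖ₑ ∂halfLine) :
    eLpNorm F 2 halfLine ≤ ENNReal.ofReal Real.pi * eLpNorm f 2 halfLine := by
  rw [eLpNorm_two_eq, eLpNorm_two_eq]
  have h1 : ∫⁻ s, ‖F s‖ₑ ^ 2 ∂halfLine ≤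
      ENNReal.ofReal (Real.pi ^ 2) * ∫⁻ s, ‖f s‖ₑ ^ 2 ∂halfLine := by
    refine le_trans ?_ (lintegral_stieltjes_sq_le (fun s => ‖f s‖ₑ) hf.enorm)
    apply lintegral_mono_ae
    filter_upwards [ae_halfLine_pos] with t ht using pow_le_pow_left' (hF t ht) 2
  calc _ ≤ _ := ENNReal.rpow_le_rpow h1 (by norm_num)
    _ = _ := by
      rw [ENNReal.mul_rpow_of_nonneg _ _ (by norm_num), ENNReal.ofReal_pow Real.pi_pos.le,
        ← ENNReal.rpow_two, ← ENNReal.rpow_mul]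
      norm_num

lemma memLp_two_inv_add {t : ℝ} (ht : 0 < t) :
    MemLp (fun s : ℝ => 1 / (s + t)) 2 halfLine := by
  rw [memLp_two_iff_integrable_sq (by measurability)]
  have h := integrableOn_add_rpow_Ioi_of_lt (a := -2) (c := 0) (m := t) (by norm_num) (by linarith)
  refine h.congr ?_
  filter_upwards [ae_halfLine_pos] with s hs
  rw [Real.rpow_neg (by positivity)]
  norm_num

/-! ### Integral equations with a kernel dominated by the Stieltjes kernel. -/

/-- The kernel `k` on `(0, ∞)²` is measurable and dominated by `w(s) / (s + t)` with a weight
`0 ≤ w ≤ 1`. -/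
structure StieltjesBound (k : ℝ → ℝ → ℝ) (w : ℝ → ℝ) : Prop where
  measurable : Measurable (Function.uncurry k)
  measurable_weight : Measurable w
  weight_nonneg : ∀ s, 0 < s → 0 ≤ w s
  weight_le_one : ∀ s, 0 < s → w s ≤ 1
  bound : ∀ t s, 0 < t → 0 < s → |k t s| ≤ w s / (s + t)

namespace StieltjesBound

variable {k : ℝ → ℝ → ℝ} {w : ℝ → ℝ} (H : StieltjesBound k w) {f : ℝ → ℝ}

include H

lemma memLp_weight_mul (hf : MemLp f 2 halfLine) : MemLp (fun s => w s * f s) 2 halfLine := by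
  refine hf.of_le (H.measurable_weight.aestronglyMeasurable.mul hf.1) ?_
  filter_upwards [ae_halfLine_pos] with s hs
  rw [norm_mul, Real.norm_of_nonneg (H.weight_nonneg s hs)]
  exact mul_le_of_le_one_left (norm_nonneg _) (H.weight_le_one s hs)

lemma eLpNorm_weight_mul_le : eLpNorm (fun s => w s * f s) 2 halfLine ≤ eLpNorm f 2 halfLine := by
  refine eLpNorm_mono_ae ?_
  filter_upwards [ae_halfLine_pos] with s hs
  rw [norm_mul, Real.norm_of_nonneg (H.weight_nonneg s hs)]
  exact mul_le_of_le_one_left (norm_nonneg _) (H.weight_le_one s hs)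

lemma norm_mul_le {t s : ℝ} (ht : 0 < t) (hs : 0 < s) :
    ‖k t s * f s‖ ≤ ‖1 / (s + t) * (w s * f s)‖ := by
  have h1 := H.bound t s ht hs
  have h2 : (0 : ℝ) ≤ 1 / (s + t) := by positivity
  rw [norm_mul, norm_mul, norm_mul, Real.norm_eq_abs (k t s),
    Real.norm_of_nonneg (H.weight_nonneg s hs), Real.norm_of_nonneg h2, ← mul_assoc]
  refine mul_le_mul_of_nonneg_right (h1.trans (le_of_eq ?_)) (norm_nonneg (f s))
  ring

/-- Only `w * f` has to be square integrable, not `f`: this admits functions such as 1 and e^{jt},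
which enter L² only after multiplication by the weight. -/
lemma integrable_mul {t : ℝ} (ht : 0 < t) (hfm : AEStronglyMeasurable f halfLine)
    (hf : MemLp (fun s => w s * f s) 2 halfLine) :
    Integrable (fun s => k t s * f s) halfLine := by
  have h1 : Integrable (fun s => 1 / (s + t) * (w s * f s)) halfLine :=
    (memLp_two_inv_add ht).integrable_mul hf
  refine h1.mono ?_ ?_
  · exact (H.measurable.comp (measurable_const.prodMk measurable_id)).aestronglyMeasurable.mul hfm
  · filter_upwards [ae_halfLine_pos] with s hs using H.norm_mul_le ht hs

lemma enorm_integral_le {t : ℝ} (ht : 0 < t) :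
    ‖∫ s, k t s * f s ∂halfLine‖ₑ ≤
      ∫⁻ s, ENNReal.ofReal (1 / (s + t)) * ‖w s * f s‖ₑ ∂halfLine := by
  refine (enorm_integral_le_lintegral_enorm _).trans (lintegral_mono_ae ?_)
  filter_upwards [ae_halfLine_pos] with s hs
  have h2 : (0 : ℝ) ≤ 1 / (s + t) := by positivity
  rw [← Real.enorm_of_nonneg h2, ← enorm_mul]
  exact enorm_le_iff_norm_le.2 (H.norm_mul_le ht hs)

lemma eLpNorm_integral_le (hfm : AEStronglyMeasurable f halfLine) :
    eLpNorm (fun t => ∫ s, k t s * f s ∂halfLine) 2 halfLine ≤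
      ENNReal.ofReal Real.pi * eLpNorm (fun s => w s * f s) 2 halfLine :=
  eLpNorm_le_of_stieltjes (H.measurable_weight.aestronglyMeasurable.mul hfm)
    fun _ ht => H.enorm_integral_le ht

lemma memLp_integral (hfm : AEStronglyMeasurable f halfLine)
    (hf : MemLp (fun s => w s * f s) 2 halfLine) :
    MemLp (fun t => ∫ s, k t s * f s ∂halfLine) 2 halfLine := by
  refine ⟨?_, (H.eLpNorm_integral_le hfm).trans_lt
    (ENNReal.mul_lt_top ENNReal.ofReal_lt_top hf.2)⟩
  have : AEStronglyMeasurable (fun p : ℝ × ℝ => k p.1 p.2 * f p.2) (halfLine.prod halfLine) :=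
    H.measurable.aestronglyMeasurable.mul hfm.comp_snd
  exact this.integral_prod_right'

/-- A function in `L²` that solves the homogeneous equation vanishes. -/
lemma eq_zero_of_homogeneous {c : ℝ} (hc : |c| * Real.pi < 1) (hf : MemLp f 2 halfLine)
    (heq : ∀ t, 0 < t → f t = c * ∫ s, k t s * f s ∂halfLine) {t : ℝ} (ht : 0 < t) : f t = 0 := by
  have h1 : eLpNorm f 2 halfLine ≤ ENNReal.ofReal (|c| * Real.pi) * eLpNorm f 2 halfLine := by
    calc eLpNorm f 2 halfLine
        = eLpNorm (c • fun t => ∫ s, k t s * f s ∂halfLine) 2 halfLine := by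
          apply eLpNorm_congr_ae
          filter_upwards [ae_halfLine_pos] with t ht using heq t ht
      _ ≤ ‖c‖ₑ * (ENNReal.ofReal Real.pi * eLpNorm f 2 halfLine) := by
          rw [eLpNorm_const_smul]
          gcongr
          exact (H.eLpNorm_integral_le hf.1).trans (by gcongr; exact H.eLpNorm_weight_mul_le)
      _ = _ := by
          rw [ENNReal.ofReal_mul (abs_nonneg c), ← mul_assoc, Real.enorm_eq_ofReal_abs]
  have h2 : eLpNorm f 2 halfLine = 0 := by
    by_contra h0
    have h3 : ENNReal.ofReal (|c| * Real.pi) * eLpNorm f 2 halfLine < 1 * eLpNorm f 2 halfLine :=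
      ENNReal.mul_lt_mul_left h0 hf.2.ne (by rw [ENNReal.ofReal_lt_one]; exact hc)
    rw [one_mul] at h3
    exact absurd h1 (not_le.2 h3)
  rw [eLpNorm_eq_zero_iff hf.1 (by norm_num)] at h2
  -- So far `f` vanishes only almost everywhere; inserting this into the integral on the right of
  -- the equation gives vanishing at every t > 0.
  rw [heq t ht, integral_eq_zero_of_ae, mul_zero]
  filter_upwards [h2] with s hs
  simp [hs]

/-- Banach's fixed point theorem in L² for the unknown v = f - g, under the map v ↦ c ∫ k (v + g),
whose Lipschitz constant is |c|π. -/
lemma exists_solution {c : ℝ} (hc : |c| * Real.pi < 1) {g : ℝ → ℝ} (hgm : Measurable g)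
    (hg : MemLp (fun s => w s * g s) 2 halfLine) :
    ∃ f : ℝ → ℝ, MemLp (fun t => f t - g t) 2 halfLine ∧
      ∀ t, 0 < t → Integrable (fun s => k t s * f s) halfLine ∧
        f t = c * (∫ s, k t s * f s ∂halfLine) + g t := by
  have hw : ∀ v : Lp ℝ 2 halfLine, MemLp (fun s => w s * (v s + g s)) 2 halfLine := fun v => by
    simp_rw [mul_add]
    exact (H.memLp_weight_mul (Lp.memLp v)).add hg
  have hm : ∀ v : Lp ℝ 2 halfLine, AEStronglyMeasurable (fun s => v s + g s) halfLine := fun v =>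
    (Lp.memLp v).1.add hgm.aestronglyMeasurable
  have hT : ∀ v : Lp ℝ 2 halfLine,
      MemLp (fun t => c * ∫ s, k t s * (v s + g s) ∂halfLine) 2 halfLine := fun v =>
    (H.memLp_integral (hm v) (hw v)).const_mul c
  let Φ : Lp ℝ 2 halfLine → Lp ℝ 2 halfLine := fun v => (hT v).toLp _
  let κ : ℝ≥0 := Real.toNNReal (|c| * Real.pi)
  have hΦ : ContractingWith κ Φ := by
    refine ⟨Real.toNNReal_lt_one.2 hc, fun v v' => ?_⟩
    rw [Lp.edist_toLp_toLp, Lp.edist_def]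
    have e1 : ((fun t => c * ∫ s, k t s * (v s + g s) ∂halfLine) -
        fun t => c * ∫ s, k t s * (v' s + g s) ∂halfLine) =ᵐ[halfLine]
        c • fun t => ∫ s, k t s * (v s - v' s) ∂halfLine := by
      filter_upwards [ae_halfLine_pos] with t ht
      simp only [Pi.sub_apply, Pi.smul_apply, smul_eq_mul]
      rw [← mul_sub, ← integral_sub (H.integrable_mul ht (hm v) (hw v))
        (H.integrable_mul ht (hm v') (hw v'))]
      congr 2
      ext s
      ring
    rw [eLpNorm_congr_ae e1, eLpNorm_const_smul]
    have hvv : AEStronglyMeasurable (fun s => v s - v' s) halfLine :=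
      (Lp.memLp v).1.sub (Lp.memLp v').1
    calc ‖c‖ₑ * eLpNorm (fun t => ∫ s, k t s * (v s - v' s) ∂halfLine) 2 halfLine
        ≤ ‖c‖ₑ * (ENNReal.ofReal Real.pi * eLpNorm (fun s => v s - v' s) 2 halfLine) := by
          gcongr
          exact (H.eLpNorm_integral_le hvv).trans (by gcongr; exact H.eLpNorm_weight_mul_le)
      _ = _ := by
          rw [← mul_assoc, Real.enorm_eq_ofReal_abs, ← ENNReal.ofReal_mul (abs_nonneg c)]
          rfl
  let v := hΦ.fixedPoint
  have hv : Φ v = v := hΦ.fixedPoint_isFixedPt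
  -- The fixed point is only a class modulo null sets. Taking the right-hand side of the equation as
  -- the definition of `f` makes the equation hold at every t > 0.
  let f : ℝ → ℝ := fun t => c * (∫ s, k t s * (v s + g s) ∂halfLine) + g t
  have hfv : (fun s => f s) =ᵐ[halfLine] fun s => v s + g s := by
    have h1 := (hT v).coeFn_toLp
    have h2 : (hT v).toLp _ = v := hv
    rw [h2] at h1
    filter_upwards [h1] with s hs
    simp only [f, ← hs]
  refine ⟨f, ?_, fun t ht => ⟨?_, ?_⟩⟩
  · refine (memLp_congr_ae ?_).2 (Lp.memLp v)
    filter_upwards [hfv] with s hs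
    rw [hs]; ring
  · refine (H.integrable_mul ht (hm v) (hw v)).congr ?_
    filter_upwards [hfv] with s hs
    rw [hs]
  · have : ∫ s, k t s * f s ∂halfLine = ∫ s, k t s * (v s + g s) ∂halfLine := by
      apply integral_congr_ae
      filter_upwards [hfv] with s hs
      rw [hs]
    rw [this]

omit H in
/-- For a real kernel, being a solution can be expressed with real integrals. -/
lemma isSolution_iff {c : ℝ} {K : ℝ → ℝ → ℂ} {g f : ℝ → ℝ}
    (hK : ∀ t s, 0 < t → 0 < s → K t s = (k t s : ℂ)) :
    IsSolution c K g f ↔ MemLp (fun t => f t - g t) 2 halfLine ∧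
      ∀ t, 0 < t → Integrable (fun s => k t s * f s) halfLine ∧
        f t = c * (∫ s, k t s * f s ∂halfLine) + g t := by
  unfold IsSolution
  refine and_congr Iff.rfl (forall₂_congr fun t ht => ?_)
  have e : (fun s => K t s * (f s : ℂ)) =ᵐ[halfLine] fun s => ((k t s * f s : ℝ) : ℂ) := by
    filter_upwards [ae_halfLine_pos] with s hs
    rw [hK t s ht hs]; push_cast; rfl
  refine and_congr ?_ ?_
  · rw [IntegrableOn, integrable_congr e]
    refine ⟨fun h => by simpa using h.re, fun h => h.ofReal⟩
  · have e2 : ∫ s, K t s * (f s : ℂ) ∂halfLine = ((∫ s, k t s * f s ∂halfLine : ℝ) : ℂ) := by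
      rw [integral_congr_ae e, ← integral_complex_ofReal]
    rw [e2]
    norm_cast

lemma exists_uniqueSolution {c : ℝ} {K : ℝ → ℝ → ℂ} {g : ℝ → ℝ}
    (hK : ∀ t s, 0 < t → 0 < s → K t s = (k t s : ℂ)) (hc : |c| * Real.pi < 1)
    (hgm : Measurable g) (hg : MemLp (fun s => w s * g s) 2 halfLine) :
    ∃ f : ℝ → ℝ, IsUniqueSolution c K g f := by
  obtain ⟨f, hf⟩ := H.exists_solution hc hgm hg
  refine ⟨f, (isSolution_iff hK).2 hf, fun f' hf' t ht => ?_⟩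
  rw [isSolution_iff hK] at hf'
  -- The inhomogeneous terms cancel in the difference of two solutions, so it lies in L² and solves
  -- the homogeneous equation.
  have h1 : MemLp (fun t => f' t - f t) 2 halfLine := by
    refine (memLp_congr_ae (ae_of_all _ fun t => ?_)).1 (hf'.1.sub hf.1)
    simp
  have h2 := H.eq_zero_of_homogeneous hc h1 (fun t ht => ?_) ht
  · linarith
  · rw [(hf'.2 t ht).2, (hf.2 t ht).2]
    simp_rw [mul_sub]
    rw [integral_sub (hf'.2 t ht).1 (hf.2 t ht).1]
    ring

end StieltjesBound

/-! ### L² norms and exponential weights. -/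

/-- The norm of `L²(0, ∞)`. -/
def l2norm (f : ℝ → ℝ) : ℝ := (eLpNorm f 2 halfLine).toReal

lemma l2norm_nonneg (f : ℝ → ℝ) : 0 ≤ l2norm f := ENNReal.toReal_nonneg

/-- Finiteness of the larger norm is essential, since `toReal` sends an infinite norm to 0. -/
lemma l2norm_mono {f g : ℝ → ℝ} (hg : MemLp g 2 halfLine) (h : ∀ s, 0 < s → |f s| ≤ |g s|) :
    l2norm f ≤ l2norm g := by
  refine ENNReal.toReal_mono hg.2.ne (eLpNorm_mono_ae ?_)
  filter_upwards [ae_halfLine_pos] with s hs using h s hs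

lemma l2norm_add_le {f g : ℝ → ℝ} (hf : MemLp f 2 halfLine) (hg : MemLp g 2 halfLine) :
    l2norm (fun s => f s + g s) ≤ l2norm f + l2norm g := by
  unfold l2norm
  rw [← ENNReal.toReal_add hf.2.ne hg.2.ne]
  exact ENNReal.toReal_mono (ENNReal.add_ne_top.2 ⟨hf.2.ne, hg.2.ne⟩)
    (eLpNorm_add_le hf.1 hg.1 (by norm_num))

lemma l2norm_const_mul (c : ℝ) (f : ℝ → ℝ) : l2norm (fun s => c * f s) = |c| * l2norm f := by
  unfold l2norm
  have : (fun s => c * f s) = c • f := rfl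
  rw [this, eLpNorm_const_smul, ENNReal.toReal_mul]
  simp

lemma l2norm_sq {f : ℝ → ℝ} (hf : MemLp f 2 halfLine) :
    l2norm f ^ 2 = ∫ s, f s ^ 2 ∂halfLine := by
  unfold l2norm
  rw [eLpNorm_two_eq, integral_eq_lintegral_of_nonneg_ae (ae_of_all _ fun s => sq_nonneg _)
    (hf.1.pow 2), ← ENNReal.toReal_pow, ← ENNReal.rpow_two, ← ENNReal.rpow_mul]
  norm_num
  congr 1
  congr 1
  ext s
  rw [← ofReal_norm, ← ENNReal.ofReal_pow (norm_nonneg _)]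
  simp

lemma integral_abs_mul_le {f g : ℝ → ℝ} (hf : MemLp f 2 halfLine) (hg : MemLp g 2 halfLine) :
    ∫ s, |f s * g s| ∂halfLine ≤ l2norm f * l2norm g := by
  have h1 : ∫ s, |f s * g s| ∂halfLine = ∫ s, ‖f s * g s‖ ∂halfLine := rfl
  have h0 : AEStronglyMeasurable (fun s => f s * g s) halfLine := hf.1.mul hg.1
  rw [h1, integral_norm_eq_lintegral_enorm h0]
  unfold l2norm
  rw [← ENNReal.toReal_mul]
  refine ENNReal.toReal_mono (ENNReal.mul_ne_top hf.2.ne hg.2.ne) ?_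
  have h2 := ENNReal.lintegral_mul_le_Lp_mul_Lq halfLine Real.HolderConjugate.two_two
    hf.1.enorm hg.1.enorm
  rw [eLpNorm_two_eq, eLpNorm_two_eq]
  simpa [enorm_mul] using h2

lemma integral_pow_mul_exp {a : ℝ} (ha : 0 < a) (i : ℕ) :
    ∫ s, s ^ i * Real.exp (-(a * s)) ∂halfLine = i.factorial / a ^ (i + 1) := by
  have h := Real.integral_rpow_mul_exp_neg_mul_Ioi (a := i + 1) (r := a) (by positivity) ha
  simp only [add_sub_cancel_right, Real.rpow_natCast] at h
  rw [h, Real.Gamma_nat_eq_factorial]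
  rw [show (i : ℝ) + 1 = ((i + 1 : ℕ) : ℝ) by push_cast; rfl, Real.rpow_natCast]
  rw [one_div, inv_pow]; field_simp

/-- The integral of a non-integrable function is 0 by convention, whereas the known value is
positive. -/
lemma integrable_pow_mul_exp {a : ℝ} (ha : 0 < a) (i : ℕ) :
    Integrable (fun s => s ^ i * Real.exp (-(a * s))) halfLine := by
  by_contra h
  have h1 := integral_pow_mul_exp ha i
  rw [integral_undef h] at h1
  have : (0 : ℝ) < i.factorial / a ^ (i + 1) := by positivity
  linarith

lemma sq_pow_mul_exp (a : ℝ) (i : ℕ) (s : ℝ) :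
    (s ^ i * Real.exp (-(a * s))) ^ 2 = s ^ (2 * i) * Real.exp (-(2 * a * s)) := by
  rw [mul_pow, ← pow_mul, ← Real.exp_nat_mul]
  congr 2
  · ring
  · push_cast; ring

lemma memLp_pow_mul_exp {a : ℝ} (ha : 0 < a) (i : ℕ) :
    MemLp (fun s => s ^ i * Real.exp (-(a * s))) 2 halfLine := by
  rw [memLp_two_iff_integrable_sq (by fun_prop)]
  simp_rw [sq_pow_mul_exp]
  exact integrable_pow_mul_exp (by positivity) _

lemma memLp_exp {a : ℝ} (ha : 0 < a) : MemLp (fun s => Real.exp (-(a * s))) 2 halfLine := by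
  simpa using memLp_pow_mul_exp ha 0

/-- The decay e^{-ns} of the kernel is spent in three portions: e^{-ns/2} weights the unknown
function, one factor e^{-ns/4} is its partner in Cauchy–Schwarz, and the other e^{-ns/4} absorbs the
growth e^{Ks}. The partner contributes n^{-1/2}. -/
lemma l2norm_exp {n : ℝ} (hn : 0 < n) :
    l2norm (fun s => Real.exp (-(n / 4 * s))) ≤ 2 / √n := by
  have h1 := l2norm_sq (memLp_exp (a := n / 4) (by positivity))
  have h2 : ∫ s, Real.exp (-(n / 4 * s)) ^ 2 ∂halfLine = 2 / n := by
    have := integral_pow_mul_exp (a := 2 * (n / 4)) (by positivity) 0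
    rw [show (fun s : ℝ => s ^ 0 * Real.exp (-(2 * (n / 4) * s))) =
      fun s => (s ^ 0 * Real.exp (-(n / 4 * s))) ^ 2 by
        ext s; rw [sq_pow_mul_exp]] at this
    simp only [pow_zero, one_mul] at this
    rw [this]
    norm_num; field_simp; norm_num
  rw [h2] at h1
  refine abs_le_of_sq_le_sq' ?_ (by positivity) |>.2
  rw [h1, div_pow, Real.sq_sqrt hn.le]
  gcongr; norm_num

/-- Each additional factor s is worth 1/n; this is how the O(s) errors become O(1/n) corrections. -/
lemma l2norm_mul_exp {n : ℝ} (hn : 0 < n) :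
    l2norm (fun s => s * Real.exp (-(n / 4 * s))) ≤ 4 / (n * √n) := by
  have h0 := memLp_pow_mul_exp (a := n / 4) (by positivity) 1
  simp only [pow_one] at h0
  have h1 := l2norm_sq h0
  have h2 : ∫ s, (s * Real.exp (-(n / 4 * s))) ^ 2 ∂halfLine = 16 / n ^ 3 := by
    have := integral_pow_mul_exp (a := 2 * (n / 4)) (by positivity) 2
    rw [show (fun s : ℝ => s ^ 2 * Real.exp (-(2 * (n / 4) * s))) =
      fun s => (s ^ 1 * Real.exp (-(n / 4 * s))) ^ 2 by
        ext s; rw [sq_pow_mul_exp]] at this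
    simp only [pow_one] at this
    rw [this]
    norm_num [Nat.factorial]; field_simp; norm_num
  rw [h2] at h1
  refine abs_le_of_sq_le_sq' ?_ (by positivity) |>.2
  rw [h1, div_pow, mul_pow, Real.sq_sqrt hn.le]
  apply le_of_eq
  rw [show n ^ 3 = n ^ 2 * n by ring]; norm_num

/-- The kernel `1 / (s + t)` itself. -/
lemma stieltjesBound_one : StieltjesBound (fun t s => 1 / (s + t)) (fun _ => 1) where
  measurable := by
    have : Function.uncurry (fun t s : ℝ => 1 / (s + t)) = fun p => 1 / (p.2 + p.1) := rfl
    rw [this]; fun_prop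
  measurable_weight := measurable_const
  weight_nonneg _ _ := zero_le_one
  weight_le_one _ _ := le_rfl
  bound t s ht hs := by rw [abs_of_pos (by positivity)]

lemma memLp_stieltjes {f : ℝ → ℝ} (hf : MemLp f 2 halfLine) :
    MemLp (fun t => ∫ s, 1 / (s + t) * f s ∂halfLine) 2 halfLine :=
  stieltjesBound_one.memLp_integral hf.1 (by simpa using hf)

lemma l2norm_stieltjes_le {f : ℝ → ℝ} (hf : MemLp f 2 halfLine) :
    l2norm (fun t => ∫ s, 1 / (s + t) * f s ∂halfLine) ≤ Real.pi * l2norm f := by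
  have h1 := stieltjesBound_one.eLpNorm_integral_le hf.1
  simp only [one_mul] at h1
  have h2 := ENNReal.toReal_mono (ENNReal.mul_ne_top ENNReal.ofReal_ne_top hf.2.ne) h1
  rwa [ENNReal.toReal_mul, ENNReal.toReal_ofReal Real.pi_pos.le] at h2

/-- The limit kernel `e^{-s} / (s + t)`. -/
lemma stieltjesBound_limit :
    StieltjesBound (fun t s => Real.exp (-s) / (s + t)) (fun s => Real.exp (-s)) where
  measurable := by
    have : Function.uncurry (fun t s : ℝ => Real.exp (-s) / (s + t)) =
      fun p => Real.exp (-p.2) / (p.2 + p.1) := rfl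
    rw [this]; fun_prop
  measurable_weight := by fun_prop
  weight_nonneg _ _ := (Real.exp_pos _).le
  weight_le_one s hs := Real.exp_le_one_iff.2 (by linarith)
  bound t s ht hs := by rw [abs_of_pos (by positivity)]

/-! ### The kernel h(s)e^{-ns}/(e^{s+t} - 1) as a perturbation of e^{-ns}/(s+t). -/

/-- The last bound is equivalent to (1 - x)e^x ≤ 1, that is, to 1 - x ≤ e^{-x}. Thus 1/(e^x - 1) has
the singularity 1/x up to a bounded remainder. -/
lemma inv_exp_sub_one_bounds {x : ℝ} (hx : 0 < x) :
    0 < 1 / (Real.exp x - 1) ∧ 1 / (Real.exp x - 1) ≤ 1 / x ∧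
      1 / x - 1 / (Real.exp x - 1) ≤ 1 := by
  have h1 : x + 1 < Real.exp x := Real.add_one_lt_exp hx.ne'
  have h2 : 0 < Real.exp x - 1 := by linarith
  refine ⟨by positivity, one_div_le_one_div_of_le hx (by linarith), ?_⟩
  have h3 : (1 - x) * Real.exp x ≤ 1 := by
    have := Real.one_sub_le_exp_neg x
    calc (1 - x) * Real.exp x ≤ Real.exp (-x) * Real.exp x := by gcongr
      _ = 1 := by rw [← Real.exp_add]; simp
  rw [div_sub_div _ _ hx.ne' h2.ne', div_le_one (by positivity)]
  nlinarith

/-- Measurability and growth assumptions on the factor `h` of the kernel: `h` is real and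
`h(s) = 1 + O(s)`, with an exponential bound at infinity. -/
structure NearOne (hr : ℝ → ℝ) (C K : ℝ) : Prop where
  measurable : Measurable hr
  C_nonneg : 0 ≤ C
  K_nonneg : 0 ≤ K
  bound : ∀ s, 0 < s → |hr s - 1| ≤ C * s * Real.exp (K * s)

namespace NearOne

variable {hr : ℝ → ℝ} {C K : ℝ} (H : NearOne hr C K)

include H

/-- There is no constant in front of the exponential, so that e^{-ns}|h(s)| ≤ 1 as soon as n ≥ C +
K; a constant larger than 1 would spoil the contraction. -/
lemma abs_le {s : ℝ} (hs : 0 < s) : |hr s| ≤ Real.exp ((C + K) * s) := by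
  have h1 := H.bound s hs
  have h2 : |hr s| ≤ 1 + C * s * Real.exp (K * s) := by
    have := abs_sub_abs_le_abs_sub (hr s) 1
    rw [abs_one] at this
    linarith
  have h3 : 1 ≤ Real.exp (K * s) := Real.one_le_exp (mul_nonneg H.K_nonneg hs.le)
  have h4 := Real.add_one_le_exp (C * s)
  calc |hr s| ≤ 1 + C * s * Real.exp (K * s) := h2
    _ ≤ (C * s + 1) * Real.exp (K * s) := by linarith
    _ ≤ Real.exp (C * s) * Real.exp (K * s) := by gcongr
    _ = _ := by rw [← Real.exp_add]; ring_nf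

/-- The kernel `h(s) e^{-ns} / (e^{s+t} - 1)`. -/
lemma stieltjesBound {n : ℝ} (hn : C + K ≤ n) :
    StieltjesBound (fun t s => hr s * Real.exp (-n * s) / (Real.exp (s + t) - 1))
      (fun s => Real.exp (-((n - (C + K)) * s))) where
  measurable := by
    have : Function.uncurry (fun t s : ℝ => hr s * Real.exp (-n * s) / (Real.exp (s + t) - 1)) =
      fun p => hr p.2 * Real.exp (-n * p.2) / (Real.exp (p.2 + p.1) - 1) := rfl
    have h := H.measurable
    rw [this]; fun_prop
  measurable_weight := by fun_prop
  weight_nonneg _ _ := (Real.exp_pos _).le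
  weight_le_one s hs := Real.exp_le_one_iff.2 (by
    have := mul_nonneg (sub_nonneg.2 hn) hs.le
    linarith)
  bound t s ht hs := by
    obtain ⟨h1, h2, -⟩ := inv_exp_sub_one_bounds (add_pos hs ht)
    have e : hr s * Real.exp (-n * s) / (Real.exp (s + t) - 1) =
      Real.exp (-n * s) * (hr s * (1 / (Real.exp (s + t) - 1))) := by ring
    rw [e, abs_mul, abs_mul, abs_of_pos (Real.exp_pos _), abs_of_pos h1]
    calc Real.exp (-n * s) * (|hr s| * (1 / (Real.exp (s + t) - 1)))
        ≤ Real.exp (-n * s) * (Real.exp ((C + K) * s) * (1 / (s + t))) := by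
          gcongr
          exact H.abs_le hs
      _ = _ := by
          rw [← mul_assoc, ← Real.exp_add, mul_one_div]
          ring_nf

/-- The difference consists of (h(s) - 1)/(e^{s+t} - 1), where the factor s cancels the singularity,
and of h-free terms bounded by the previous comparison of 1/x with 1/(e^x - 1). The resulting bound
does not depend on t. -/
lemma kernel_sub_le {n t s : ℝ} (ht : 0 < t) (hs : 0 < s) :
    |hr s * Real.exp (-n * s) / (Real.exp (s + t) - 1) - Real.exp (-n * s) / (s + t)| ≤
      (C + 1) * (Real.exp (-n * s) * Real.exp (K * s)) := by
  obtain ⟨h1, h2, h3⟩ := inv_exp_sub_one_bounds (add_pos hs ht)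
  have e : hr s * Real.exp (-n * s) / (Real.exp (s + t) - 1) - Real.exp (-n * s) / (s + t) =
      Real.exp (-n * s) * ((hr s - 1) * (1 / (Real.exp (s + t) - 1)) -
        (1 / (s + t) - 1 / (Real.exp (s + t) - 1))) := by ring
  rw [e, abs_mul, abs_of_pos (Real.exp_pos _), mul_left_comm]
  refine mul_le_mul_of_nonneg_left ?_ (Real.exp_pos _).le
  have h4 : 1 ≤ Real.exp (K * s) := Real.one_le_exp (mul_nonneg H.K_nonneg hs.le)
  have hC := H.C_nonneg
  have h5 : |(hr s - 1) * (1 / (Real.exp (s + t) - 1))| ≤ C * Real.exp (K * s) := by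
    rw [abs_mul, abs_of_pos h1]
    calc |hr s - 1| * (1 / (Real.exp (s + t) - 1))
        ≤ (C * s * Real.exp (K * s)) * (1 / (s + t)) := by
          gcongr
          exact H.bound s hs
      _ ≤ (C * s * Real.exp (K * s)) * (1 / s) := by gcongr; linarith
      _ = _ := by field_simp
  have h6 : |1 / (s + t) - 1 / (Real.exp (s + t) - 1)| ≤ 1 := by
    rw [abs_of_nonneg (by linarith)]; exact h3
  calc _ ≤ _ := abs_sub _ _
    _ ≤ C * Real.exp (K * s) + 1 := add_le_add h5 h6
    _ ≤ _ := by linarith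

end NearOne

/-! ### Comparison with the dilated solution of the limit equation. -/

/-- `f = c ∫₀^∞ k(·, s) f(s) ds + g` on `(0, ∞)` with `f - g ∈ L²(0, ∞)`, for real kernels. -/
structure RealSolution (c : ℝ) (k : ℝ → ℝ → ℝ) (g f : ℝ → ℝ) : Prop where
  memLp : MemLp (fun t => f t - g t) 2 halfLine
  integrable : ∀ t, 0 < t → Integrable (fun s => k t s * f s) halfLine
  eq : ∀ t, 0 < t → f t = c * (∫ s, k t s * f s ∂halfLine) + g t

lemma IsSolution.realSolution {c : ℝ} {K : ℝ → ℝ → ℂ} {k : ℝ → ℝ → ℝ} {g f : ℝ → ℝ}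
    (h : IsSolution c K g f) (hK : ∀ t s, 0 < t → 0 < s → K t s = (k t s : ℂ)) :
    RealSolution c k g f := by
  rw [StieltjesBound.isSolution_iff hK] at h
  exact ⟨h.1, fun t ht => (h.2 t ht).1, fun t ht => (h.2 t ht).2⟩

lemma memLp_bounded_mul {b f : ℝ → ℝ} (hb : Measurable b) (hb1 : ∀ s, 0 < s → |b s| ≤ 1)
    (hf : MemLp f 2 halfLine) : MemLp (fun s => b s * f s) 2 halfLine := by
  refine hf.of_le (hb.aestronglyMeasurable.mul hf.1) ?_
  filter_upwards [ae_halfLine_pos] with s hs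
  rw [norm_mul]
  exact mul_le_of_le_one_left (norm_nonneg _) (hb1 s hs)

lemma abs_exp_neg_le_one {a s : ℝ} (ha : 0 ≤ a) (hs : 0 < s) : |Real.exp (-(a * s))| ≤ 1 := by
  rw [abs_of_pos (Real.exp_pos _), Real.exp_le_one_iff]
  have := mul_nonneg ha hs.le
  linarith

lemma integrable_comp_mul {f : ℝ → ℝ} {n : ℝ} (hn : 0 < n) (hf : Integrable f halfLine) :
    Integrable (fun s => f (n * s)) halfLine := by
  have := (integrableOn_Ioi_comp_mul_left_iff f 0 hn).2 (by rw [mul_zero]; exact hf)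
  exact this

lemma integral_comp_mul_eq {f : ℝ → ℝ} {n : ℝ} (hn : 0 < n) :
    ∫ s, f (n * s) ∂halfLine = n⁻¹ * ∫ s, f s ∂halfLine := by
  have := integral_comp_mul_left_Ioi f 0 hn
  simpa using this

namespace RealSolution

section limit

variable {c : ℝ} {f : ℝ → ℝ}
  (H : RealSolution c (fun t s => Real.exp (-s) / (s + t)) (fun _ => 1) f)

include H

lemma memLp_exp_mul : MemLp (fun s => Real.exp (-(1 / 2 * s)) * f s) 2 halfLine := by
  have h1 := (memLp_bounded_mul (b := fun s => Real.exp (-(1 / 2 * s))) (by fun_prop)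
    (fun s hs => abs_exp_neg_le_one (by norm_num) hs) H.memLp).add
    (memLp_exp (a := 1 / 2) (by norm_num))
  refine (memLp_congr_ae (ae_of_all _ fun s => ?_)).1 h1
  simp only [Pi.add_apply]
  ring

lemma integrable_mul_exp : Integrable (fun s => f s * Real.exp (-s)) halfLine := by
  have h1 : Integrable (fun s => (Real.exp (-(1 / 2 * s)) * f s) * Real.exp (-(1 / 2 * s)))
    halfLine := H.memLp_exp_mul.integrable_mul (memLp_exp (a := 1 / 2) (by norm_num))
  refine h1.congr (ae_of_all _ fun s => ?_)
  simp only
  rw [show Real.exp (-s) = Real.exp (-(1 / 2 * s)) * Real.exp (-(1 / 2 * s)) by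
    rw [← Real.exp_add]; ring_nf]
  ring

/-- Measurability is read off from the integrable function f(ns)e^{-ns} by multiplying back with
e^{ns}. -/
lemma aestronglyMeasurable_comp_mul {n : ℝ} (hn : 0 < n) :
    AEStronglyMeasurable (fun s => f (n * s)) halfLine := by
  have h1 := (integrable_comp_mul hn H.integrable_mul_exp).1
  have h2 : AEStronglyMeasurable (fun s : ℝ => Real.exp (n * s)) halfLine := by fun_prop
  refine (h1.mul h2).congr (ae_of_all _ fun s => ?_)
  simp only [Pi.mul_apply]
  rw [mul_assoc, ← Real.exp_add]; simp

lemma memLp_exp_mul_comp {n : ℝ} (hn : 0 < n) :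
    MemLp (fun s => Real.exp (-(n / 2 * s)) * f (n * s)) 2 halfLine := by
  have h2 : AEStronglyMeasurable (fun s : ℝ => Real.exp (-(n / 2 * s))) halfLine := by fun_prop
  have h3 : AEStronglyMeasurable (fun s => Real.exp (-(n / 2 * s)) * f (n * s)) halfLine :=
    h2.mul (H.aestronglyMeasurable_comp_mul hn)
  rw [memLp_two_iff_integrable_sq h3]
  refine (integrable_comp_mul hn H.memLp_exp_mul.integrable_sq).congr (ae_of_all _ fun s => ?_)
  simp only
  ring_nf

lemma l2norm_exp_mul_comp {n : ℝ} (hn : 0 < n) :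
    l2norm (fun s => Real.exp (-(n / 2 * s)) * f (n * s)) =
      l2norm (fun s => Real.exp (-(1 / 2 * s)) * f s) / √n := by
  have h1 := l2norm_sq (H.memLp_exp_mul_comp hn)
  have h2 := l2norm_sq H.memLp_exp_mul
  have h3 := integral_comp_mul_eq (f := fun s => (Real.exp (-(1 / 2 * s)) * f s) ^ 2) hn
  rw [← h2] at h3
  have h4 : ∫ s, (Real.exp (-(n / 2 * s)) * f (n * s)) ^ 2 ∂halfLine =
      ∫ s, (Real.exp (-(1 / 2 * (n * s))) * f (n * s)) ^ 2 ∂halfLine := by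
    congr 1; ext s; ring_nf
  rw [h4, h3] at h1
  refine (sq_eq_sq₀ (l2norm_nonneg _) (div_nonneg (l2norm_nonneg _) (Real.sqrt_nonneg _))).1 ?_
  rw [h1, div_pow, Real.sq_sqrt hn.le]
  ring

omit H in
lemma integral_comp {n : ℝ} (hn : 0 < n) :
    ∫ s, Real.exp (-n * s) * f (n * s) ∂halfLine = n⁻¹ * expMoment f := by
  have h3 := integral_comp_mul_eq (f := fun s => f s * Real.exp (-s)) hn
  unfold expMoment
  rw [← h3]
  congr 1; ext s; rw [mul_comm, neg_mul]

/-- The substitution s ↦ ns leaves 1/(s+t) ds invariant and turns e^{-s} into e^{-ns}, so f(n·)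
solves an equation directly comparable with that of u. -/
lemma eq_comp {n : ℝ} (hn : 0 < n) {t : ℝ} (ht : 0 < t) :
    Integrable (fun s => Real.exp (-n * s) / (s + t) * f (n * s)) halfLine ∧
      f (n * t) = c * (∫ s, Real.exp (-n * s) / (s + t) * f (n * s) ∂halfLine) + 1 := by
  have h1 := H.integrable (n * t) (mul_pos hn ht)
  have h2 := H.eq (n * t) (mul_pos hn ht)
  have e : ∀ s, n * (Real.exp (-(n * s)) / (n * s + n * t) * f (n * s)) =
      Real.exp (-n * s) / (s + t) * f (n * s) := by
    intro s
    rw [← mul_add, neg_mul]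
    rcases eq_or_ne (s + t) 0 with h | h
    · simp [h]
    · field_simp
  constructor
  · refine ((integrable_comp_mul hn h1).const_mul n).congr (ae_of_all _ fun s => e s)
  · have h3 := integral_comp_mul_eq
      (f := fun s => Real.exp (-s) / (s + n * t) * f s) hn
    have h4 : ∫ s, Real.exp (-s) / (s + n * t) * f s ∂halfLine =
        ∫ s, Real.exp (-n * s) / (s + t) * f (n * s) ∂halfLine := by
      simp_rw [← e]
      rw [integral_const_mul, h3]
      field_simp
    rw [h2, h4]

end limit

section comparison

variable {c : ℝ} {f u hr : ℝ → ℝ} {C K n : ℝ} {j : ℕ}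
  (Hf : RealSolution c (fun t s => Real.exp (-s) / (s + t)) (fun _ => 1) f)
  (Hh : NearOne hr C K)
  (Hu : RealSolution c (fun t s => hr s * Real.exp (-n * s) / (Real.exp (s + t) - 1))
    (fun t => Real.exp (j * t)) u)
  (hn : 0 < n) (hnj : 4 * (j : ℝ) ≤ n) (hnK : 4 * K ≤ n)

include Hf Hu hn hnj

/-- The unweighted difference is in general not in L², since u behaves like e^{jt} and f(n·) like 1;
for n ≥ 4j the weight e^{-ns/2} dominates both. -/
lemma memLp_exp_mul_sub :
    MemLp (fun s => Real.exp (-(n / 2 * s)) * (u s - f (n * s))) 2 halfLine := by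
  have h1 := (memLp_bounded_mul (b := fun s => Real.exp (-(n / 2 * s))) (by fun_prop)
    (fun s hs => abs_exp_neg_le_one (by positivity) hs) Hu.memLp).add
    (memLp_exp (a := n / 2 - j) (by linarith))
  have h2 := h1.sub (Hf.memLp_exp_mul_comp hn)
  refine (memLp_congr_ae (ae_of_all _ fun s => ?_)).1 h2
  simp only [Pi.add_apply, Pi.sub_apply]
  rw [show Real.exp (-((n / 2 - j) * s)) = Real.exp (-(n / 2 * s)) * Real.exp (j * s) by
    rw [← Real.exp_add]; ring_nf]
  ring

include Hh hnK

/-- The three terms come from subtracting the two equations: the Stieltjes kernel applied to the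
weighted difference itself, the bounded kernel error estimated by Cauchy–Schwarz, and the
discrepancy e^{jt} - 1 ≤ jt e^{jt} of the inhomogeneous terms. -/
lemma exp_mul_abs_sub_le {t : ℝ} (ht : 0 < t) :
    |Real.exp (-(n / 2 * t)) * (u t - f (n * t))| ≤
      |c| * (∫ s, 1 / (s + t) * |Real.exp (-(n / 2 * s)) * (u s - f (n * s))| ∂halfLine) +
      (|c| * ((C + 1) * (2 / √n * (l2norm (fun s => Real.exp (-(n / 2 * s)) * (u s - f (n * s))) +
        l2norm (fun s => Real.exp (-(n / 2 * s)) * f (n * s)))))) * Real.exp (-(n / 4 * t)) +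
      j * (t * Real.exp (-(n / 4 * t))) := by
  have hF := memLp_exp_mul_sub Hf Hu hn hnj
  have hG := Hf.memLp_exp_mul_comp hn
  have hE := memLp_exp (a := n / 4) (by positivity)
  set F := fun s => Real.exp (-(n / 2 * s)) * (u s - f (n * s)) with hFdef
  set G := fun s => Real.exp (-(n / 2 * s)) * f (n * s) with hGdef
  have hC := Hh.C_nonneg
  obtain ⟨hi2, he2⟩ := Hf.eq_comp hn ht
  have hi1 := Hu.integrable t ht
  have he1 := Hu.eq t ht
  -- the pointwise bound on the difference of the integrands
  have hpt : ∀ᵐ s ∂halfLine,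
      |hr s * Real.exp (-n * s) / (Real.exp (s + t) - 1) * u s -
        Real.exp (-n * s) / (s + t) * f (n * s)| ≤
      1 / (s + t) * |F s| +
        (C + 1) * (|Real.exp (-(n / 4 * s)) * F s| + |Real.exp (-(n / 4 * s)) * G s|) := by
    filter_upwards [ae_halfLine_pos] with s hs
    have hk := Hh.kernel_sub_le (n := n) ht hs
    set k := hr s * Real.exp (-n * s) / (Real.exp (s + t) - 1)
    set T := Real.exp (-n * s) / (s + t) with hT
    have hexp : Real.exp (-n * s) = Real.exp (-(n / 2 * s)) * Real.exp (-(n / 2 * s)) := by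
      rw [← Real.exp_add]; ring_nf
    have hexp2 : Real.exp (-n * s) * Real.exp (K * s) ≤
        Real.exp (-(n / 4 * s)) * Real.exp (-(n / 2 * s)) := by
      rw [← Real.exp_add, ← Real.exp_add]
      apply Real.exp_le_exp.2
      nlinarith
    have hle1 : Real.exp (-(n / 2 * s)) ≤ 1 := by
      rw [Real.exp_le_one_iff]
      have : 0 < n / 2 * s := by positivity
      linarith
    have hd1 : |F s| = Real.exp (-(n / 2 * s)) * |u s - f (n * s)| := by
      rw [hFdef]; simp only; rw [abs_mul, abs_of_pos (Real.exp_pos _)]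
    have hd2 : |G s| = Real.exp (-(n / 2 * s)) * |f (n * s)| := by
      rw [hGdef]; simp only; rw [abs_mul, abs_of_pos (Real.exp_pos _)]
    -- The kernel error k - T meets both u - f(n·) and f(n·), so its contribution involves the
    -- unknown norm of F as well as the known norm of G.
    have e : k * u s - T * f (n * s) =
      T * (u s - f (n * s)) + (k - T) * (u s - f (n * s)) + (k - T) * f (n * s) := by ring
    rw [e]
    have b1 : |T * (u s - f (n * s))| ≤ 1 / (s + t) * |F s| := by
      rw [abs_mul, abs_of_pos (by positivity), hd1, hT, hexp]
      calc _ = 1 / (s + t) * (Real.exp (-(n / 2 * s)) *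
            (Real.exp (-(n / 2 * s)) * |u s - f (n * s)|)) := by ring
        _ ≤ _ := by
            gcongr
            exact mul_le_of_le_one_left (by positivity) hle1
    have hk' : |k - T| ≤ (C + 1) * (Real.exp (-(n / 4 * s)) * Real.exp (-(n / 2 * s))) :=
      hk.trans (by gcongr)
    have b2 : |(k - T) * (u s - f (n * s))| ≤ (C + 1) * |Real.exp (-(n / 4 * s)) * F s| := by
      rw [abs_mul, abs_mul (Real.exp (-(n / 4 * s))), hd1, abs_of_pos (Real.exp_pos _)]
      calc _ ≤ _ := mul_le_mul_of_nonneg_right hk' (abs_nonneg _)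
        _ = _ := by ring
    have b3 : |(k - T) * f (n * s)| ≤ (C + 1) * |Real.exp (-(n / 4 * s)) * G s| := by
      rw [abs_mul, abs_mul (Real.exp (-(n / 4 * s))), hd2, abs_of_pos (Real.exp_pos _)]
      calc _ ≤ _ := mul_le_mul_of_nonneg_right hk' (abs_nonneg _)
        _ = _ := by ring
    refine (abs_add_three _ _ _).trans ((add_le_add_three b1 b2 b3).trans (le_of_eq ?_))
    ring
  have hFi : Integrable (fun s => 1 / (s + t) * |F s|) halfLine :=
    (memLp_two_inv_add ht).integrable_mul hF.abs
  have hFi2 : Integrable (fun s => |Real.exp (-(n / 4 * s)) * F s|) halfLine :=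
    (hE.integrable_mul hF).abs
  have hGi2 : Integrable (fun s => |Real.exp (-(n / 4 * s)) * G s|) halfLine :=
    (hE.integrable_mul hG).abs
  have hint : |∫ s, (hr s * Real.exp (-n * s) / (Real.exp (s + t) - 1) * u s -
        Real.exp (-n * s) / (s + t) * f (n * s)) ∂halfLine| ≤
      (∫ s, 1 / (s + t) * |F s| ∂halfLine) +
        (C + 1) * (2 / √n * (l2norm F + l2norm G)) := by
    calc _ ≤ ∫ s, |hr s * Real.exp (-n * s) / (Real.exp (s + t) - 1) * u s -
        Real.exp (-n * s) / (s + t) * f (n * s)| ∂halfLine := abs_integral_le_integral_abs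
      _ ≤ ∫ s, (1 / (s + t) * |F s| + (C + 1) *
          (|Real.exp (-(n / 4 * s)) * F s| + |Real.exp (-(n / 4 * s)) * G s|)) ∂halfLine :=
          integral_mono_ae (hi1.sub hi2).abs (hFi.add ((hFi2.add hGi2).const_mul _)) hpt
      _ = (∫ s, 1 / (s + t) * |F s| ∂halfLine) + (C + 1) *
          ((∫ s, |Real.exp (-(n / 4 * s)) * F s| ∂halfLine) +
            ∫ s, |Real.exp (-(n / 4 * s)) * G s| ∂halfLine) := by
          have h12 : Integrable (fun s => (C + 1) * (|Real.exp (-(n / 4 * s)) * F s| +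
            |Real.exp (-(n / 4 * s)) * G s|)) halfLine := (hFi2.add hGi2).const_mul _
          rw [integral_add hFi h12, integral_const_mul, integral_add hFi2 hGi2]
      _ ≤ _ := by
          rw [mul_add (2 / √n)]
          have hN := l2norm_exp hn
          gcongr
          · exact (integral_abs_mul_le hE hF).trans
              (mul_le_mul_of_nonneg_right hN (l2norm_nonneg _))
          · exact (integral_abs_mul_le hE hG).trans
              (mul_le_mul_of_nonneg_right hN (l2norm_nonneg _))
  have hjt : |Real.exp (j * t) - 1| ≤ j * t * Real.exp (j * t) := by
    have h0 : 0 ≤ (j : ℝ) * t := by positivity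
    rw [abs_of_nonneg (by linarith [Real.one_le_exp h0])]
    have h1 := Real.one_sub_le_exp_neg (j * t)
    have h2 : (1 - j * t) * Real.exp (j * t) ≤ 1 := by
      calc _ ≤ Real.exp (-(j * t)) * Real.exp (j * t) := by gcongr
        _ = 1 := by rw [← Real.exp_add]; simp
    linarith
  have hdiff : u t - f (n * t) = c * (∫ s, (hr s * Real.exp (-n * s) / (Real.exp (s + t) - 1) * u s
      - Real.exp (-n * s) / (s + t) * f (n * s)) ∂halfLine) + (Real.exp (j * t) - 1) := by
    rw [integral_sub hi1 hi2, he1, he2]; ring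
  have hle1 : Real.exp (-(n / 2 * t)) ≤ 1 := by
    rw [Real.exp_le_one_iff]
    have : 0 < n / 2 * t := by positivity
    linarith
  have hle2 : Real.exp (-(n / 2 * t)) ≤ Real.exp (-(n / 4 * t)) := by
    apply Real.exp_le_exp.2
    have : 0 < n * t := by positivity
    linarith
  have hle3 : Real.exp (-(n / 2 * t)) * Real.exp (j * t) ≤ Real.exp (-(n / 4 * t)) := by
    rw [← Real.exp_add]
    apply Real.exp_le_exp.2
    nlinarith
  have hI0 : 0 ≤ ∫ s, 1 / (s + t) * |F s| ∂halfLine := by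
    apply integral_nonneg_of_ae
    filter_upwards [ae_halfLine_pos] with s hs
    simp only [Pi.zero_apply]
    positivity
  have hM0 : 0 ≤ (C + 1) * (2 / √n * (l2norm F + l2norm G)) := by
    have := l2norm_nonneg F
    have := l2norm_nonneg G
    positivity
  set I := ∫ s, 1 / (s + t) * |F s| ∂halfLine
  set M := (C + 1) * (2 / √n * (l2norm F + l2norm G))
  rw [abs_mul, abs_of_pos (Real.exp_pos _), hdiff]
  calc _ ≤ Real.exp (-(n / 2 * t)) * (|c| * (I + M) + j * t * Real.exp (j * t)) := by
        gcongr
        refine (abs_add_le _ _).trans (add_le_add ?_ hjt)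
        rw [abs_mul]
        gcongr
    _ = Real.exp (-(n / 2 * t)) * (|c| * I) + (|c| * M) * Real.exp (-(n / 2 * t)) +
        j * (t * (Real.exp (-(n / 2 * t)) * Real.exp (j * t))) := by ring
    _ ≤ 1 * (|c| * I) + (|c| * M) * Real.exp (-(n / 4 * t)) +
        j * (t * Real.exp (-(n / 4 * t))) := by gcongr
    _ = _ := by ring

/-- The L² norm of the pointwise bound. The first term keeps the factor |c|π < 1; the kernel error
acquires 4/n as the product of two factors 2/√n, one from the integral in s and one from the norm in
t. -/
lemma l2norm_sub_le :
    l2norm (fun s => Real.exp (-(n / 2 * s)) * (u s - f (n * s))) ≤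
      |c| * Real.pi * l2norm (fun s => Real.exp (-(n / 2 * s)) * (u s - f (n * s))) +
      4 * |c| * (C + 1) / n * (l2norm (fun s => Real.exp (-(n / 2 * s)) * (u s - f (n * s))) +
        l2norm (fun s => Real.exp (-(1 / 2 * s)) * f s) / √n) + j * (4 / (n * √n)) := by
  have hF := memLp_exp_mul_sub Hf Hu hn hnj
  have hE := memLp_exp (a := n / 4) (by positivity)
  have hE1 : MemLp (fun s => s * Real.exp (-(n / 4 * s))) 2 halfLine := by
    simpa using memLp_pow_mul_exp (a := n / 4) (by positivity) 1
  have hpt := fun t ht => exp_mul_abs_sub_le Hf Hh Hu hn hnj hnK (t := t) ht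
  rw [Hf.l2norm_exp_mul_comp hn] at hpt
  have hC := Hh.C_nonneg
  set F := fun s => Real.exp (-(n / 2 * s)) * (u s - f (n * s)) with hFdef
  set a := l2norm (fun s => Real.exp (-(1 / 2 * s)) * f s) with ha
  have ha0 : 0 ≤ a := l2norm_nonneg _
  have hF0 : 0 ≤ l2norm F := l2norm_nonneg _
  have hA := (memLp_stieltjes hF.abs).const_mul |c|
  set M := |c| * ((C + 1) * (2 / √n * (l2norm F + a / √n))) with hM
  have hM0 : 0 ≤ M := by positivity
  have hB := hE.const_mul M
  have hD := hE1.const_mul (j : ℝ)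
  have h1 := l2norm_mono ((hA.add hB).add hD) (f := F) (fun t ht => (hpt t ht).trans (le_abs_self _))
  refine h1.trans ((l2norm_add_le (hA.add hB) hD).trans (add_le_add
    ((l2norm_add_le hA hB).trans (add_le_add ?_ ?_)) ?_))
  · rw [l2norm_const_mul, abs_abs, mul_assoc]
    gcongr
    refine (l2norm_stieltjes_le hF.abs).trans (le_of_eq ?_)
    congr 1
    have := l2norm_mono (f := |F|) hF (fun s _ => by simp)
    have := l2norm_mono (f := F) hF.abs (fun s _ => by simp)
    exact le_antisymm ‹_› ‹_›
  · rw [l2norm_const_mul, abs_of_nonneg hM0]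
    refine (mul_le_mul_of_nonneg_left (l2norm_exp hn) hM0).trans (le_of_eq ?_)
    rw [hM]
    have : √n * √n = n := Real.mul_self_sqrt hn.le
    rw [← this]
    simp only [Real.sqrt_mul_self (Real.sqrt_nonneg n)]
    field_simp
    ring
  · rw [l2norm_const_mul, Nat.abs_cast]
    gcongr
    exact l2norm_mul_exp hn

end comparison

end RealSolution

/-! ### Asymptotics of the Cauchy-type integrals. -/

/-- Since z e^s - 1 = e^s (z - e^{-s}) and e^{-s} lies in [0,1] for s ≥ 0, the distance from z to
[0,1] serves as ρ. -/
lemma exists_lower_bound {z : ℂ} (hz : z ∉ Complex.ofReal '' Icc (0 : ℝ) 1) :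
    ∃ ρ : ℝ, 0 < ρ ∧ ∀ s : ℝ, 0 ≤ s → ρ * Real.exp s ≤ ‖z * (Real.exp s : ℂ) - 1‖ := by
  have hcl : IsClosed (Complex.ofReal '' Icc (0 : ℝ) 1) :=
    (isCompact_Icc.image Complex.continuous_ofReal).isClosed
  have hne : (Complex.ofReal '' Icc (0 : ℝ) 1).Nonempty := ⟨_, 0, by simp, rfl⟩
  refine ⟨Metric.infDist z (Complex.ofReal '' Icc (0 : ℝ) 1),
    (hcl.notMem_iff_infDist_pos hne).1 hz, fun s hs => ?_⟩
  have h1 : Metric.infDist z (Complex.ofReal '' Icc (0 : ℝ) 1) ≤ dist z (Real.exp (-s) : ℝ) :=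
    Metric.infDist_le_dist_of_mem ⟨_, ⟨(Real.exp_pos _).le, Real.exp_le_one_iff.2 (by linarith)⟩,
      rfl⟩
  have h2 : z * (Real.exp s : ℂ) - 1 = (z - (Real.exp (-s) : ℝ)) * (Real.exp s : ℝ) := by
    rw [sub_mul, ← Complex.ofReal_mul, ← Real.exp_add]; simp
  rw [h2, norm_mul, Complex.norm_real, Real.norm_of_nonneg (Real.exp_pos _).le, ← dist_eq_norm]
  gcongr

/-- The growth of 1 - e^s, at most s e^s in modulus, is compensated by the factor e^s in the lower
bound for z e^s - 1. -/
lemma one_div_sub_one_div_le {z : ℂ} {ρ s : ℝ} (hρ : 0 < ρ) (hs : 0 < s)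
    (h : ∀ s : ℝ, 0 ≤ s → ρ * Real.exp s ≤ ‖z * (Real.exp s : ℂ) - 1‖) :
    ‖1 / (z * (Real.exp s : ℂ) - 1) - 1 / (z - 1)‖ ≤ ‖z‖ * s / ρ ^ 2 := by
  have h0 := h s hs.le
  have h1 := h 0 le_rfl
  simp only [Real.exp_zero, Complex.ofReal_one, mul_one] at h1
  have hes := Real.exp_pos s
  have n1 : z * (Real.exp s : ℂ) - 1 ≠ 0 := norm_pos_iff.1 (lt_of_lt_of_le (by positivity) h0)
  have n2 : z - 1 ≠ 0 := norm_pos_iff.1 (lt_of_lt_of_le hρ h1)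
  have e : 1 / (z * (Real.exp s : ℂ) - 1) - 1 / (z - 1) =
      z * ((1 - Real.exp s : ℝ) : ℂ) / ((z * (Real.exp s : ℂ) - 1) * (z - 1)) := by
    rw [div_sub_div _ _ n1 n2]
    congr 1
    push_cast; ring
  have h3 : |1 - Real.exp s| ≤ s * Real.exp s := by
    rw [abs_of_nonpos (by linarith [Real.one_le_exp hs.le])]
    have h2 : (1 - s) * Real.exp s ≤ 1 := by
      calc _ ≤ Real.exp (-s) * Real.exp s := by gcongr; exact Real.one_sub_le_exp_neg s
        _ = 1 := by rw [← Real.exp_add]; simp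
    linarith
  rw [e, norm_div, norm_mul, norm_mul, Complex.norm_real, Real.norm_eq_abs]
  calc _ ≤ ‖z‖ * (s * Real.exp s) / (ρ * Real.exp s * ρ) := by gcongr
    _ = _ := by field_simp

section

variable {c : ℝ} {f u hr : ℝ → ℝ} {C K n : ℝ} {j : ℕ}
  (Hf : RealSolution c (fun t s => Real.exp (-s) / (s + t)) (fun _ => 1) f)
  (Hh : NearOne hr C K)
  (Hu : RealSolution c (fun t s => hr s * Real.exp (-n * s) / (Real.exp (s + t) - 1))
    (fun t => Real.exp (j * t)) u)
  (hn : 0 < n) (hnj : 4 * (j : ℝ) ≤ n) (hnK : 4 * (C + K) ≤ n)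

include Hh hnK in
lemma norm_cauchyKernel_mul_le {z : ℂ} {ρ s : ℝ} (hρ : 0 < ρ) (hs : 0 < s)
    (h : ∀ s : ℝ, 0 ≤ s → ρ * Real.exp s ≤ ‖z * (Real.exp s : ℂ) - 1‖) (v : ℝ) :
    ‖(hr s : ℂ) * (Real.exp (-n * s) : ℂ) / (z * (Real.exp s : ℂ) - 1) * (v : ℂ)‖ ≤
      1 / ρ * |Real.exp (-(n / 4 * s)) * (Real.exp (-(n / 2 * s)) * v)| := by
  have h0 : ρ ≤ ‖z * (Real.exp s : ℂ) - 1‖ :=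
    (le_mul_of_one_le_right hρ.le (Real.one_le_exp hs.le)).trans (h s hs.le)
  rw [norm_mul, norm_div, norm_mul, Complex.norm_real, Complex.norm_real, Complex.norm_real,
    Real.norm_eq_abs, Real.norm_eq_abs, Real.norm_eq_abs, abs_mul, abs_mul,
    abs_of_pos (Real.exp_pos _), abs_of_pos (Real.exp_pos _), abs_of_pos (Real.exp_pos _),
    ← mul_assoc, ← mul_assoc]
  refine mul_le_mul_of_nonneg_right ?_ (abs_nonneg v)
  calc _ ≤ Real.exp ((C + K) * s) * Real.exp (-n * s) / ρ := by
        gcongr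
        exact Hh.abs_le hs
    _ ≤ Real.exp (-(n / 4 * s)) * Real.exp (-(n / 2 * s)) / ρ := by
        gcongr ?_ / ρ
        rw [← Real.exp_add, ← Real.exp_add]
        apply Real.exp_le_exp.2
        nlinarith
    _ = _ := by ring

include Hf Hh Hu hn hnj hnK

lemma integrable_cauchyKernel_mul {z : ℂ} (hz : z ∉ Complex.ofReal '' Icc (0 : ℝ) 1) :
    Integrable (fun s => (hr s : ℂ) * (Real.exp (-n * s) : ℂ) / (z * (Real.exp s : ℂ) - 1) *
      (u s : ℂ)) halfLine := by
  obtain ⟨ρ, hρ, h⟩ := exists_lower_bound hz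
  have hF := (Hf.memLp_exp_mul_sub Hu hn hnj).add (Hf.memLp_exp_mul_comp hn)
  have hF' : MemLp (fun s => Real.exp (-(n / 2 * s)) * u s) 2 halfLine := by
    refine (memLp_congr_ae (ae_of_all _ fun s => ?_)).1 hF
    simp only [Pi.add_apply]
    ring
  have hE := memLp_exp (a := n / 4) (by positivity)
  have hi : Integrable (fun s => 1 / ρ * |Real.exp (-(n / 4 * s)) *
    (Real.exp (-(n / 2 * s)) * u s)|) halfLine := (hE.integrable_mul hF').abs.const_mul _
  have hum : AEStronglyMeasurable u halfLine := by
    have h1 : AEStronglyMeasurable (fun t : ℝ => Real.exp (j * t)) halfLine := by fun_prop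
    refine (Hu.memLp.1.add h1).congr (ae_of_all _ fun s => ?_)
    simp
  refine hi.mono' ?_ ?_
  · have hm := Hh.measurable
    refine AEStronglyMeasurable.mul ?_ (Complex.continuous_ofReal.comp_aestronglyMeasurable hum)
    exact Measurable.aestronglyMeasurable (by fun_prop)
  · filter_upwards [ae_halfLine_pos] with s hs
    exact norm_cauchyKernel_mul_le Hh hnK hρ hs h (u s)

/-- With u = (u - f(n·)) + f(n·), the first part costs 2/√n times the norm of the weighted
difference. In the second part, replacing h by 1 and z e^s - 1 by z - 1 is an error O(s), worth an
additional 1/n; what is left is exactly the leading term. -/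
lemma norm_cauchy_sub_le {z : ℂ} (hz : z ∉ Complex.ofReal '' Icc (0 : ℝ) 1) {ρ : ℝ} (hρ : 0 < ρ)
    (h : ∀ s : ℝ, 0 ≤ s → ρ * Real.exp s ≤ ‖z * (Real.exp s : ℂ) - 1‖) :
    ‖(∫ s, (hr s : ℂ) * (Real.exp (-n * s) : ℂ) / (z * (Real.exp s : ℂ) - 1) * (u s : ℂ) ∂halfLine)
      - (expMoment f : ℂ) / (z - 1) * (n : ℂ)⁻¹‖ ≤
    1 / ρ * (2 / √n * l2norm (fun s => Real.exp (-(n / 2 * s)) * (u s - f (n * s)))) +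
      (C / ρ + ‖z‖ / ρ ^ 2) * (4 / (n * √n) *
        (l2norm (fun s => Real.exp (-(1 / 2 * s)) * f s) / √n)) := by
  have hF := Hf.memLp_exp_mul_sub Hu hn hnj
  have hG := Hf.memLp_exp_mul_comp hn
  have hE := memLp_exp (a := n / 4) (by positivity)
  have hE1 : MemLp (fun s => s * Real.exp (-(n / 4 * s))) 2 halfLine := by
    simpa using memLp_pow_mul_exp (a := n / 4) (by positivity) 1
  have hGn := Hf.l2norm_exp_mul_comp hn
  have hC := Hh.C_nonneg
  have hint1 := integrable_cauchyKernel_mul Hf Hh Hu hn hnj hnK hz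
  have hGi : Integrable (fun s => Real.exp (-n * s) * f (n * s)) halfLine := by
    refine (integrable_comp_mul hn Hf.integrable_mul_exp).congr (ae_of_all _ fun s => ?_)
    simp only
    rw [mul_comm, neg_mul]
  have hint2 : Integrable (fun s => ((Real.exp (-n * s) * f (n * s) : ℝ) : ℂ) * (1 / (z - 1)))
    halfLine := hGi.ofReal.mul_const _
  have e1 : (expMoment f : ℂ) / (z - 1) * (n : ℂ)⁻¹ =
      ∫ s, ((Real.exp (-n * s) * f (n * s) : ℝ) : ℂ) * (1 / (z - 1)) ∂halfLine := by
    rw [integral_mul_const, integral_complex_ofReal, RealSolution.integral_comp hn]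
    push_cast; ring
  rw [e1, ← integral_sub hint1 hint2]
  have h1 := h 0 le_rfl
  simp only [Real.exp_zero, Complex.ofReal_one, mul_one] at h1
  set F := fun s => Real.exp (-(n / 2 * s)) * (u s - f (n * s)) with hFdef
  set G := fun s => Real.exp (-(n / 2 * s)) * f (n * s) with hGdef
  have hFi : Integrable (fun s => 1 / ρ * |Real.exp (-(n / 4 * s)) * F s|) halfLine :=
    (hE.integrable_mul hF).abs.const_mul _
  have hGi2 : Integrable (fun s => (C / ρ + ‖z‖ / ρ ^ 2) *
      |s * Real.exp (-(n / 4 * s)) * G s|) halfLine :=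
    (hE1.integrable_mul hG).abs.const_mul _
  have hpt : ∀ᵐ s ∂halfLine, ‖(hr s : ℂ) * (Real.exp (-n * s) : ℂ) / (z * (Real.exp s : ℂ) - 1) *
      (u s : ℂ) - ((Real.exp (-n * s) * f (n * s) : ℝ) : ℂ) * (1 / (z - 1))‖ ≤
      1 / ρ * |Real.exp (-(n / 4 * s)) * F s| +
        (C / ρ + ‖z‖ / ρ ^ 2) * |s * Real.exp (-(n / 4 * s)) * G s| := by
    filter_upwards [ae_halfLine_pos] with s hs
    have b1 := norm_cauchyKernel_mul_le Hh hnK hρ hs h (u s - f (n * s))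
    have e : (hr s : ℂ) * (Real.exp (-n * s) : ℂ) / (z * (Real.exp s : ℂ) - 1) *
      (u s : ℂ) - ((Real.exp (-n * s) * f (n * s) : ℝ) : ℂ) * (1 / (z - 1)) =
      (hr s : ℂ) * (Real.exp (-n * s) : ℂ) / (z * (Real.exp s : ℂ) - 1) *
        ((u s - f (n * s) : ℝ) : ℂ) +
      (((hr s - 1 : ℝ) : ℂ) * (1 / (z * (Real.exp s : ℂ) - 1)) +
        (1 / (z * (Real.exp s : ℂ) - 1) - 1 / (z - 1))) *
        ((Real.exp (-n * s) * f (n * s) : ℝ) : ℂ) := by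
      push_cast; ring
    rw [e]
    refine (norm_add_le _ _).trans (add_le_add b1 ?_)
    have h0 : ρ ≤ ‖z * (Real.exp s : ℂ) - 1‖ :=
      (le_mul_of_one_le_right hρ.le (Real.one_le_exp hs.le)).trans (h s hs.le)
    have hK1 : 1 ≤ Real.exp (K * s) := Real.one_le_exp (mul_nonneg Hh.K_nonneg hs.le)
    have b2 : ‖((hr s - 1 : ℝ) : ℂ) * (1 / (z * (Real.exp s : ℂ) - 1)) +
        (1 / (z * (Real.exp s : ℂ) - 1) - 1 / (z - 1))‖ ≤
        (C / ρ + ‖z‖ / ρ ^ 2) * (s * Real.exp (K * s)) := by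
      refine (norm_add_le _ _).trans ?_
      rw [add_mul]
      refine add_le_add ?_ ((one_div_sub_one_div_le hρ hs h).trans ?_)
      · rw [norm_mul, Complex.norm_real, norm_div, norm_one, Real.norm_eq_abs]
        calc _ ≤ (C * s * Real.exp (K * s)) * (1 / ρ) := by
              gcongr
              exact Hh.bound s hs
          _ = _ := by ring
      · calc _ = ‖z‖ / ρ ^ 2 * (s * 1) := by ring
          _ ≤ _ := by gcongr
    have b3 : Real.exp (K * s) * |Real.exp (-n * s) * f (n * s)| ≤
        |Real.exp (-(n / 4 * s)) * G s| := by
      have hexp : Real.exp (K * s) * Real.exp (-n * s) ≤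
          Real.exp (-(n / 4 * s)) * Real.exp (-(n / 2 * s)) := by
        rw [← Real.exp_add, ← Real.exp_add]
        apply Real.exp_le_exp.2
        nlinarith
      have := mul_le_mul_of_nonneg_right hexp (abs_nonneg (f (n * s)))
      simpa only [hGdef, abs_mul, abs_of_pos (Real.exp_pos _), mul_assoc] using this
    rw [norm_mul, Complex.norm_real, Real.norm_eq_abs, mul_assoc s, abs_mul s, abs_of_pos hs]
    calc _ ≤ (C / ρ + ‖z‖ / ρ ^ 2) * (s * Real.exp (K * s)) *
          |Real.exp (-n * s) * f (n * s)| := by gcongr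
      _ = (C / ρ + ‖z‖ / ρ ^ 2) * (s * (Real.exp (K * s) *
          |Real.exp (-n * s) * f (n * s)|)) := by ring
      _ ≤ _ := by gcongr
  calc _ ≤ ∫ s, ‖(hr s : ℂ) * (Real.exp (-n * s) : ℂ) / (z * (Real.exp s : ℂ) - 1) *
      (u s : ℂ) - ((Real.exp (-n * s) * f (n * s) : ℝ) : ℂ) * (1 / (z - 1))‖ ∂halfLine :=
        norm_integral_le_integral_norm _
    _ ≤ ∫ s, (1 / ρ * |Real.exp (-(n / 4 * s)) * F s| +
        (C / ρ + ‖z‖ / ρ ^ 2) * |s * Real.exp (-(n / 4 * s)) * G s|) ∂halfLine :=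
        integral_mono_ae (hint1.sub hint2).norm (hFi.add hGi2) hpt
    _ = 1 / ρ * (∫ s, |Real.exp (-(n / 4 * s)) * F s| ∂halfLine) +
        (C / ρ + ‖z‖ / ρ ^ 2) * ∫ s, |s * Real.exp (-(n / 4 * s)) * G s| ∂halfLine := by
        rw [integral_add hFi hGi2, integral_const_mul, integral_const_mul]
    _ ≤ _ := by
        rw [← hGn]
        gcongr
        · exact (integral_abs_mul_le hE hF).trans
            (mul_le_mul_of_nonneg_right (l2norm_exp hn) (l2norm_nonneg _))
        · exact (integral_abs_mul_le hE1 hG).trans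
            (mul_le_mul_of_nonneg_right (l2norm_mul_exp hn) (l2norm_nonneg _))

end

/-- The `O(n⁻²)` expansion, for a family of solutions. -/
lemma isBigO_cauchy {c : ℝ} (hc : |c| * Real.pi < 1) {f hr : ℝ → ℝ} {C K : ℝ} {j : ℕ}
    (Hf : RealSolution c (fun t s => Real.exp (-s) / (s + t)) (fun _ => 1) f)
    (Hh : NearOne hr C K) {u : ℕ → ℝ → ℝ}
    (Hu : ∀ᶠ n : ℕ in atTop, RealSolution c
      (fun t s => hr s * Real.exp (-(n : ℝ) * s) / (Real.exp (s + t) - 1))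
      (fun t => Real.exp (j * t)) (u n))
    {z : ℂ} (hz : z ∉ Complex.ofReal '' Icc (0 : ℝ) 1) :
    (fun n : ℕ => (∫ s, (hr s : ℂ) * (Real.exp (-(n : ℝ) * s) : ℂ) /
        (z * (Real.exp s : ℂ) - 1) * (u n s : ℂ) ∂halfLine)
      - (expMoment f : ℂ) / (z - 1) * (n : ℂ)⁻¹) =O[atTop] (fun n : ℕ => ((n : ℝ) ^ 2)⁻¹) := by
  obtain ⟨ρ, hρ, h⟩ := exists_lower_bound hz
  set a := l2norm (fun s => Real.exp (-(1 / 2 * s)) * f s) with ha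
  have ha0 : 0 ≤ a := l2norm_nonneg _
  have hC := Hh.C_nonneg
  set κ := |c| * Real.pi with hκ
  set A := 4 * |c| * (C + 1) with hA
  have hA0 : 0 ≤ A := by positivity
  -- For n ≥ 2A/(1-κ) the term (A/n)x takes only half of the margin 1 - κ, so (1-κ)/2 · x ≤ (A a +
  -- 4j)/(n√n); `B` is the constant this gives.
  set B := 2 / (1 - κ) * (A * a + 4 * j) with hB
  rw [isBigO_iff]
  refine ⟨1 / ρ * (2 * B) + (C / ρ + ‖z‖ / ρ ^ 2) * (4 * a), ?_⟩
  have hev := fun x : ℝ => (tendsto_natCast_atTop_atTop (R := ℝ)).eventually (eventually_ge_atTop x)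
  filter_upwards [Hu, eventually_gt_atTop 0, hev (4 * j), hev (4 * (C + K)),
    hev (2 * A / (1 - κ))] with n Hun hn0 hnj hnK hnA
  have hn : (0 : ℝ) < n := by exact_mod_cast hn0
  have hnK' : 4 * K ≤ n := by linarith
  have h1 := Hf.l2norm_sub_le Hh Hun hn hnj hnK'
  have h2 := norm_cauchy_sub_le Hf Hh Hun hn hnj hnK hz hρ h
  rw [← ha] at h1 h2
  set x := l2norm (fun s => Real.exp (-(n / 2 * s)) * (u n s - f (n * s)))
  have hx0 : 0 ≤ x := l2norm_nonneg _
  have hsq : √(n : ℝ) * √n = n := Real.mul_self_sqrt hn.le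
  have hsn : 0 < √(n : ℝ) := Real.sqrt_pos.2 hn
  have hκ1 : 0 < 1 - κ := by linarith
  have hA2 : A / n ≤ (1 - κ) / 2 := by
    rw [div_le_div_iff₀ hn (by norm_num)]
    rw [div_le_iff₀ hκ1] at hnA
    linarith
  have hx : x ≤ B / (n * √n) := by
    have h3 : x ≤ κ * x + (1 - κ) / 2 * x + A / n * (a / √n) + j * (4 / (n * √n)) := by
      calc x ≤ κ * x + A / n * (x + a / √n) + j * (4 / (n * √n)) := h1
        _ = κ * x + A / n * x + A / n * (a / √n) + j * (4 / (n * √n)) := by ring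
        _ ≤ _ := by gcongr
    have h4 : (1 - κ) / 2 * x ≤ (A * a + 4 * j) / (n * √n) := by
      have : (A * a + 4 * j) / (n * √n) = A / n * (a / √n) + j * (4 / (n * √n)) := by
        field_simp
      rw [this]; linarith
    have h5 : B / (n * √n) = 2 / (1 - κ) * ((A * a + 4 * j) / (n * √n)) := by rw [hB]; ring
    rw [h5]
    calc x = 2 / (1 - κ) * ((1 - κ) / 2 * x) := by field_simp
      _ ≤ _ := by gcongr
  have hcast : ((n : ℝ) : ℂ) = (n : ℂ) := by norm_cast
  rw [hcast] at h2
  refine h2.trans ?_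
  rw [Real.norm_of_nonneg (by positivity)]
  calc _ ≤ 1 / ρ * (2 / √n * (B / (n * √n))) +
      (C / ρ + ‖z‖ / ρ ^ 2) * (4 / (n * √n) * (a / √n)) := by gcongr
    _ = 1 / ρ * (2 * B / (n * (√n * √n))) +
      (C / ρ + ‖z‖ / ρ ^ 2) * (4 * a / (n * (√n * √n))) := by
        congr 2 <;> field_simp
    _ = _ := by rw [hsq]; field_simp

/-! ### Reduction of the theorem to the behaviour of h. -/

/-- The contraction factor is |sin(πd)|, and it stays below 1 because cos(πd) does not vanish for
|d| < 1/2. -/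
lemma abs_sin_div_pi_mul_pi_lt_one {d : ℝ} (hd : d ∈ Ioo (-1 / 2 : ℝ) (1 / 2)) :
    |Real.sin (Real.pi * d) / Real.pi| * Real.pi < 1 := by
  rw [abs_div, abs_of_pos Real.pi_pos, div_mul_cancel₀ _ Real.pi_pos.ne']
  have hpi := Real.pi_pos
  have hc : 0 < Real.cos (Real.pi * d) :=
    Real.cos_pos_of_mem_Ioo ⟨by nlinarith [hd.1], by nlinarith [hd.2]⟩
  rw [← sq_lt_one_iff_abs_lt_one]
  nlinarith [Real.sin_sq_add_cos_sq (Real.pi * d)]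

lemma limitKernel_eq (t s : ℝ) : limitKernel t s = ((Real.exp (-s) / (s + t) : ℝ) : ℂ) := rfl

lemma exists_limit_solution {c : ℝ} (hc : |c| * Real.pi < 1) :
    ∃ f : ℝ → ℝ, IsUniqueSolution c limitKernel (fun _ => 1) f :=
  stieltjesBound_limit.exists_uniqueSolution (fun t s _ _ => limitKernel_eq t s) hc
    measurable_const (by simpa using memLp_exp (a := 1) one_pos)

/-- The main conclusion, for either sign of the constant in front of the integral, assuming the
behaviour of the factor `h` of the kernel. -/
lemma exists_solution_family {d : ℝ} {φ : Polynomial ℝ} {q : ℕ} {hr : ℝ → ℝ} {C K : ℝ}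
    (Hh : NearOne hr C K) (hh : ∀ s, 0 < s → h d φ q s = (hr s : ℂ))
    {c : ℝ} (hc : |c| * Real.pi < 1) {f : ℝ → ℝ}
    (Hf : IsSolution c limitKernel (fun _ => 1) f) (j : ℕ) {N : ℕ}
    (hN : 4 * (C + K + j) + 1 ≤ (N : ℝ)) :
    ∃ u : ℕ → ℝ → ℝ,
      (∀ n : ℕ, N ≤ n → IsUniqueSolution c (kernel d φ q n) (fun t => Real.exp (j * t)) (u n)) ∧
      ∀ z : ℂ, z ∉ Complex.ofReal '' Icc (0 : ℝ) 1 →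
        (∀ n : ℕ, N ≤ n → IntegrableOn (cauchyIntegrand d φ q n (u n) z) (Ioi 0)) ∧
        (fun n : ℕ => (c : ℂ) * (∫ s in Ioi (0 : ℝ), cauchyIntegrand d φ q n (u n) z s) -
          (c : ℂ) * ((expMoment f : ℂ) / (z - 1)) * (n : ℂ)⁻¹) =O[atTop]
          (fun n : ℕ => ((n : ℝ) ^ 2)⁻¹) := by
  have Hf' := Hf.realSolution fun t s _ _ => limitKernel_eq t s
  have hC := Hh.C_nonneg
  have hK := Hh.K_nonneg
  have hk : ∀ (n : ℕ) (t s : ℝ), 0 < t → 0 < s → kernel d φ q n t s =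
      ((hr s * Real.exp (-(n : ℝ) * s) / (Real.exp (s + t) - 1) : ℝ) : ℂ) := by
    intro n t s _ hs
    unfold kernel
    rw [hh s hs]
    push_cast
    rfl
  have hbig : ∀ n : ℕ, N ≤ n → 4 * (C + K + j) + 1 ≤ (n : ℝ) := fun n hn =>
    hN.trans (by exact_mod_cast hn)
  have hex : ∀ n : ℕ, ∃ u : ℝ → ℝ, N ≤ n →
      IsUniqueSolution c (kernel d φ q n) (fun t => Real.exp (j * t)) u := by
    intro n
    by_cases hn : N ≤ n
    · have h1 := hbig n hn
      have hj : (0 : ℝ) ≤ j := by positivity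
      obtain ⟨u, hu⟩ := (Hh.stieltjesBound (n := n) (by linarith)).exists_uniqueSolution
        (hk n) hc (g := fun t => Real.exp (j * t)) (by fun_prop) (by
          -- The summand 1 in the threshold keeps this rate positive even when C, K and j all
          -- vanish.
          have := memLp_exp (a := n - (C + K) - j) (by linarith)
          refine (memLp_congr_ae (ae_of_all _ fun s => ?_)).1 this
          rw [← Real.exp_add]; ring_nf)
      exact ⟨u, fun _ => hu⟩
    -- Below the threshold the value is immaterial; it only lets `choose` produce a sequence indexed
    -- by all of ℕ. The threshold is fixed before z appears.
    · exact ⟨0, fun h => absurd h hn⟩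
  choose u hu using hex
  have hRu : ∀ n : ℕ, N ≤ n → RealSolution c
      (fun t s => hr s * Real.exp (-(n : ℝ) * s) / (Real.exp (s + t) - 1))
      (fun t => Real.exp (j * t)) (u n) := fun n hn => (hu n hn).1.realSolution (hk n)
  refine ⟨u, hu, fun z hz => ⟨fun n hn => ?_, ?_⟩⟩
  · have h1 := hbig n hn
    have hj : (0 : ℝ) ≤ j := by positivity
    refine (integrable_cauchyKernel_mul Hf' Hh (hRu n hn) (by linarith) (by linarith)
      (by linarith) hz).congr ?_
    filter_upwards [ae_halfLine_pos] with s hs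
    unfold cauchyIntegrand
    rw [hh s hs]
  · have h1 := (isBigO_cauchy hc Hf' Hh (u := u)
      (by filter_upwards [eventually_ge_atTop N] with n hn using hRu n hn) hz).const_mul_left (c : ℂ)
    refine h1.congr_left fun n => ?_
    rw [mul_sub, ← mul_assoc]
    congr 2
    apply integral_congr_ae
    filter_upwards [ae_halfLine_pos] with s hs
    unfold cauchyIntegrand
    rw [hh s hs]

/-- Reduction of the theorem to the behaviour of `h`. -/
theorem theorem_of_nearOne (d : ℝ) (hd : d ∈ Set.Ioo (-1 / 2 : ℝ) (1 / 2))
    (φ : Polynomial ℝ) (q : ℕ) {hr : ℝ → ℝ} {C K : ℝ}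
    (Hh : NearOne hr C K) (hh : ∀ s, 0 < s → h d φ q s = (hr s : ℂ)) :
    ∃ q₁ p₁ : ℝ → ℝ,
      FGN.IsUniqueSolution (Real.sin (Real.pi * d) / Real.pi) FGN.limitKernel (fun _ => 1) q₁ ∧
      FGN.IsUniqueSolution (-(Real.sin (Real.pi * d) / Real.pi)) FGN.limitKernel (fun _ => 1) p₁ ∧
      IntegrableOn (fun τ => q₁ τ * Real.exp (-τ)) (Set.Ioi 0) ∧
      IntegrableOn (fun τ => p₁ τ * Real.exp (-τ)) (Set.Ioi 0) ∧
      ∀ j : ℕ, j ≤ q + 1 → ∃ (N : ℕ) (u w : ℕ → ℝ → ℝ),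
        (∀ n : ℕ, N ≤ n →
          FGN.IsUniqueSolution (Real.sin (Real.pi * d) / Real.pi) (FGN.kernel d φ q n)
            (fun t => Real.exp (j * t)) (u n) ∧
          FGN.IsUniqueSolution (-(Real.sin (Real.pi * d) / Real.pi)) (FGN.kernel d φ q n)
            (fun t => Real.exp (j * t)) (w n)) ∧
        ∀ z : ℂ, z ∉ Complex.ofReal '' Set.Icc (0 : ℝ) 1 →
          (∀ n : ℕ, N ≤ n →
            IntegrableOn (FGN.cauchyIntegrand d φ q n (u n) z) (Set.Ioi 0) ∧
            IntegrableOn (FGN.cauchyIntegrand d φ q n (w n) z) (Set.Ioi 0)) ∧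
          (fun n : ℕ => FGN.S d φ q j n (u n) z
              - (z ^ j + ((Real.sin (Real.pi * d) / Real.pi : ℝ) : ℂ)
                  * ((FGN.expMoment q₁ : ℂ) / (z - 1)) * (n : ℂ)⁻¹))
            =O[atTop] (fun n : ℕ => ((n : ℝ) ^ 2)⁻¹) ∧
          (fun n : ℕ => FGN.D d φ q j n (w n) z
              - (z ^ j - ((Real.sin (Real.pi * d) / Real.pi : ℝ) : ℂ)
                  * ((FGN.expMoment p₁ : ℂ) / (z - 1)) * (n : ℂ)⁻¹))
            =O[atTop] (fun n : ℕ => ((n : ℝ) ^ 2)⁻¹) := by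
  have hc := abs_sin_div_pi_mul_pi_lt_one hd
  have hc' : |-(Real.sin (Real.pi * d) / Real.pi)| * Real.pi < 1 := by rwa [abs_neg]
  obtain ⟨q₁, hq⟩ := exists_limit_solution hc
  obtain ⟨p₁, hp⟩ := exists_limit_solution hc'
  refine ⟨q₁, p₁, hq, hp,
    (hq.1.realSolution fun t s _ _ => limitKernel_eq t s).integrable_mul_exp,
    (hp.1.realSolution fun t s _ _ => limitKernel_eq t s).integrable_mul_exp, fun j _ => ?_⟩
  obtain ⟨N, hN⟩ := exists_nat_ge (4 * (C + K + j) + 1)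
  obtain ⟨u, hu, hu'⟩ := exists_solution_family Hh hh hc hq.1 j hN
  obtain ⟨w, hw, hw'⟩ := exists_solution_family Hh hh hc' hp.1 j hN
  refine ⟨N, u, w, fun n hn => ⟨hu n hn, hw n hn⟩, fun z hz => ⟨fun n hn =>
    ⟨(hu' z hz).1 n hn, (hw' z hz).1 n hn⟩, ?_, ?_⟩⟩
  · refine (hu' z hz).2.congr_left fun n => ?_
    unfold FGN.S
    ring
  · refine (hw' z hz).2.congr_left fun n => ?_
    unfold FGN.D
    push_cast
    ring

/-! ### Regularity of arg Q⁺(e^{-s}) from the Lindelöf–Wirtinger series. -/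

/-- A term `(σ + 2πik/s)^{-2-2d}` of the normalized Lindelöf–Wirtinger series. -/
def seriesTerm (d σ : ℝ) (k : ℤ) (s : ℝ) : ℂ :=
  ((σ : ℂ) + 2 * Real.pi * Complex.I * k / s) ^ ((-2 - 2 * d : ℝ) : ℂ)

section

variable {d σ s : ℝ} {k : ℤ}

lemma seriesBase_re : ((σ : ℂ) + 2 * Real.pi * Complex.I * k / s).re = σ := by
  have : (σ : ℂ) + 2 * Real.pi * Complex.I * k / s = ⟨σ, 2 * Real.pi * k / s⟩ := by
    apply Complex.ext
    · simp [Complex.div_re]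
    · simp [Complex.div_im]
      rcases eq_or_ne s 0 with h | h
      · simp [h]
      · field_simp
  rw [this]

lemma seriesBase_im : ((σ : ℂ) + 2 * Real.pi * Complex.I * k / s).im = 2 * Real.pi * k / s := by
  simp [Complex.div_im]
  rcases eq_or_ne s 0 with h | h
  · simp [h]
  · field_simp

lemma one_le_norm_seriesBase (hσ : |σ| = 1) :
    1 ≤ ‖(σ : ℂ) + 2 * Real.pi * Complex.I * k / s‖ := by
  have := Complex.abs_re_le_norm ((σ : ℂ) + 2 * Real.pi * Complex.I * k / s)
  rwa [seriesBase_re, hσ] at this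

lemma le_norm_seriesBase (hs : 0 < s) :
    2 * Real.pi * |(k : ℝ)| / s ≤ ‖(σ : ℂ) + 2 * Real.pi * Complex.I * k / s‖ := by
  have := Complex.abs_im_le_norm ((σ : ℂ) + 2 * Real.pi * Complex.I * k / s)
  rwa [seriesBase_im, abs_div, abs_mul, abs_of_pos hs, abs_of_pos Real.two_pi_pos] at this

lemma seriesBase_mem_slitPlane (hs : 0 < s) (hk : k ≠ 0) :
    (σ : ℂ) + 2 * Real.pi * Complex.I * k / s ∈ Complex.slitPlane := by
  right
  rw [seriesBase_im]
  have : (k : ℝ) ≠ 0 := by exact_mod_cast hk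
  have := Real.pi_pos.ne'
  positivity

/-- The exponent `min 1 (1 + 2d)` governing the regularity of `arg Q⁺` at `1`. -/
def regExp (d : ℝ) : ℝ := min 1 (1 + 2 * d)

/-- The base has real part ±1, hence norm at least 1, so the exponent 2+2d may be lowered to 1+α.
This exponent still exceeds 1, which keeps the sum over k convergent, while α ≤ 1. -/
lemma norm_rpow_le (hd : -1 / 2 < d) (hσ : |σ| = 1) (hs : 0 < s) (hk : k ≠ 0) :
    ‖(σ : ℂ) + 2 * Real.pi * Complex.I * k / s‖ ^ (-2 - 2 * d) ≤
      s ^ (1 + regExp d) * |(k : ℝ)| ^ (-(1 + regExp d)) := by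
  have h1 := one_le_norm_seriesBase (σ := σ) (k := k) (s := s) hσ
  have h2 := le_norm_seriesBase (σ := σ) (k := k) hs
  have hk' : 0 < |(k : ℝ)| := abs_pos.2 (by exact_mod_cast hk)
  have h3 : |(k : ℝ)| / s ≤ ‖(σ : ℂ) + 2 * Real.pi * Complex.I * k / s‖ := by
    refine le_trans ?_ h2
    gcongr
    exact le_mul_of_one_le_left hk'.le (by linarith [Real.pi_gt_three])
  have hα : regExp d ≤ 1 + 2 * d := min_le_right _ _
  have hα0 : 0 < regExp d := lt_min one_pos (by linarith)
  calc _ ≤ ‖(σ : ℂ) + 2 * Real.pi * Complex.I * k / s‖ ^ (-(1 + regExp d)) :=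
        Real.rpow_le_rpow_of_exponent_le h1 (by linarith)
    _ ≤ (|(k : ℝ)| / s) ^ (-(1 + regExp d)) :=
        Real.rpow_le_rpow_of_nonpos (by positivity) h3 (by linarith)
    _ = _ := by
        rw [Real.div_rpow hk'.le hs.le, Real.rpow_neg hs.le, div_inv_eq_mul, mul_comm]

lemma norm_seriesTerm_le (hd : -1 / 2 < d) (hσ : |σ| = 1) (hs : 0 < s) (hk : k ≠ 0) :
    ‖seriesTerm d σ k s‖ ≤ s ^ (1 + regExp d) * |(k : ℝ)| ^ (-(1 + regExp d)) := by
  unfold seriesTerm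
  rw [Complex.norm_cpow_real]
  exact norm_rpow_le hd hσ hs hk

/-- Mean value inequality. Differentiating the base gives 2πik/ξ² up to sign, of modulus at most
|base|/ξ; this restores the power of the base lost by differentiation and costs only 1/ξ. -/
lemma norm_seriesTerm_sub_le (hd : -1 / 2 < d) (hσ : |σ| = 1) {r : ℝ} (hr : 0 < r) (hrs : r ≤ s)
    (hk : k ≠ 0) :
    ‖seriesTerm d σ k s - seriesTerm d σ k r‖ ≤
      (2 + 2 * d) * s ^ regExp d * |(k : ℝ)| ^ (-(1 + regExp d)) * (s - r) := by
  have hs : 0 < s := hr.trans_le hrs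
  have hder : ∀ ξ ∈ Icc r s, HasDerivWithinAt (seriesTerm d σ k)
      (((-2 - 2 * d : ℝ) : ℂ) * ((σ : ℂ) + 2 * Real.pi * Complex.I * k / ξ) ^
        (((-2 - 2 * d : ℝ) : ℂ) - 1) * (-(2 * Real.pi * Complex.I * k) / (ξ : ℂ) ^ 2))
      (Icc r s) ξ := by
    intro ξ hξ
    have hξ0 : 0 < ξ := hr.trans_le hξ.1
    have hξc : (ξ : ℂ) ≠ 0 := by exact_mod_cast hξ0.ne'
    have h1 : HasDerivAt (fun ζ : ℂ => (σ : ℂ) + 2 * Real.pi * Complex.I * k / ζ)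
        (-(2 * Real.pi * Complex.I * k) / (ξ : ℂ) ^ 2) (ξ : ℂ) := by
      have h2 := ((hasDerivAt_inv hξc).const_mul (2 * Real.pi * Complex.I * k)).const_add (σ : ℂ)
      simp only [div_eq_mul_inv] at h2 ⊢
      refine h2.congr_deriv ?_
      ring
    exact ((h1.cpow_const (c := ((-2 - 2 * d : ℝ) : ℂ))
      (seriesBase_mem_slitPlane hξ0 hk)).comp_ofReal).hasDerivWithinAt
  have hbound : ∀ ξ ∈ Icc r s, ‖((-2 - 2 * d : ℝ) : ℂ) *
      ((σ : ℂ) + 2 * Real.pi * Complex.I * k / ξ) ^ (((-2 - 2 * d : ℝ) : ℂ) - 1) *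
      (-(2 * Real.pi * Complex.I * k) / (ξ : ℂ) ^ 2)‖ ≤
      (2 + 2 * d) * s ^ regExp d * |(k : ℝ)| ^ (-(1 + regExp d)) := by
    intro ξ hξ
    have hξ0 : 0 < ξ := hr.trans_le hξ.1
    have hα0 : 0 < regExp d := lt_min one_pos (by linarith)
    have h1 := one_le_norm_seriesBase (σ := σ) (k := k) (s := ξ) hσ
    have h2 := le_norm_seriesBase (σ := σ) (k := k) hξ0
    have h3 := norm_rpow_le (σ := σ) hd hσ hξ0 hk
    set v := ‖(σ : ℂ) + 2 * Real.pi * Complex.I * k / ξ‖ with hv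
    have e1 : (((-2 - 2 * d : ℝ) : ℂ) - 1) = ((-2 - 2 * d - 1 : ℝ) : ℂ) := by push_cast; rfl
    have e2 : ‖-(2 * Real.pi * Complex.I * k) / (ξ : ℂ) ^ 2‖ = 2 * Real.pi * |(k : ℝ)| / ξ / ξ := by
      rw [norm_div, norm_neg, norm_mul, norm_mul, norm_mul, norm_pow, Complex.norm_real,
        Complex.norm_real, Complex.norm_I, Complex.norm_intCast]
      simp [abs_of_pos Real.pi_pos, abs_of_pos hξ0]
      field_simp
    rw [e1, norm_mul, norm_mul, Complex.norm_cpow_real, ← hv, e2, Complex.norm_real,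
      Real.norm_eq_abs, abs_of_neg (by linarith)]
    have hv0 : 0 < v := by linarith
    calc -(-2 - 2 * d) * v ^ (-2 - 2 * d - 1) * (2 * Real.pi * |(k : ℝ)| / ξ / ξ)
        ≤ -(-2 - 2 * d) * v ^ (-2 - 2 * d - 1) * (v / ξ) := by
          have : 0 ≤ -(-2 - 2 * d) := by linarith
          gcongr
      _ = (2 + 2 * d) * (v ^ (-2 - 2 * d) / ξ) := by
          rw [Real.rpow_sub_one hv0.ne']
          field_simp
          ring
      _ ≤ (2 + 2 * d) * (ξ ^ (1 + regExp d) * |(k : ℝ)| ^ (-(1 + regExp d)) / ξ) := by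
          gcongr
          linarith
      _ = (2 + 2 * d) * ξ ^ regExp d * |(k : ℝ)| ^ (-(1 + regExp d)) := by
          rw [Real.rpow_add hξ0, Real.rpow_one]
          field_simp
      _ ≤ _ := by
          have := hξ.2
          gcongr
          linarith
  have h := (convex_Icc r s).norm_image_sub_le_of_norm_hasDerivWithin_le hder hbound
    (left_mem_Icc.2 hrs) (right_mem_Icc.2 hrs)
  rwa [Real.norm_of_nonneg (by linarith)] at h

end

/-- The sum over `k ≠ 0` of the real parts of the terms of the two polylogarithm series. -/
def realSeries (d s : ℝ) : ℝ :=
  ∑' k : ℤ, if k = 0 then 0 else (seriesTerm d 1 k s).re + (seriesTerm d (-1) k s).re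

lemma regExp_pos {d : ℝ} (hd : -1 / 2 < d) : 0 < regExp d := lt_min one_pos (by linarith)

lemma summable_regExp {d : ℝ} (hd : -1 / 2 < d) :
    Summable fun k : ℤ => |(k : ℝ)| ^ (-(1 + regExp d)) :=
  Real.summable_abs_int_rpow (by linarith [regExp_pos hd])

lemma tsum_regExp_nonneg (d : ℝ) : 0 ≤ ∑' k : ℤ, |(k : ℝ)| ^ (-(1 + regExp d)) :=
  tsum_nonneg fun _ => by positivity

lemma norm_realSeries_term_le {d s : ℝ} (hd : -1 / 2 < d) (hs : 0 < s) (k : ℤ) :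
    ‖if k = 0 then 0 else (seriesTerm d 1 k s).re + (seriesTerm d (-1) k s).re‖ ≤
      2 * s ^ (1 + regExp d) * |(k : ℝ)| ^ (-(1 + regExp d)) := by
  split_ifs with hk
  · rw [norm_zero]; positivity
  · have h1 := (Complex.abs_re_le_norm _).trans (norm_seriesTerm_le (σ := 1) hd (by simp) hs hk)
    have h2 := (Complex.abs_re_le_norm _).trans (norm_seriesTerm_le (σ := -1) hd (by simp) hs hk)
    rw [Real.norm_eq_abs]
    refine (abs_add_le _ _).trans ?_
    linarith

lemma summable_realSeries {d s : ℝ} (hd : -1 / 2 < d) (hs : 0 < s) :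
    Summable fun k : ℤ => if k = 0 then 0 else (seriesTerm d 1 k s).re +
      (seriesTerm d (-1) k s).re :=
  Summable.of_norm_bounded ((summable_regExp hd).mul_left _) (norm_realSeries_term_le hd hs)

lemma abs_realSeries_le {d s : ℝ} (hd : -1 / 2 < d) (hs : 0 < s) :
    |realSeries d s| ≤ 2 * (∑' k : ℤ, |(k : ℝ)| ^ (-(1 + regExp d))) * s ^ (1 + regExp d) := by
  have h := tsum_of_norm_bounded (((summable_regExp hd).mul_left
    (2 * s ^ (1 + regExp d))).hasSum) (norm_realSeries_term_le hd hs)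
  rw [tsum_mul_left] at h
  refine h.trans (le_of_eq ?_)
  ring

lemma abs_realSeries_sub_le {d r s : ℝ} (hd : -1 / 2 < d) (hr : 0 < r) (hrs : r ≤ s) :
    |realSeries d s - realSeries d r| ≤
      2 * (2 + 2 * d) * (∑' k : ℤ, |(k : ℝ)| ^ (-(1 + regExp d))) * s ^ regExp d * (s - r) := by
  have hs : 0 < s := hr.trans_le hrs
  unfold realSeries
  rw [← (summable_realSeries hd hs).tsum_sub (summable_realSeries hd hr)]
  have hb : ∀ k : ℤ, ‖(if k = 0 then 0 else (seriesTerm d 1 k s).re + (seriesTerm d (-1) k s).re) -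
      (if k = 0 then 0 else (seriesTerm d 1 k r).re + (seriesTerm d (-1) k r).re)‖ ≤
      2 * (2 + 2 * d) * s ^ regExp d * (s - r) * |(k : ℝ)| ^ (-(1 + regExp d)) := by
    intro k
    split_ifs with hk
    · rw [sub_zero, norm_zero]
      have : 0 ≤ s - r := by linarith
      have : 0 ≤ 2 + 2 * d := by linarith
      positivity
    · have h1 := (Complex.abs_re_le_norm _).trans
        (norm_seriesTerm_sub_le (σ := 1) hd (by simp) hr hrs hk)
      have h2 := (Complex.abs_re_le_norm _).trans
        (norm_seriesTerm_sub_le (σ := -1) hd (by simp) hr hrs hk)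
      rw [Complex.sub_re] at h1 h2
      rw [Real.norm_eq_abs, add_sub_add_comm]
      refine (abs_add_le _ _).trans ?_
      linarith
  have h := tsum_of_norm_bounded (((summable_regExp hd).mul_left
    (2 * (2 + 2 * d) * s ^ regExp d * (s - r))).hasSum) hb
  rw [tsum_mul_left] at h
  refine h.trans (le_of_eq ?_)
  ring

/-- The argument is Im log, and a horizontal line at height y ≠ 0 avoids the branch cut and has
|1/ζ| ≤ 1/|y| along it. -/
lemma abs_arg_sub_arg_le {x x' y : ℝ} (hy : y ≠ 0) :
    |Complex.arg ⟨x, y⟩ - Complex.arg ⟨x', y⟩| ≤ |x - x'| / |y| := by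
  have hder : ∀ ξ ∈ (univ : Set ℝ), HasDerivWithinAt (fun ξ : ℝ => Complex.log ((ξ : ℂ) + y * Complex.I))
      (1 / ((ξ : ℂ) + y * Complex.I)) univ ξ := by
    intro ξ _
    have h1 : HasDerivAt (fun ζ : ℂ => Complex.log (ζ + y * Complex.I))
        (1 / ((ξ : ℂ) + y * Complex.I)) (ξ : ℂ) :=
      ((hasDerivAt_id (ξ : ℂ)).add_const _).clog (Or.inr (by simpa using hy))
    exact h1.comp_ofReal.hasDerivWithinAt
  have hbound : ∀ ξ ∈ (univ : Set ℝ), ‖1 / ((ξ : ℂ) + y * Complex.I)‖ ≤ 1 / |y| := by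
    intro ξ _
    rw [norm_div, norm_one]
    have := Complex.abs_im_le_norm ((ξ : ℂ) + y * Complex.I)
    simp only [Complex.add_im, Complex.ofReal_im, Complex.mul_im, Complex.ofReal_re, Complex.I_im,
      Complex.I_re] at this
    have h0 : 0 < |y| := abs_pos.2 hy
    gcongr
    simpa using this
  have h := convex_univ.norm_image_sub_le_of_norm_hasDerivWithin_le hder hbound
    (mem_univ x') (mem_univ x)
  have h2 := (Complex.abs_im_le_norm _).trans h
  rw [Complex.sub_im, Complex.log_im, Complex.log_im, ← Complex.mk_eq_add_mul_I,
    ← Complex.mk_eq_add_mul_I, Real.norm_eq_abs] at h2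
  refine h2.trans (le_of_eq ?_)
  ring

/-- `arg Q⁺(e^{-s})`. -/
def argQ (d s : ℝ) : ℝ :=
  Complex.arg ⟨Real.cos (Real.pi * d) + realSeries d s / (2 * Real.cos (Real.pi * d)),
    -Real.sin (Real.pi * d)⟩

section

variable {d : ℝ} (hd : d ∈ Ioo (-1 / 2 : ℝ) (1 / 2)) (hd0 : d ≠ 0)

include hd

lemma cos_pi_mul_pos : 0 < Real.cos (Real.pi * d) := by
  have hpi := Real.pi_pos
  exact Real.cos_pos_of_mem_Ioo ⟨by nlinarith [hd.1], by nlinarith [hd.2]⟩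

include hd0 in
lemma sin_pi_mul_ne_zero : Real.sin (Real.pi * d) ≠ 0 := by
  have hpi := Real.pi_pos
  rw [Ne, Real.sin_eq_zero_iff_of_lt_of_lt (by nlinarith [hd.1]) (by nlinarith [hd.2])]
  positivity

lemma arg_cos_sub_sin :
    Complex.arg ⟨Real.cos (Real.pi * d), -Real.sin (Real.pi * d)⟩ = -(Real.pi * d) := by
  have hpi := Real.pi_pos
  have h := Complex.arg_cos_add_sin_mul_I (θ := -(Real.pi * d))
    ⟨by nlinarith [hd.2], by nlinarith [hd.1]⟩
  rw [← h, ← Complex.ofReal_cos, ← Complex.ofReal_sin, ← Complex.mk_eq_add_mul_I, Real.cos_neg,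
    Real.sin_neg]

include hd0 in
-- Since d ≠ 0, the imaginary part -sin(πd) in `argQ` is a nonzero constant, so the argument is
-- Lipschitz in the real part and inherits the bounds on the series.
lemma exists_argQ_bounds : ∃ C : ℝ, 0 ≤ C ∧
    (∀ s, 0 < s → |argQ d s + Real.pi * d| ≤ C * s ^ (1 + regExp d)) ∧
    ∀ r s, 0 < r → r ≤ s → |argQ d s - argQ d r| ≤ C * s ^ regExp d * (s - r) := by
  have hsin := sin_pi_mul_ne_zero hd hd0
  have hcos := cos_pi_mul_pos hd
  set Z := ∑' k : ℤ, |(k : ℝ)| ^ (-(1 + regExp d)) with hZ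
  have hZ0 : 0 ≤ Z := tsum_regExp_nonneg d
  have hsin' : 0 < |Real.sin (Real.pi * d)| := abs_pos.2 hsin
  have hd1 : 0 ≤ 2 + 2 * d := by linarith [hd.1]
  set c := (2 * Real.cos (Real.pi * d)) * |Real.sin (Real.pi * d)|
  have hc : 0 < c := by positivity
  have hneg : -Real.sin (Real.pi * d) ≠ 0 := neg_ne_zero.2 hsin
  refine ⟨(2 * Z + 2 * (2 + 2 * d) * Z) / c, by positivity, fun s hs => ?_, fun r s hr hrs => ?_⟩
  · have h1 := abs_arg_sub_arg_le (x := Real.cos (Real.pi * d) +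
      realSeries d s / (2 * Real.cos (Real.pi * d))) (x' := Real.cos (Real.pi * d)) hneg
    rw [arg_cos_sub_sin hd, sub_neg_eq_add, add_sub_cancel_left, abs_neg, abs_div,
      abs_of_pos (by positivity : 0 < 2 * Real.cos (Real.pi * d)), div_div] at h1
    refine h1.trans ?_
    rw [div_mul_eq_mul_div]
    gcongr
    refine (abs_realSeries_le hd.1 hs).trans ?_
    rw [← hZ]
    gcongr
    have : 0 ≤ 2 * (2 + 2 * d) * Z := by positivity
    linarith
  · have h1 := abs_arg_sub_arg_le (x := Real.cos (Real.pi * d) +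
      realSeries d s / (2 * Real.cos (Real.pi * d))) (x' := Real.cos (Real.pi * d) +
      realSeries d r / (2 * Real.cos (Real.pi * d))) hneg
    rw [add_sub_add_left_eq_sub, ← sub_div, abs_neg, abs_div,
      abs_of_pos (by positivity : 0 < 2 * Real.cos (Real.pi * d)), div_div] at h1
    refine h1.trans ?_
    rw [div_mul_eq_mul_div, div_mul_eq_mul_div]
    have : 0 ≤ s - r := by linarith
    have : 0 < s := by linarith
    gcongr
    refine (abs_realSeries_sub_le hd.1 hr hrs).trans ?_
    rw [← hZ]
    gcongr
    linarith

end

lemma abs_argQ_le (d s : ℝ) : |argQ d s| ≤ Real.pi := Complex.abs_arg_le_pi _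

/-! ### Boundary values of the polylogarithm and of Q. -/

/-- Boundary values are defined by `limUnder`; identifying it with a given limit requires the filter
to be nontrivial. -/
instance neBot_upper (t : ℝ) : (𝓝[{z : ℂ | 0 < z.im}] (t : ℂ)).NeBot := by
  rw [← mem_closure_iff_nhdsWithin_neBot, Complex.closure_setOfPred_lt_im]
  simp

instance neBot_lower (t : ℝ) : (𝓝[{z : ℂ | z.im < 0}] (t : ℂ)).NeBot := by
  rw [← mem_closure_iff_nhdsWithin_neBot, Complex.closure_setOfPred_im_lt]
  simp

lemma limPlus_eq {F : ℂ → ℂ} {t : ℝ} {L : ℂ}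
    (h : Tendsto F (𝓝[{z : ℂ | 0 < z.im}] (t : ℂ)) (𝓝 L)) : limPlus F t = L := h.limUnder_eq

lemma limMinus_eq {F : ℂ → ℂ} {t : ℝ} {L : ℂ}
    (h : Tendsto F (𝓝[{z : ℂ | z.im < 0}] (t : ℂ)) (𝓝 L)) : limMinus F t = L := h.limUnder_eq

/-- The imaginary part has modulus at least 2π|k| - π. This gives a summable majorant for the terms
with k ≠ 0 that is uniform in z. -/
lemma abs_le_norm_add_two_pi {ζ : ℂ} (h : |ζ.im| ≤ Real.pi) {k : ℤ} (hk : k ≠ 0) :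
    |(k : ℝ)| ≤ ‖ζ + 2 * Real.pi * Complex.I * k‖ := by
  have h1 := Complex.abs_im_le_norm (ζ + 2 * Real.pi * Complex.I * k)
  have h2 : (ζ + 2 * Real.pi * Complex.I * k).im = ζ.im + 2 * Real.pi * k := by simp
  rw [h2] at h1
  have hk1 : 1 ≤ |(k : ℝ)| := by
    rw [← Int.cast_abs]
    exact_mod_cast Int.one_le_abs hk
  have h3 : |2 * Real.pi * (k : ℝ)| = 2 * Real.pi * |(k : ℝ)| := by
    rw [abs_mul, abs_of_pos Real.two_pi_pos]
  have h4 : |2 * Real.pi * (k : ℝ)| ≤ |ζ.im + 2 * Real.pi * k| + |ζ.im| := by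
    have := abs_sub (ζ.im + 2 * Real.pi * k) ζ.im
    simpa using this
  rw [h3] at h4
  nlinarith [Real.pi_gt_three]

/-- Termwise passage to the limit in the Lindelöf–Wirtinger series. -/
lemma tendsto_wirtinger {d : ℝ} (hd : -1 / 2 < d) {l : Filter ℂ} {ζ : ℂ → ℂ} {x : ℝ} {L : ℂ}
    (hζ : Tendsto ζ l (𝓝 (x : ℂ))) (him : ∀ z, |(ζ z).im| ≤ Real.pi)
    (h0 : Tendsto (fun z => ζ z ^ ((-2 - 2 * d : ℝ) : ℂ)) l (𝓝 L)) :
    Tendsto (fun z => ∑' k : ℤ, (ζ z + 2 * Real.pi * Complex.I * k) ^ ((-2 - 2 * d : ℝ) : ℂ)) l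
      (𝓝 (∑' k : ℤ, if k = 0 then L else
        ((x : ℂ) + 2 * Real.pi * Complex.I * k) ^ ((-2 - 2 * d : ℝ) : ℂ))) := by
  have hsum : Summable fun k : ℤ => |(k : ℝ)| ^ (-(2 + 2 * d)) + if k = 0 then ‖L‖ + 1 else 0 :=
    (Real.summable_abs_int_rpow (by linarith)).add (hasSum_ite_eq 0 _).summable
  refine tendsto_tsum_of_dominated_convergence hsum (fun k => ?_) ?_
  -- The limit of the term k = 0 is an assumption because for x < 0 its base approaches the branch
  -- cut, and the limit depends on the side.
  · by_cases hk : k = 0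
    · simpa [hk] using h0
    · simp only [hk, if_false]
      refine (continuousAt_cpow_const ?_).tendsto.comp (hζ.add_const _)
      right
      have : (k : ℝ) ≠ 0 := by exact_mod_cast hk
      simp [hk, Real.pi_pos.ne']
  · have h1 : ∀ᶠ z in l, ‖ζ z ^ ((-2 - 2 * d : ℝ) : ℂ)‖ ≤ ‖L‖ + 1 :=
      (h0.norm.eventually (eventually_le_nhds (by linarith)))
    filter_upwards [h1] with z hz k
    by_cases hk : k = 0
    · simp only [hk, Int.cast_zero, mul_zero, add_zero, if_true]
      exact hz.trans (le_add_of_nonneg_left (by positivity))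
    · simp only [hk, if_false, add_zero]
      rw [Complex.norm_cpow_real, show -2 - 2 * d = -(2 + 2 * d) by ring]
      exact Real.rpow_le_rpow_of_nonpos (abs_pos.2 (by exact_mod_cast hk))
        (abs_le_norm_add_two_pi (him z) hk) (by linarith)

lemma cpow_eq_mul_seriesTerm (d σ : ℝ) {s : ℝ} (hs : 0 < s) {k : ℤ} (hk : k ≠ 0) :
    (((σ * s : ℝ) : ℂ) + 2 * Real.pi * Complex.I * k) ^ ((-2 - 2 * d : ℝ) : ℂ) =
      (s : ℂ) ^ ((-2 - 2 * d : ℝ) : ℂ) * seriesTerm d σ k s := by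
  unfold seriesTerm
  have hsc : (s : ℂ) ≠ 0 := by exact_mod_cast hs.ne'
  have hv : (σ : ℂ) + 2 * Real.pi * Complex.I * k / s ≠ 0 :=
    Complex.slitPlane_ne_zero (seriesBase_mem_slitPlane hs hk)
  have e : ((σ * s : ℝ) : ℂ) + 2 * Real.pi * Complex.I * k =
      (s : ℂ) * ((σ : ℂ) + 2 * Real.pi * Complex.I * k / s) := by
    push_cast; field_simp
  rw [e, Complex.cpow_def_of_ne_zero (mul_ne_zero hsc hv), Complex.cpow_def_of_ne_zero hsc,
    Complex.cpow_def_of_ne_zero hv, Complex.log_ofReal_mul hs hv, Complex.ofReal_log hs.le,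
    add_mul, Complex.exp_add]

lemma summable_seriesTerm {d σ s : ℝ} (hd : -1 / 2 < d) (hσ : |σ| = 1) (hs : 0 < s) :
    Summable fun k : ℤ => if k = 0 then 0 else seriesTerm d σ k s := by
  refine Summable.of_norm_bounded ((summable_regExp hd).mul_left (s ^ (1 + regExp d))) fun k => ?_
  split_ifs with hk
  · rw [norm_zero]; positivity
  · exact norm_seriesTerm_le hd hσ hs hk

lemma conj_seriesTerm (d σ : ℝ) {s : ℝ} (hs : 0 < s) {k : ℤ} (hk : k ≠ 0) :
    (starRingEnd ℂ) (seriesTerm d σ k s) = seriesTerm d σ (-k) s := by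
  unfold seriesTerm
  have h1 := seriesBase_mem_slitPlane (σ := σ) hs hk
  have h2 := Complex.conj_cpow _ ((-2 - 2 * d : ℝ) : ℂ) (Complex.mem_slitPlane_iff_arg.1 h1).1
  rw [Complex.conj_ofReal] at h2
  rw [← h2]
  congr 1
  simp [Complex.conj_ofNat]

/-- Complex conjugation exchanges the terms of index k and -k. -/
lemma im_tsum_seriesTerm (d σ : ℝ) {s : ℝ} (hs : 0 < s) :
    (∑' k : ℤ, if k = 0 then 0 else seriesTerm d σ k s).im = 0 := by
  rw [← Complex.conj_eq_iff_im, Complex.conj_tsum, ← (Equiv.neg ℤ).tsum_eq]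
  refine tsum_congr fun k => ?_
  simp only [Equiv.neg_apply, neg_eq_zero]
  split_ifs with hk
  · simp
  · rw [conj_seriesTerm d σ hs (neg_ne_zero.2 hk), neg_neg]

lemma realSeries_eq {d s : ℝ} (hd : -1 / 2 < d) (hs : 0 < s) :
    (realSeries d s : ℂ) = (∑' k : ℤ, if k = 0 then 0 else seriesTerm d 1 k s) +
      ∑' k : ℤ, if k = 0 then 0 else seriesTerm d (-1) k s := by
  have s1 := summable_seriesTerm (σ := 1) hd (by simp) hs
  have s2 := summable_seriesTerm (σ := -1) hd (by simp) hs
  apply Complex.ext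
  · rw [Complex.ofReal_re, ← s1.tsum_add s2, Complex.re_tsum (s1.add s2)]
    unfold realSeries
    refine tsum_congr fun k => ?_
    split_ifs <;> simp
  · rw [Complex.ofReal_im, Complex.add_im, im_tsum_seriesTerm d 1 hs, im_tsum_seriesTerm d (-1) hs,
      add_zero]

lemma tsum_wirtinger_eq {d σ s : ℝ} (hd : -1 / 2 < d) (hσ : |σ| = 1) (hs : 0 < s) (L : ℂ) :
    (∑' k : ℤ, if k = 0 then L else
      (((σ * s : ℝ) : ℂ) + 2 * Real.pi * Complex.I * k) ^ ((-2 - 2 * d : ℝ) : ℂ)) =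
    L + (s : ℂ) ^ ((-2 - 2 * d : ℝ) : ℂ) * ∑' k : ℤ, if k = 0 then 0 else seriesTerm d σ k s := by
  have e : ∀ k : ℤ, (if k = 0 then L else
      (((σ * s : ℝ) : ℂ) + 2 * Real.pi * Complex.I * k) ^ ((-2 - 2 * d : ℝ) : ℂ)) =
      (if k = 0 then L else 0) + (s : ℂ) ^ ((-2 - 2 * d : ℝ) : ℂ) *
        if k = 0 then 0 else seriesTerm d σ k s := by
    intro k
    split_ifs with hk
    · simp
    · rw [cpow_eq_mul_seriesTerm d σ hs hk, zero_add]
  simp_rw [e]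
  rw [(hasSum_ite_eq 0 L).summable.tsum_add ((summable_seriesTerm hd hσ hs).mul_left _),
    tsum_ite_eq, tsum_mul_left]

section

variable {d : ℝ} (hd : d ∈ Ioo (-1 / 2 : ℝ) (1 / 2)) {s : ℝ} (hs : 0 < s)

lemma tendsto_log_upper :
    Tendsto Complex.log (𝓝[{z : ℂ | 0 < z.im}] ((Real.exp (-s) : ℝ) : ℂ)) (𝓝 ((-s : ℝ) : ℂ)) := by
  have h1 : ((Real.exp (-s) : ℝ) : ℂ) ∈ Complex.slitPlane := by
    exact Complex.ofReal_mem_slitPlane.2 (Real.exp_pos _)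
  have h2 := (continuousAt_clog h1).tendsto
  rw [← Complex.ofReal_log (Real.exp_pos _).le, Real.log_exp] at h2
  exact h2.mono_left nhdsWithin_le_nhds

include hd hs

lemma tendsto_polylog_upper :
    Tendsto (polylog d) (𝓝[{z : ℂ | 0 < z.im}] ((Real.exp (-s) : ℝ) : ℂ))
      (𝓝 ((Real.Gamma (2 + 2 * d) : ℂ) * ((s : ℂ) ^ ((-2 - 2 * d : ℝ) : ℂ) +
        (s : ℂ) ^ ((-2 - 2 * d : ℝ) : ℂ) *
          ∑' k : ℤ, if k = 0 then 0 else seriesTerm d 1 k s))) := by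
  unfold polylog
  refine Tendsto.const_mul _ ?_
  have hlog : Tendsto (fun z => -Complex.log z)
      (𝓝[{z : ℂ | 0 < z.im}] ((Real.exp (-s) : ℝ) : ℂ)) (𝓝 ((1 * s : ℝ) : ℂ)) := by
    have := (tendsto_log_upper (s := s)).neg
    simpa using this
  have h0 : Tendsto (fun z => (-Complex.log z) ^ ((-2 - 2 * d : ℝ) : ℂ))
      (𝓝[{z : ℂ | 0 < z.im}] ((Real.exp (-s) : ℝ) : ℂ))
      (𝓝 ((s : ℂ) ^ ((-2 - 2 * d : ℝ) : ℂ))) := by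
    rw [one_mul] at hlog
    refine (continuousAt_cpow_const ?_).tendsto.comp hlog
    left
    simpa using hs
  have h := tendsto_wirtinger hd.1 hlog (fun z => ?_) h0
  · rwa [tsum_wirtinger_eq hd.1 (by simp) hs] at h
  · rw [Complex.neg_im, abs_neg, Complex.log_im]
    exact Complex.abs_arg_le_pi z

/-- For Im z > 0 one has -log z⁻¹ = log z, which tends to -s from above the negative axis. The term
k = 0 therefore acquires the phase e^{iπ(-2-2d)}, the only source of a nonreal boundary value of Q.
-/
lemma tendsto_polylog_inv_upper :
    Tendsto (fun z => polylog d z⁻¹) (𝓝[{z : ℂ | 0 < z.im}] ((Real.exp (-s) : ℝ) : ℂ))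
      (𝓝 ((Real.Gamma (2 + 2 * d) : ℂ) * ((s : ℂ) ^ ((-2 - 2 * d : ℝ) : ℂ) *
        Complex.exp (Real.pi * Complex.I * ((-2 - 2 * d : ℝ) : ℂ)) +
        (s : ℂ) ^ ((-2 - 2 * d : ℝ) : ℂ) *
          ∑' k : ℤ, if k = 0 then 0 else seriesTerm d (-1) k s))) := by
  unfold polylog
  refine Tendsto.const_mul _ ?_
  have hev : ∀ᶠ z in 𝓝[{z : ℂ | 0 < z.im}] ((Real.exp (-s) : ℝ) : ℂ), 0 < z.im :=
    self_mem_nhdsWithin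
  have hinv : ∀ z : ℂ, 0 < z.im → -Complex.log z⁻¹ = Complex.log z := by
    intro z hz
    rw [Complex.log_inv, neg_neg]
    exact (Complex.mem_slitPlane_iff_arg.1 (Or.inr hz.ne')).1
  have hlog : Tendsto (fun z => -Complex.log z⁻¹)
      (𝓝[{z : ℂ | 0 < z.im}] ((Real.exp (-s) : ℝ) : ℂ)) (𝓝 ((-1 * s : ℝ) : ℂ)) := by
    rw [neg_one_mul]
    refine (tendsto_log_upper).congr' ?_
    filter_upwards [hev] with z hz using (hinv z hz).symm
  have hlogim : ∀ z : ℂ, 0 < z.im → 0 ≤ (Complex.log z).im := by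
    intro z hz
    rw [Complex.log_im]
    exact Complex.arg_nonneg_iff.2 hz.le
  have h0 : Tendsto (fun z => (-Complex.log z⁻¹) ^ ((-2 - 2 * d : ℝ) : ℂ))
      (𝓝[{z : ℂ | 0 < z.im}] ((Real.exp (-s) : ℝ) : ℂ))
      (𝓝 ((s : ℂ) ^ ((-2 - 2 * d : ℝ) : ℂ) *
        Complex.exp (Real.pi * Complex.I * ((-2 - 2 * d : ℝ) : ℂ)))) := by
    have hc := Complex.continuousWithinAt_log_of_re_neg_of_im_zero (z := ((-s : ℝ) : ℂ))
      (by simpa using hs) (by simp)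
    have h1 : Tendsto (fun z => -Complex.log z⁻¹)
        (𝓝[{z : ℂ | 0 < z.im}] ((Real.exp (-s) : ℝ) : ℂ))
        (𝓝[{z : ℂ | 0 ≤ z.im}] ((-s : ℝ) : ℂ)) := by
      rw [neg_one_mul] at hlog
      refine tendsto_nhdsWithin_iff.2 ⟨hlog, ?_⟩
      filter_upwards [hev] with z hz
      rw [hinv z hz]
      exact hlogim z hz
    have h2 := (Complex.continuous_exp.tendsto _).comp
      ((hc.tendsto.comp h1).mul_const ((-2 - 2 * d : ℝ) : ℂ))
    have hne : ((-s : ℝ) : ℂ) ≠ 0 := by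
      rw [Ne, Complex.ofReal_eq_zero]; linarith
    rw [← Complex.cpow_def_of_ne_zero hne, Complex.ofReal_cpow_of_nonpos (by linarith)] at h2
    simp only [Complex.ofReal_neg, neg_neg] at h2
    refine h2.congr' ?_
    have hne2 : ∀ᶠ z in 𝓝[{z : ℂ | 0 < z.im}] ((Real.exp (-s) : ℝ) : ℂ), -Complex.log z⁻¹ ≠ 0 := by
      rw [neg_one_mul] at hlog
      exact hlog.eventually_ne hne
    filter_upwards [hne2] with z hz
    simp only [Function.comp_apply]
    rw [Complex.cpow_def_of_ne_zero hz]
  have h := tendsto_wirtinger hd.1 hlog (fun z => ?_) h0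
  · rwa [tsum_wirtinger_eq hd.1 (by simp) hs] at h
  · rw [Complex.neg_im, abs_neg, Complex.log_im]
    exact Complex.abs_arg_le_pi _

/-- The boundary value `Q⁺(e^{-s})` has argument `argQ d s`. -/
lemma eta_exp_neg : eta d (Real.exp (-s)) = argQ d s := by
  set t := Real.exp (-s) with ht
  have ht0 : 0 < t := Real.exp_pos _
  have ht1 : t < 1 := Real.exp_lt_one_iff.2 (by linarith)
  have htc : (t : ℂ) ≠ 0 := by exact_mod_cast ht0.ne'
  have hcos := cos_pi_mul_pos hd
  have h1 : Tendsto (fun z : ℂ => (1 / (4 * Real.pi) : ℂ) * (z⁻¹ - 2 + z))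
      (𝓝[{z : ℂ | 0 < z.im}] (t : ℂ)) (𝓝 ((1 / (4 * Real.pi) : ℂ) * ((t : ℂ)⁻¹ - 2 + t))) := by
    refine Tendsto.mono_left ?_ nhdsWithin_le_nhds
    exact (((tendsto_id.inv₀ htc).sub_const 2).add tendsto_id).const_mul _
  have h2 := h1.mul ((tendsto_polylog_upper hd hs).add (tendsto_polylog_inv_upper hd hs))
  have h3 : limPlus (Q d) t = _ := limPlus_eq h2
  set A := s ^ (-2 - 2 * d) with hA
  have hA0 : 0 < A := by positivity
  have hAc : (s : ℂ) ^ ((-2 - 2 * d : ℝ) : ℂ) = (A : ℂ) := by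
    rw [hA, Complex.ofReal_cpow hs.le]
  -- All positive factors of Q⁺ are collected here, since they do not affect the argument; t⁻¹ - 2 +
  -- t = (1-t)²/t is one of them.
  set ρ : ℝ := 1 / (4 * Real.pi) * (t⁻¹ - 2 + t) * Real.Gamma (2 + 2 * d) * A *
    (2 * Real.cos (Real.pi * d)) with hρ
  have hρ0 : 0 < ρ := by
    have hG : 0 < Real.Gamma (2 + 2 * d) := Real.Gamma_pos_of_pos (by linarith [hd.1])
    have hq : 0 < t⁻¹ - 2 + t := by
      have : t⁻¹ - 2 + t = (1 - t) ^ 2 / t := by field_simp; ring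
      rw [this]
      have : 0 < 1 - t := by linarith
      positivity
    have := Real.pi_pos
    positivity
  -- The two terms with k = 0 add up to 1 + e^{-2πid} = 2cos(πd) e^{-iπd}; dividing by 2cos(πd) > 0
  -- leaves the limiting argument -πd.
  have hexp : 1 + Complex.exp (Real.pi * Complex.I * ((-2 - 2 * d : ℝ) : ℂ)) =
      (2 * Real.cos (Real.pi * d) : ℝ) *
        ((Real.cos (Real.pi * d) : ℂ) - Real.sin (Real.pi * d) * Complex.I) := by
    have e1 : Real.pi * Complex.I * ((-2 - 2 * d : ℝ) : ℂ) =
        ((-(2 * (Real.pi * d)) : ℝ) : ℂ) * Complex.I - 2 * Real.pi * Complex.I := by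
      push_cast; ring
    rw [e1, Complex.exp_sub, Complex.exp_two_pi_mul_I, div_one, Complex.exp_mul_I,
      ← Complex.ofReal_cos, ← Complex.ofReal_sin, Real.cos_neg, Real.sin_neg, Real.cos_two_mul,
      Real.sin_two_mul]
    push_cast; ring
  have h4 : limPlus (Q d) t = (ρ : ℂ) * (⟨Real.cos (Real.pi * d) +
      realSeries d s / (2 * Real.cos (Real.pi * d)), -Real.sin (Real.pi * d)⟩ : ℂ) := by
    have hcosc : (Real.cos (Real.pi * d) : ℂ) ≠ 0 := by exact_mod_cast hcos.ne'
    rw [h3, hAc, Complex.mk_eq_add_mul_I]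
    have hR := realSeries_eq hd.1 hs
    set T₁ := ∑' k : ℤ, if k = 0 then 0 else seriesTerm d 1 k s
    set T₂ := ∑' k : ℤ, if k = 0 then 0 else seriesTerm d (-1) k s
    calc _ = (1 / (4 * Real.pi) : ℂ) * ((t : ℂ)⁻¹ - 2 + t) * (Real.Gamma (2 + 2 * d) : ℂ) * A *
        ((1 + Complex.exp (Real.pi * Complex.I * ((-2 - 2 * d : ℝ) : ℂ))) + (T₁ + T₂)) := by ring
      _ = _ := by
        rw [hexp, ← hR, hρ]
        push_cast
        push_cast at hcosc
        field_simp
        ring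
  unfold eta argQ
  rw [h4, Complex.arg_real_mul _ hρ0]

end

/-! ### The Sokhotski–Plemelj formula. -/

section plemelj

lemma intervalIntegral_eq_Ioo {E : Type*} [NormedAddCommGroup E] [NormedSpace ℝ E] (f : ℝ → E) :
    ∫ τ in (0 : ℝ)..1, f τ = ∫ τ in Ioo (0 : ℝ) 1, f τ := by
  rw [intervalIntegral.integral_of_le zero_le_one, integral_Ioc_eq_integral_Ioo]

lemma ofReal_sub_ne_zero {z : ℂ} (hz : z.im ≠ 0) (τ : ℝ) : (τ : ℂ) - z ≠ 0 := by
  intro h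
  apply hz
  have := congrArg Complex.im h
  simpa using this

lemma integral_inv_sub_eq_log {z : ℂ} (hz : z.im ≠ 0) :
    ∫ τ in (0 : ℝ)..1, 1 / ((τ : ℂ) - z) = Complex.log (1 - z) - Complex.log (-z) := by
  have hder : ∀ τ ∈ uIcc (0 : ℝ) 1, HasDerivAt (fun τ : ℝ => Complex.log ((τ : ℂ) - z))
      (1 / ((τ : ℂ) - z)) τ := by
    intro τ _
    have h1 : HasDerivAt (fun ζ : ℂ => Complex.log (ζ - z)) (1 / ((τ : ℂ) - z)) (τ : ℂ) :=
      ((hasDerivAt_id (τ : ℂ)).sub_const _).clog (Or.inr (by simpa using hz))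
    exact h1.comp_ofReal
  rw [intervalIntegral.integral_eq_sub_of_hasDerivAt hder]
  · simp
  · apply Continuous.intervalIntegrable
    exact continuous_const.div (by fun_prop) fun τ => ofReal_sub_ne_zero hz τ

variable {η : ℝ → ℝ} (hη : ContinuousOn η (Ioo 0 1)) {M : ℝ}
  (hM : ∀ τ ∈ Ioo (0 : ℝ) 1, |η τ| ≤ M)

include hη hM

lemma integrableOn_div_sub {z : ℂ} (hz : z.im ≠ 0) :
    IntegrableOn (fun τ : ℝ => (η τ : ℂ) / ((τ : ℂ) - z)) (Ioo 0 1) := by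
  have hc : ContinuousOn (fun τ : ℝ => (η τ : ℂ) / ((τ : ℂ) - z)) (Ioo 0 1) :=
    (Complex.continuous_ofReal.comp_continuousOn hη).div (by fun_prop)
      fun τ _ => ofReal_sub_ne_zero hz τ
  refine (integrable_const (M / |z.im|)).mono' (hc.aestronglyMeasurable measurableSet_Ioo) ?_
  filter_upwards [ae_restrict_mem measurableSet_Ioo] with τ hτ
  rw [norm_div, Complex.norm_real, Real.norm_eq_abs]
  have h1 := Complex.abs_im_le_norm ((τ : ℂ) - z)
  simp only [Complex.sub_im, Complex.ofReal_im, zero_sub, abs_neg] at h1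
  have h2 : 0 < |z.im| := abs_pos.2 hz
  have h3 := hM τ hτ
  have h4 := (abs_nonneg _).trans h3
  gcongr

/-- The Sokhotski–Plemelj formula from the upper half-plane, for a density that is Lipschitz near
the boundary point. -/
lemma tendsto_cauchy_upper {t : ℝ} (ht : t ∈ Ioo (0 : ℝ) 1) {L δ : ℝ} (hδ : 0 < δ)
    (hL : ∀ x ∈ Ioo (0 : ℝ) 1, |x - t| < δ → ∀ τ ∈ Ioo (0 : ℝ) 1, |η τ - η x| ≤ L * |τ - x|) :
    Tendsto (fun z : ℂ => ∫ τ in (0 : ℝ)..1, (η τ : ℂ) / ((τ : ℂ) - z))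
      (𝓝[{z : ℂ | 0 < z.im}] (t : ℂ))
      (𝓝 (((∫ τ in Ioo (0 : ℝ) 1, (η τ - η t) / (τ - t)) + η t * Real.log ((1 - t) / t) : ℝ) +
        (η t * Real.pi : ℝ) * Complex.I)) := by
  have hηt : ContinuousAt η t := hη.continuousAt (Ioo_mem_nhds ht.1 ht.2)
  have hre : Tendsto (fun z : ℂ => z.re) (𝓝[{z : ℂ | 0 < z.im}] (t : ℂ)) (𝓝 t) := by
    have := (Complex.continuous_re.tendsto (t : ℂ)).mono_left
      (nhdsWithin_le_nhds (s := {z : ℂ | 0 < z.im}))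
    simpa using this
  have hid : Tendsto (fun z : ℂ => z) (𝓝[{z : ℂ | 0 < z.im}] (t : ℂ)) (𝓝 (t : ℂ)) :=
    tendsto_id.mono_left nhdsWithin_le_nhds
  have him : ∀ᶠ z in 𝓝[{z : ℂ | 0 < z.im}] (t : ℂ), 0 < z.im := self_mem_nhdsWithin
  have hηre : Tendsto (fun z : ℂ => (η z.re : ℂ)) (𝓝[{z : ℂ | 0 < z.im}] (t : ℂ))
      (𝓝 (η t : ℂ)) :=
    (Complex.continuous_ofReal.tendsto _).comp (hηt.tendsto.comp hre)
  -- the regular part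
  have h1 : Tendsto (fun z : ℂ => ∫ τ in Ioo (0 : ℝ) 1, ((η τ : ℂ) - η z.re) / ((τ : ℂ) - z))
      (𝓝[{z : ℂ | 0 < z.im}] (t : ℂ))
      (𝓝 (∫ τ in Ioo (0 : ℝ) 1, ((η τ : ℂ) - η t) / ((τ : ℂ) - t))) := by
    -- Subtracting η(Re z) rather than η(t) gives |η(τ) - η(Re z)| ≤ L|τ - Re z| ≤ L|τ - z|, so the
    -- quotient is bounded uniformly as z → t.
    refine tendsto_integral_filter_of_dominated_convergence (fun _ => L) ?_ ?_
      (integrable_const _) ?_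
    · filter_upwards [him] with z hz
      refine ContinuousOn.aestronglyMeasurable ?_ measurableSet_Ioo
      exact ((Complex.continuous_ofReal.comp_continuousOn hη).sub continuousOn_const).div
        (by fun_prop) fun τ _ => ofReal_sub_ne_zero hz.ne' τ
    · filter_upwards [him, hre.eventually (Ioo_mem_nhds ht.1 ht.2),
        hre.eventually (Metric.ball_mem_nhds t hδ)] with z hz hz1 hz2
      filter_upwards [ae_restrict_mem measurableSet_Ioo] with τ hτ
      have h2 := hL z.re hz1 (by simpa [Real.dist_eq] using hz2) τ hτ
      have h3 := Complex.abs_re_le_norm ((τ : ℂ) - z)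
      simp only [Complex.sub_re, Complex.ofReal_re] at h3
      have h4 : 0 < ‖(τ : ℂ) - z‖ := norm_pos_iff.2 (ofReal_sub_ne_zero hz.ne' τ)
      rw [← Complex.ofReal_sub, norm_div, Complex.norm_real, Real.norm_eq_abs, div_le_iff₀ h4]
      -- The sign of L is not assumed. The Lipschitz bound forces L ≥ 0 when tested at any τ ≠ Re z;
      -- if τ = Re z, another point of (0,1) is used.
      have hL0 : 0 ≤ L ∨ |τ - z.re| = 0 := by
        rcases (abs_nonneg (τ - z.re)).eq_or_lt with h | h
        · exact Or.inr h.symm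
        · left
          by_contra hneg
          have := mul_neg_of_neg_of_pos (not_le.1 hneg) h
          linarith [abs_nonneg (η τ - η z.re)]
      rcases hL0 with hL0 | hL0
      · exact h2.trans (by gcongr)
      · have h6 : 0 ≤ L := by
          by_contra hneg
          obtain ⟨y, hy1, hy2⟩ : ∃ y ∈ Ioo (0 : ℝ) 1, y ≠ z.re := by
            rcases eq_or_ne z.re (1 / 2) with h | h
            · exact ⟨1 / 3, by constructor <;> norm_num, by rw [h]; norm_num⟩
            · exact ⟨1 / 2, by constructor <;> norm_num, h.symm⟩
          have h7 := hL z.re hz1 (by simpa [Real.dist_eq] using hz2) y hy1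
          have := mul_neg_of_neg_of_pos (not_le.1 hneg) (abs_pos.2 (sub_ne_zero.2 hy2))
          linarith [abs_nonneg (η y - η z.re)]
        rw [hL0, mul_zero] at h2
        exact h2.trans (by positivity)
    · have hne : ∀ᵐ τ ∂(volume.restrict (Ioo (0 : ℝ) 1)), τ ≠ t :=
        ae_restrict_of_ae (Measure.ae_ne volume t)
      filter_upwards [hne] with τ hτ
      refine (hηre.const_sub _).div (hid.const_sub _) ?_
      rw [← Complex.ofReal_sub]
      exact_mod_cast sub_ne_zero.2 hτ
  -- the logarithmic part
  have h2 : Tendsto (fun z : ℂ => Complex.log (1 - z) - Complex.log (-z))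
      (𝓝[{z : ℂ | 0 < z.im}] (t : ℂ))
      (𝓝 ((Real.log (1 - t) : ℂ) - (Real.log t - Real.pi * Complex.I))) := by
    refine Tendsto.sub ?_ ?_
    · rw [Complex.ofReal_log (by linarith [ht.2])]
      have : ContinuousAt Complex.log ((1 - t : ℝ) : ℂ) :=
        continuousAt_clog (Complex.ofReal_mem_slitPlane.2 (by linarith [ht.2]))
      refine this.tendsto.comp ?_
      push_cast
      exact hid.const_sub 1
    -- As z → t from above, -z → -t from below the cut, so log(-z) → log t - iπ. This is the origin
    -- of the term iπη(t).
    · have h3 := Complex.tendsto_log_nhdsWithin_im_neg_of_re_neg_of_im_zero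
        (z := ((-t : ℝ) : ℂ)) (by simpa using ht.1) (by simp)
      have h4 : ‖((-t : ℝ) : ℂ)‖ = t := by
        rw [Complex.norm_real, norm_neg, Real.norm_of_nonneg ht.1.le]
      rw [h4] at h3
      refine h3.comp (tendsto_nhdsWithin_iff.2 ⟨?_, ?_⟩)
      · push_cast; exact hid.neg
      · filter_upwards [him] with z hz
        simpa using hz
  have h3 := h1.add (hηre.mul h2)
  have e : (∫ τ in Ioo (0 : ℝ) 1, ((η τ : ℂ) - η t) / ((τ : ℂ) - t)) =
      ((∫ τ in Ioo (0 : ℝ) 1, (η τ - η t) / (τ - t) : ℝ) : ℂ) := by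
    rw [← integral_complex_ofReal]
    congr 1
    ext τ
    push_cast; rfl
  rw [e] at h3
  have e2 : ((∫ τ in Ioo (0 : ℝ) 1, (η τ - η t) / (τ - t) : ℝ) : ℂ) +
      η t * ((Real.log (1 - t) : ℂ) - (Real.log t - Real.pi * Complex.I)) =
      (((∫ τ in Ioo (0 : ℝ) 1, (η τ - η t) / (τ - t)) + η t * Real.log ((1 - t) / t) : ℝ) +
        (η t * Real.pi : ℝ) * Complex.I) := by
    rw [Real.log_div (by linarith [ht.2]) ht.1.ne']
    push_cast; ring
  rw [e2] at h3
  refine h3.congr' ?_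
  filter_upwards [him] with z hz
  rw [intervalIntegral_eq_Ioo, ← integral_inv_sub_eq_log hz.ne', intervalIntegral_eq_Ioo,
    ← integral_const_mul, ← integral_add]
  · congr 1
    ext τ
    ring
  · have hi1 := integrableOn_div_sub hη hM hz.ne'
    have hi2 := (integrableOn_div_sub (η := fun _ => η z.re) continuousOn_const
      (M := |η z.re|) (fun _ _ => le_rfl) hz.ne')
    refine (hi1.sub hi2).congr (ae_of_all _ fun τ => ?_)
    simp only [Pi.sub_apply]
    ring
  · exact ((integrableOn_div_sub (η := fun _ => (1 : ℝ)) continuousOn_const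
      (M := 1) (fun _ _ => by simp) hz.ne').congr (ae_of_all _ fun τ => by simp)).const_mul _

end plemelj

lemma X₀_conj (d : ℝ) (z : ℂ) : X₀ d ((starRingEnd ℂ) z) = (starRingEnd ℂ) (X₀ d z) := by
  unfold X₀
  rw [← Complex.exp_conj, map_mul, intervalIntegral_eq_Ioo, intervalIntegral_eq_Ioo,
    ← integral_conj]
  congr 2
  · simp
  · congr 1
    ext τ
    simp

lemma X_conj (d : ℝ) (z : ℂ) : X d ((starRingEnd ℂ) z) = (starRingEnd ℂ) (X d z) := by
  unfold X
  split_ifs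
  · rw [X₀_conj, map_mul, map_inv₀]
  · exact X₀_conj d z

/-- Reflection symmetry yields X⁻ from X⁺, so the Plemelj formula is needed from one side only. -/
lemma limMinus_eq_conj {F : ℂ → ℂ} (hF : ∀ z, F ((starRingEnd ℂ) z) = (starRingEnd ℂ) (F z))
    {t : ℝ} {L : ℂ} (h : Tendsto F (𝓝[{z : ℂ | 0 < z.im}] (t : ℂ)) (𝓝 L)) :
    limMinus F t = (starRingEnd ℂ) L := by
  apply limMinus_eq
  have hc : Tendsto (starRingEnd ℂ) (𝓝[{z : ℂ | z.im < 0}] (t : ℂ))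
      (𝓝[{z : ℂ | 0 < z.im}] (t : ℂ)) := by
    refine tendsto_nhdsWithin_iff.2 ⟨?_, ?_⟩
    · have := (Complex.continuous_conj.tendsto (t : ℂ)).mono_left
        (nhdsWithin_le_nhds (s := {z : ℂ | z.im < 0}))
      simpa using this
    · filter_upwards [self_mem_nhdsWithin] with z hz
      simpa using hz
  have h1 := (Complex.continuous_conj.tendsto L).comp (h.comp hc)
  refine h1.congr fun z => ?_
  simp only [Function.comp_apply]
  rw [hF, Complex.conj_conj]

/-! ### The regularized singular integral in the exponent of X(e^s)/X^±(e^{-s}). -/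

/-- The Hölder-type bounds satisfied by `argQ`, as a property of a function on `(0, ∞)`. -/
structure HolderBound (E : ℝ → ℝ) (C α : ℝ) : Prop where
  C_nonneg : 0 ≤ C
  pos : 0 < α
  le_one : α ≤ 1
  abs_le : ∀ s, |E s| ≤ Real.pi
  sub_le : ∀ r s, 0 < r → r ≤ s → |E s - E r| ≤ C * s ^ α * (s - r)

namespace HolderBound

variable {E : ℝ → ℝ} {C α : ℝ} (H : HolderBound E C α)

include H

lemma sub_le_max {r s : ℝ} (hr : 0 < r) (hs : 0 < s) :
    |E r - E s| ≤ C * max r s ^ α * |r - s| := by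
  rcases le_total r s with h | h
  · rw [abs_sub_comm, max_eq_right h, abs_sub_comm r, abs_of_nonneg (sub_nonneg.2 h)]
    exact H.sub_le r s hr h
  · rw [max_eq_left h, abs_of_nonneg (sub_nonneg.2 h)]
    exact H.sub_le s r hs h

lemma abs_sub_le_two_pi (r s : ℝ) : |E r - E s| ≤ 2 * Real.pi := by
  have := abs_sub (E r) (E s)
  linarith [H.abs_le r, H.abs_le s]

lemma continuousOn : ContinuousOn E (Ioi 0) := by
  intro s hs
  have hs' : (0 : ℝ) < s := hs
  refine ContinuousAt.continuousWithinAt ?_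
  rw [ContinuousAt, tendsto_iff_dist_tendsto_zero]
  have h1 : Tendsto (fun r : ℝ => C * max r s ^ α * |r - s|) (𝓝 s) (𝓝 0) := by
    have h2 : Tendsto (fun r : ℝ => max r s) (𝓝 s) (𝓝 s) := by
      have : Continuous fun r : ℝ => max r s := by fun_prop
      simpa using this.tendsto s
    have h3 : Tendsto (fun r : ℝ => |r - s|) (𝓝 s) (𝓝 0) := by
      have : Continuous fun r : ℝ => |r - s| := by fun_prop
      simpa using this.tendsto s
    have h4 := ((h2.rpow_const (p := α) (Or.inl hs'.ne')).const_mul C).mul h3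
    simpa using h4
  refine squeeze_zero' (Eventually.of_forall fun _ => dist_nonneg) ?_ h1
  filter_upwards [Ioi_mem_nhds hs'] with r hr
  rw [Real.dist_eq]
  exact H.sub_le_max hr hs'

/-- For τ ≥ t/4 both logarithms stay in a bounded range and log is Lipschitz with constant 4/t. For
τ < t/4 the points are at distance at least t/4, and the trivial bound 2π on the difference
suffices. -/
lemma comp_log_lipschitz {t : ℝ} (ht : t ∈ Ioo (0 : ℝ) 1) : ∃ L : ℝ,
    ∀ x ∈ Ioo (0 : ℝ) 1, |x - t| < t / 2 → ∀ τ ∈ Ioo (0 : ℝ) 1,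
      |E (-Real.log τ) - E (-Real.log x)| ≤ L * |τ - x| := by
  have ht0 := ht.1
  have hlog : ∀ y ∈ Ioo (0 : ℝ) 1, 0 < -Real.log y := fun y hy =>
    neg_pos.2 (Real.log_neg hy.1 hy.2)
  have hC := H.C_nonneg
  set S := -Real.log (t / 4) with hS
  have hS0 : 0 < S := hlog _ ⟨by linarith, by linarith [ht.2]⟩
  have hlip : ∀ a b : ℝ, t / 4 ≤ a → t / 4 ≤ b → |Real.log a - Real.log b| ≤ 4 / t * |a - b| := by
    have h1 : ∀ a b : ℝ, t / 4 ≤ a → a ≤ b → Real.log b - Real.log a ≤ 4 / t * (b - a) := by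
      intro a b ha hab
      have ha0 : 0 < a := by linarith
      have hb0 : 0 < b := by linarith
      rw [← Real.log_div hb0.ne' ha0.ne']
      refine (Real.log_le_sub_one_of_pos (by positivity)).trans ?_
      have h2 : b / a - 1 = (b - a) / a := by field_simp
      have h3 : 4 / t * (b - a) = (b - a) / (t / 4) := by field_simp
      rw [h2, h3]
      have : 0 ≤ b - a := by linarith
      gcongr
    intro a b ha hb
    rcases le_total a b with h | h
    · have ha0 : 0 < a := by linarith
      rw [abs_sub_comm, abs_of_nonneg (sub_nonneg.2 (Real.log_le_log ha0 h)), abs_sub_comm,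
        abs_of_nonneg (sub_nonneg.2 h)]
      exact h1 a b ha h
    · have hb0 : 0 < b := by linarith
      rw [abs_of_nonneg (sub_nonneg.2 (Real.log_le_log hb0 h)), abs_of_nonneg (sub_nonneg.2 h)]
      exact h1 b a hb h
  refine ⟨C * S ^ α * (4 / t) + 8 * Real.pi / t, fun x hx hxt τ hτ => ?_⟩
  have hx1 : t / 2 < x := by linarith [(abs_lt.1 hxt).1]
  rcases le_or_gt (t / 4) τ with h | h
  · have h1 := H.sub_le_max (hlog τ hτ) (hlog x hx)
    have h2 : max (-Real.log τ) (-Real.log x) ≤ S :=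
      max_le (neg_le_neg (Real.log_le_log (by linarith) h))
        (neg_le_neg (Real.log_le_log (by linarith) (by linarith)))
    have h3 : 0 ≤ max (-Real.log τ) (-Real.log x) := (hlog τ hτ).le.trans (le_max_left _ _)
    have h4 : |-Real.log τ - -Real.log x| ≤ 4 / t * |τ - x| := by
      rw [neg_sub_neg, abs_sub_comm]
      exact hlip τ x h (by linarith)
    have hα := H.pos
    calc _ ≤ _ := h1
      _ ≤ C * S ^ α * (4 / t * |τ - x|) := by gcongr
      _ = C * S ^ α * (4 / t) * |τ - x| + 0 := by ring
      _ ≤ C * S ^ α * (4 / t) * |τ - x| + 8 * Real.pi / t * |τ - x| := by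
          have := Real.pi_pos
          gcongr
          positivity
      _ = _ := by ring
  · have h5 : t / 4 ≤ |τ - x| := by
      rw [abs_sub_comm, abs_of_nonneg (by linarith)]
      linarith
    have hpi := Real.pi_pos
    calc _ ≤ 2 * Real.pi := H.abs_sub_le_two_pi _ _
      _ = 8 * Real.pi / t * (t / 4) := by field_simp; norm_num
      _ ≤ 8 * Real.pi / t * |τ - x| := by gcongr
      _ ≤ _ := by
          rw [add_mul]
          have : 0 ≤ C * S ^ α * (4 / t) * |τ - x| := by positivity
          linarith

end HolderBound

/-- The regularized integral in the exponent of `X(e^s) / X^±(e^{-s})`, in logarithmic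
coordinates. -/
def logIntegrand (E : ℝ → ℝ) (s r : ℝ) : ℝ :=
  Real.exp (-r) * ((E r - E s) /
    ((Real.exp (-r) - Real.exp (-s)) * (1 - Real.exp (-s) * Real.exp (-r))))

lemma one_div_one_sub_exp_neg_le {y : ℝ} (hy : 0 < y) :
    1 / (1 - Real.exp (-y)) ≤ 1 + 1 / y := by
  have h1 := Real.add_one_lt_exp hy.ne'
  have h2 : Real.exp (-y) < 1 := Real.exp_lt_one_iff.2 (by linarith)
  have h3 : Real.exp (-y) ≤ 1 / (1 + y) := by
    rw [Real.exp_neg, ← one_div]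
    exact one_div_le_one_div_of_le (by linarith) (by linarith)
  have h4 : y / (1 + y) ≤ 1 - Real.exp (-y) := by
    have : y / (1 + y) = 1 - 1 / (1 + y) := by field_simp; ring
    linarith
  calc _ ≤ 1 / (y / (1 + y)) := one_div_le_one_div_of_le (by positivity) h4
    _ = _ := by field_simp; ring

/-- This is x ≤ 2 sinh(x/2) times e^{x/2}. It captures the zero at x = 0 and an exponential rate at
infinity in one bound. -/
lemma mul_exp_half_le {x : ℝ} (hx : 0 ≤ x) : x * Real.exp (x / 2) ≤ Real.exp x - 1 := by
  have h1 : x / 2 ≤ Real.sinh (x / 2) := Real.self_le_sinh_iff.2 (by positivity)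
  rw [Real.sinh_eq] at h1
  have h2 : Real.exp (x / 2) * Real.exp (x / 2) = Real.exp x := by
    rw [← Real.exp_add]; ring_nf
  have h3 : Real.exp (x / 2) * Real.exp (-(x / 2)) = 1 := by
    rw [← Real.exp_add]; simp
  nlinarith [Real.exp_pos (x / 2)]

lemma abs_logIntegrand_of_lt {E : ℝ → ℝ} {r s : ℝ} (hr : 0 < r) (h : r < s) :
    |logIntegrand E s r| ≤ |E r - E s| * (1 + 1 / (s - r)) * (1 + 1 / (r + s)) := by
  have hx : 0 < s - r := by linarith
  have hy : 0 < r + s := by linarith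
  have h1 := one_div_one_sub_exp_neg_le hx
  have h2 := one_div_one_sub_exp_neg_le hy
  have p1 : 0 < 1 - Real.exp (-(s - r)) := by
    linarith [Real.exp_lt_one_iff.2 (show -(s - r) < 0 by linarith)]
  have p2 : 0 < 1 - Real.exp (-(r + s)) := by
    linarith [Real.exp_lt_one_iff.2 (show -(r + s) < 0 by linarith)]
  have e : logIntegrand E s r = (E r - E s) * (1 / (1 - Real.exp (-(s - r)))) *
      (1 / (1 - Real.exp (-(r + s)))) := by
    unfold logIntegrand
    have e1 : Real.exp (-r) - Real.exp (-s) = Real.exp (-r) * (1 - Real.exp (-(s - r))) := by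
      rw [mul_sub, ← Real.exp_add]; ring_nf
    have e2 : Real.exp (-s) * Real.exp (-r) = Real.exp (-(r + s)) := by
      rw [← Real.exp_add]; ring_nf
    rw [e1, e2]
    have := Real.exp_pos (-r)
    field_simp
  rw [e, abs_mul, abs_mul, abs_of_pos (by positivity : 0 < 1 / (1 - Real.exp (-(s - r)))),
    abs_of_pos (by positivity : 0 < 1 / (1 - Real.exp (-(r + s))))]
  gcongr

lemma abs_logIntegrand_of_gt {E : ℝ → ℝ} {r s : ℝ} (hs : 0 < s) (h : s < r) :
    |logIntegrand E s r| ≤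
      |E r - E s| / (r - s) * Real.exp (-((r - s) / 2)) * (1 + 1 / (r + s)) := by
  have hx : 0 < r - s := by linarith
  have hy : 0 < r + s := by linarith
  have h1 := mul_exp_half_le hx.le
  have h2 := one_div_one_sub_exp_neg_le hy
  have p0 := Real.exp_pos ((r - s) / 2)
  have p1 : 0 < Real.exp (r - s) - 1 := lt_of_lt_of_le (by positivity) h1
  have p2 : 0 < 1 - Real.exp (-(r + s)) := by
    linarith [Real.exp_lt_one_iff.2 (show -(r + s) < 0 by linarith)]
  have e : logIntegrand E s r = -((E r - E s) * (1 / (Real.exp (r - s) - 1)) *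
      (1 / (1 - Real.exp (-(r + s))))) := by
    unfold logIntegrand
    have e1 : Real.exp (-r) - Real.exp (-s) = -(Real.exp (-r) * (Real.exp (r - s) - 1)) := by
      rw [mul_sub, ← Real.exp_add]; ring_nf
    have e2 : Real.exp (-s) * Real.exp (-r) = Real.exp (-(r + s)) := by
      rw [← Real.exp_add]; ring_nf
    rw [e1, e2]
    have := Real.exp_pos (-r)
    field_simp
  rw [e, abs_neg, abs_mul, abs_mul, abs_of_pos (by positivity : 0 < 1 / (Real.exp (r - s) - 1)),
    abs_of_pos (by positivity : 0 < 1 / (1 - Real.exp (-(r + s))))]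
  have h3 : 1 / (Real.exp (r - s) - 1) ≤ 1 / (r - s) * Real.exp (-((r - s) / 2)) := by
    rw [Real.exp_neg]
    calc _ ≤ 1 / ((r - s) * Real.exp ((r - s) / 2)) :=
          one_div_le_one_div_of_le (by positivity) h1
      _ = _ := by field_simp
  calc _ ≤ |E r - E s| * (1 / (r - s) * Real.exp (-((r - s) / 2))) * (1 + 1 / (r + s)) := by
        gcongr
    _ = _ := by ring

lemma integrable_rpow_mul_exp {a b : ℝ} (ha : 0 < a) (hb : 0 < b) :
    Integrable (fun r : ℝ => r ^ (a - 1) * Real.exp (-(b * r))) halfLine := by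
  by_contra h
  have h1 := Real.integral_rpow_mul_exp_neg_mul_Ioi ha hb
  rw [integral_undef h] at h1
  have : 0 < (1 / b) ^ a * Real.Gamma a := by
    have := Real.Gamma_pos_of_pos ha
    positivity
  linarith

lemma ae_halfLine_ne (s : ℝ) : ∀ᵐ r ∂halfLine, r ≠ s :=
  ae_restrict_of_ae (Measure.ae_ne volume s)

lemma integrable_indicator_Iio (c s : ℝ) :
    Integrable ((Iio s).indicator fun _ => c) halfLine := by
  rw [integrable_indicator_iff measurableSet_Iio, IntegrableOn, halfLine,
    Measure.restrict_restrict measurableSet_Iio]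
  have : Iio s ∩ Ioi 0 = Ioo 0 s := by ext; simp [and_comm]
  rw [this]
  exact integrable_const _

lemma integral_indicator_Iio {c s : ℝ} (hs : 0 < s) :
    ∫ r, (Iio s).indicator (fun _ => c) r ∂halfLine = s * c := by
  rw [integral_indicator measurableSet_Iio, halfLine,
    Measure.restrict_restrict measurableSet_Iio]
  have : Iio s ∩ Ioi 0 = Ioo 0 s := by ext; simp [and_comm]
  rw [this]
  simp [hs.le]

lemma integrable_exp_neg_abs : Integrable (fun y : ℝ => Real.exp (-(|y| / 4))) := by
  have h1 : IntegrableOn (fun y : ℝ => Real.exp (-(1 / 4) * y)) (Ioi 0) :=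
    integrableOn_exp_mul_Ioi (by norm_num) 0
  have h2 : IntegrableOn (fun y : ℝ => Real.exp ((1 / 4) * y)) (Iic 0) :=
    integrableOn_exp_mul_Iic (by norm_num) 0
  rw [← integrableOn_univ, ← Iic_union_Ioi (a := (0 : ℝ))]
  refine IntegrableOn.union (h2.congr_fun (fun y hy => ?_) measurableSet_Iic)
    (h1.congr_fun (fun y hy => ?_) measurableSet_Ioi)
  · have : y ≤ 0 := hy
    simp only [abs_of_nonpos this]
    ring_nf
  · have : 0 < y := hy
    simp only [abs_of_pos this]
    ring_nf

namespace HolderBound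

variable {E : ℝ → ℝ} {C α : ℝ} (H : HolderBound E C α)

include H

/-- For r < s the difference of E cancels 1/(s-r), and the remaining constant of order 1/s is
integrated over an interval of length s. For r > s a majorant independent of s is r^α(1 +
1/r)e^{-r/2}, up to a constant; it is integrable at 0 because α > 0. -/
lemma exists_bound_of_le_one : ∃ B : ℝ, 0 ≤ B ∧ ∀ s, 0 < s → s ≤ 1 →
    |∫ r, logIntegrand E s r ∂halfLine| ≤ B := by
  have hC := H.C_nonneg
  have hα := H.pos
  set G : ℝ → ℝ := fun r => 2 * C * (r ^ (α + 1 - 1) * Real.exp (-(1 / 2 * r)) +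
    r ^ (α - 1) * Real.exp (-(1 / 2 * r))) with hG
  have hGi : Integrable G halfLine :=
    ((integrable_rpow_mul_exp (by linarith) (by norm_num)).add
      (integrable_rpow_mul_exp hα (by norm_num))).const_mul _
  have hGpos : ∀ r, 0 < r → 0 ≤ G r := fun r hr => by
    simp only [hG]; positivity
  have hG0 : 0 ≤ ∫ r, G r ∂halfLine := integral_nonneg_of_ae (by
    filter_upwards [ae_halfLine_pos] with r hr using hGpos r hr)
  refine ⟨4 * C + ∫ r, G r ∂halfLine, by positivity, fun s hs hs1 => ?_⟩
  have hpt : ∀ᵐ r ∂halfLine, ‖logIntegrand E s r‖ ≤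
      (Iio s).indicator (fun _ => 4 * C / s) r + G r := by
    filter_upwards [ae_halfLine_pos, ae_halfLine_ne s] with r hr hrs
    rw [Real.norm_eq_abs]
    rcases lt_or_gt_of_ne hrs with h | h
    · rw [indicator_of_mem (show r ∈ Iio s from h)]
      have hx : 0 < s - r := by linarith
      have h1 := abs_logIntegrand_of_lt (E := E) hr h
      have h2 : |E r - E s| ≤ C * 1 * (s - r) := by
        rw [abs_sub_comm]
        refine (H.sub_le r s hr h.le).trans ?_
        gcongr
        exact Real.rpow_le_one hs.le hs1 hα.le
      have h3 : 1 + 1 / (r + s) ≤ 2 / s := by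
        have e1 : 1 / (r + s) ≤ 1 / s := one_div_le_one_div_of_le hs (by linarith)
        have e2 : 1 ≤ 1 / s := by rw [le_div_iff₀ hs]; linarith
        have e3 : 2 / s = 1 / s + 1 / s := by ring
        linarith
      calc _ ≤ _ := h1
        _ ≤ (C * 1 * (s - r)) * (1 + 1 / (s - r)) * (2 / s) := by gcongr
        _ = C * ((s - r) + 1) * (2 / s) := by field_simp
        _ ≤ C * 2 * (2 / s) := by gcongr; linarith
        _ = 4 * C / s := by ring
        _ ≤ _ := by linarith [hGpos r hr]
    · have hind : 0 ≤ (Iio s).indicator (fun _ => 4 * C / s) r :=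
        indicator_nonneg (fun _ _ => by positivity) r
      have hx : 0 < r - s := by linarith
      have h1 := abs_logIntegrand_of_gt (E := E) hs h
      have h2 : |E r - E s| / (r - s) ≤ C * r ^ α := by
        rw [div_le_iff₀ hx]
        exact H.sub_le s r hs h.le
      have h3 : 1 + 1 / (r + s) ≤ 1 + 1 / r := by gcongr; linarith
      have h4 : Real.exp (-((r - s) / 2)) ≤ 2 * Real.exp (-(1 / 2 * r)) := by
        have e1 : Real.exp (-((r - s) / 2)) = Real.exp (s / 2) * Real.exp (-(1 / 2 * r)) := by
          rw [← Real.exp_add]; ring_nf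
        have e2 : Real.exp (s / 2) ≤ 2 := by
          have e3 : Real.exp (s / 2) ≤ Real.exp (1 / 2) := Real.exp_le_exp.2 (by linarith)
          have e4 : Real.exp (1 / 2) * Real.exp (1 / 2) = Real.exp 1 := by
            rw [← Real.exp_add]; norm_num
          nlinarith [Real.exp_one_lt_d9, Real.exp_pos (1 / 2)]
        rw [e1]
        gcongr
      calc _ ≤ _ := h1
        _ ≤ (C * r ^ α) * (2 * Real.exp (-(1 / 2 * r))) * (1 + 1 / r) := by gcongr
        _ = G r := by
            simp only [hG]
            rw [add_sub_cancel_right, Real.rpow_sub_one hr.ne']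
            field_simp
        _ ≤ _ := by linarith
  have h := norm_integral_le_of_norm_le ((integrable_indicator_Iio (4 * C / s) s).add hGi) hpt
  rw [Real.norm_eq_abs] at h
  refine h.trans (le_of_eq ?_)
  simp only [Pi.add_apply]
  rw [integral_add (integrable_indicator_Iio (4 * C / s) s) hGi, integral_indicator_Iio hs]
  congr 1
  field_simp

/-- The linear growth has two sources: a bounded integrand on (0,s), and a neighbourhood of r = s
where the Lipschitz constant is of order s^α ≤ s and the integrand is localized by e^{-|r-s|/4}. -/
lemma exists_bound_of_one_le : ∃ B : ℝ, 0 ≤ B ∧ ∀ s, 1 ≤ s →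
    |∫ r, logIntegrand E s r ∂halfLine| ≤ B * s := by
  have hC := H.C_nonneg
  have hα := H.pos
  have hpi := Real.pi_pos
  set Z := ∫ y : ℝ, Real.exp (-(|y| / 4)) with hZ
  have hZ0 : 0 ≤ Z := integral_nonneg fun _ => (Real.exp_pos _).le
  refine ⟨8 * Real.pi + 8 * C * Z, by positivity, fun s hs1 => ?_⟩
  have hs : 0 < s := by linarith
  have hEi : Integrable (fun r : ℝ => Real.exp (-(|r - s| / 4))) :=
    integrable_exp_neg_abs.comp_sub_right s
  have hpt : ∀ᵐ r ∂halfLine, ‖logIntegrand E s r‖ ≤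
      (Iio s).indicator (fun _ => 8 * Real.pi) r + 8 * C * s * Real.exp (-(|r - s| / 4)) := by
    filter_upwards [ae_halfLine_pos, ae_halfLine_ne s] with r hr hrs
    rw [Real.norm_eq_abs]
    have hrpow : ∀ y : ℝ, 1 ≤ y → y ^ α ≤ y := fun y hy => by
      calc y ^ α ≤ y ^ (1 : ℝ) := Real.rpow_le_rpow_of_exponent_le hy H.le_one
        _ = y := Real.rpow_one y
    have h3 : 1 + 1 / (r + s) ≤ 2 := by
      have : 1 / (r + s) ≤ 1 := by rw [div_le_one (by linarith)]; linarith
      linarith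
    rcases lt_or_gt_of_ne hrs with h | h
    · rw [indicator_of_mem (show r ∈ Iio s from h)]
      have hx : 0 < s - r := by linarith
      have h1 := abs_logIntegrand_of_lt (E := E) hr h
      have h2 := H.abs_sub_le_two_pi r s
      have habs : |r - s| = s - r := by rw [abs_sub_comm, abs_of_pos hx]
      rw [habs]
      have hq : |E r - E s| / (s - r) ≤ 2 * Real.pi + 2 * C * s * Real.exp (-((s - r) / 4)) := by
        rcases le_total (s - r) 1 with hx1 | hx1
        · have h4 : |E r - E s| / (s - r) ≤ C * s := by
            rw [div_le_iff₀ hx, abs_sub_comm]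
            refine (H.sub_le r s hr h.le).trans ?_
            gcongr
            exact hrpow s hs1
          have h5 : 1 ≤ 2 * Real.exp (-((s - r) / 4)) := by
            have := Real.one_sub_le_exp_neg ((s - r) / 4)
            linarith
          calc _ ≤ C * s * 1 := by linarith
            _ ≤ C * s * (2 * Real.exp (-((s - r) / 4))) := by gcongr
            _ ≤ _ := by linarith
        · have h4 : |E r - E s| / (s - r) ≤ 2 * Real.pi := by
            rw [div_le_iff₀ hx]
            nlinarith
          have : 0 ≤ 2 * C * s * Real.exp (-((s - r) / 4)) := by positivity
          linarith
      calc _ ≤ _ := h1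
        _ = (|E r - E s| + |E r - E s| / (s - r)) * (1 + 1 / (r + s)) := by ring
        _ ≤ (2 * Real.pi + (2 * Real.pi + 2 * C * s * Real.exp (-((s - r) / 4)))) * 2 := by
            gcongr
        _ = 8 * Real.pi + 4 * C * s * Real.exp (-((s - r) / 4)) := by ring
        _ ≤ _ := by
            have : 0 ≤ C * s * Real.exp (-((s - r) / 4)) := by positivity
            linarith
    · rw [indicator_of_notMem (show r ∉ Iio s from not_lt.2 h.le), zero_add]
      have hx : 0 < r - s := by linarith
      rw [abs_of_pos hx]
      have h1 := abs_logIntegrand_of_gt (E := E) hs h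
      have h2 : |E r - E s| / (r - s) ≤ C * r := by
        rw [div_le_iff₀ hx]
        refine (H.sub_le s r hs h.le).trans ?_
        gcongr
        exact hrpow r (by linarith)
      have h4 : r * Real.exp (-((r - s) / 2)) ≤ 4 * s * Real.exp (-((r - s) / 4)) := by
        have e1 : Real.exp (-((r - s) / 2)) =
            Real.exp (-((r - s) / 4)) * Real.exp (-((r - s) / 4)) := by
          rw [← Real.exp_add]; ring_nf
        have e2 : (1 + (r - s) / 4) * Real.exp (-((r - s) / 4)) ≤ 1 := by
          calc _ ≤ Real.exp ((r - s) / 4) * Real.exp (-((r - s) / 4)) := by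
                gcongr
                linarith [Real.add_one_le_exp ((r - s) / 4)]
            _ = 1 := by rw [← Real.exp_add]; simp
        have e3 : r ≤ 4 * s * (1 + (r - s) / 4) := by nlinarith
        have e4 := Real.exp_pos (-((r - s) / 4))
        calc r * Real.exp (-((r - s) / 2))
            = r * Real.exp (-((r - s) / 4)) * Real.exp (-((r - s) / 4)) := by rw [e1]; ring
          _ ≤ 4 * s * (1 + (r - s) / 4) * Real.exp (-((r - s) / 4)) *
              Real.exp (-((r - s) / 4)) := by gcongr
          _ = 4 * s * ((1 + (r - s) / 4) * Real.exp (-((r - s) / 4))) *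
              Real.exp (-((r - s) / 4)) := by ring
          _ ≤ 4 * s * 1 * Real.exp (-((r - s) / 4)) := by gcongr
          _ = _ := by ring
      calc _ ≤ _ := h1
        _ ≤ C * r * Real.exp (-((r - s) / 2)) * 2 := by gcongr
        _ = 2 * C * (r * Real.exp (-((r - s) / 2))) := by ring
        _ ≤ 2 * C * (4 * s * Real.exp (-((r - s) / 4))) := by gcongr
        _ = _ := by ring
  have hEi' : Integrable (fun r : ℝ => 8 * C * s * Real.exp (-(|r - s| / 4))) halfLine :=
    (hEi.restrict).const_mul _
  have h := norm_integral_le_of_norm_le ((integrable_indicator_Iio (8 * Real.pi) s).add hEi') hpt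
  rw [Real.norm_eq_abs] at h
  refine h.trans ?_
  simp only [Pi.add_apply]
  rw [integral_add (integrable_indicator_Iio (8 * Real.pi) s) hEi', integral_indicator_Iio hs,
    integral_const_mul]
  have hle : ∫ r, Real.exp (-(|r - s| / 4)) ∂halfLine ≤ Z := by
    calc _ ≤ ∫ r : ℝ, Real.exp (-(|r - s| / 4)) :=
          setIntegral_le_integral hEi (ae_of_all _ fun _ => (Real.exp_pos _).le)
      _ = Z := integral_sub_right_eq_self (fun y : ℝ => Real.exp (-(|y| / 4))) s
  calc _ ≤ s * (8 * Real.pi) + 8 * C * s * Z := by gcongr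
    _ = _ := by ring

/-- The exponent of `X(e^s) / X^±(e^{-s})` is `O(s)` on all of `(0, ∞)`. -/
lemma exists_exponent_bound : ∃ B : ℝ, 0 ≤ B ∧ ∀ s, 0 < s →
    |1 / Real.pi * (-(1 - Real.exp (-(2 * s))) * (∫ r, logIntegrand E s r ∂halfLine) - s * E s)| ≤
      B * s := by
  obtain ⟨B₁, hB₁, h₁⟩ := H.exists_bound_of_le_one
  obtain ⟨B₂, hB₂, h₂⟩ := H.exists_bound_of_one_le
  have hpi := Real.pi_pos
  refine ⟨1 / Real.pi * (2 * B₁ + B₂ + Real.pi), by positivity, fun s hs => ?_⟩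
  have h0 : 0 ≤ 1 - Real.exp (-(2 * s)) := by
    linarith [Real.exp_le_one_iff.2 (show -(2 * s) ≤ 0 by linarith)]
  have h3 : 1 - Real.exp (-(2 * s)) ≤ 2 * s := by linarith [Real.one_sub_le_exp_neg (2 * s)]
  have h4 : 1 - Real.exp (-(2 * s)) ≤ 1 := by linarith [Real.exp_pos (-(2 * s))]
  -- Near 0 the factor 1 - e^{-2s} ≤ 2s supplies the smallness; for s ≥ 1 it is merely bounded by 1
  -- and the linear bound on the integral takes over.
  have h5 : (1 - Real.exp (-(2 * s))) * |∫ r, logIntegrand E s r ∂halfLine| ≤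
      (2 * B₁ + B₂) * s := by
    rcases le_total s 1 with h | h
    · calc _ ≤ 2 * s * B₁ := by gcongr; exact h₁ s hs h
        _ ≤ _ := by nlinarith
    · calc _ ≤ 1 * (B₂ * s) := by gcongr; exact h₂ s h
        _ ≤ _ := by nlinarith
  rw [abs_mul, abs_of_pos (by positivity : 0 < 1 / Real.pi), mul_assoc (1 / Real.pi)]
  gcongr
  calc _ ≤ |-(1 - Real.exp (-(2 * s))) * (∫ r, logIntegrand E s r ∂halfLine)| + |s * E s| :=
        abs_sub _ _
    _ ≤ (2 * B₁ + B₂) * s + s * Real.pi := by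
        rw [abs_mul, abs_neg, abs_of_nonneg h0, abs_mul, abs_of_pos hs]
        gcongr
        exact H.abs_le s
    _ = _ := by ring

end HolderBound

/-! ### Factors of h that are 1 + O(s). -/

lemma abs_exp_sub_one_le_mul_exp (x : ℝ) : |Real.exp x - 1| ≤ |x| * Real.exp |x| := by
  rcases le_total 0 x with h | h
  · have h1 : (1 - x) * Real.exp x ≤ 1 := by
      calc _ ≤ Real.exp (-x) * Real.exp x := by gcongr; exact Real.one_sub_le_exp_neg x
        _ = 1 := by rw [← Real.exp_add]; simp
    rw [abs_of_nonneg h, abs_of_nonneg (by linarith [Real.one_le_exp h])]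
    linarith
  · rw [abs_of_nonpos h, abs_of_nonpos (by linarith [Real.exp_le_one_iff.2 h])]
    have h1 := Real.add_one_le_exp x
    have h2 : 1 ≤ Real.exp (-x) := Real.one_le_exp (by linarith)
    nlinarith

namespace NearOne

lemma mul {f g : ℝ → ℝ} {C₁ K₁ C₂ K₂ : ℝ} (hf : NearOne f C₁ K₁) (hg : NearOne g C₂ K₂) :
    NearOne (fun s => f s * g s) (C₁ + C₂) (K₁ + (C₂ + K₂)) where
  measurable := hf.measurable.mul hg.measurable
  C_nonneg := add_nonneg hf.C_nonneg hg.C_nonneg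
  K_nonneg := add_nonneg hf.K_nonneg (add_nonneg hg.C_nonneg hg.K_nonneg)
  bound s hs := by
    have h1 := hf.bound s hs
    have h2 := hg.bound s hs
    have h3 := hg.abs_le hs
    have hC₁ := hf.C_nonneg
    have hC₂ := hg.C_nonneg
    have hK₁ := hf.K_nonneg
    calc |f s * g s - 1| = |(f s - 1) * g s + (g s - 1)| := by ring_nf
      _ ≤ |f s - 1| * |g s| + |g s - 1| := by
          rw [← abs_mul]; exact abs_add_le _ _
      _ ≤ (C₁ * s * Real.exp (K₁ * s)) * Real.exp ((C₂ + K₂) * s) +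
          C₂ * s * Real.exp (K₂ * s) := by gcongr
      _ ≤ (C₁ * s * Real.exp (K₁ * s)) * Real.exp ((C₂ + K₂) * s) +
          C₂ * s * Real.exp ((K₁ + (C₂ + K₂)) * s) := by
          gcongr
          linarith
      _ = (C₁ + C₂) * s * Real.exp ((K₁ + (C₂ + K₂)) * s) := by
          rw [mul_assoc (C₁ * s), ← Real.exp_add]; ring_nf

lemma exp_of_abs_le {A : ℝ → ℝ} (hA : Measurable A) {B : ℝ} (hB : 0 ≤ B)
    (h : ∀ s, 0 < s → |A s| ≤ B * s) : NearOne (fun s => Real.exp (A s)) B B where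
  measurable := by fun_prop
  C_nonneg := hB
  K_nonneg := hB
  bound s hs := by
    have h1 := h s hs
    refine (abs_exp_sub_one_le_mul_exp _).trans ?_
    gcongr

end NearOne

lemma abs_polynomial_exp_sub_le (φ : Polynomial ℝ) : ∃ C K : ℝ, 0 ≤ C ∧ 0 ≤ K ∧ ∀ s : ℝ, 0 < s →
    |φ.eval (Real.exp s) - φ.eval (Real.exp (-s))| ≤ C * s * Real.exp (K * s) := by
  induction φ using Polynomial.induction_on' with
  | add p r hp hr =>
    obtain ⟨C₁, K₁, hC₁, hK₁, h₁⟩ := hp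
    obtain ⟨C₂, K₂, hC₂, hK₂, h₂⟩ := hr
    refine ⟨C₁ + C₂, K₁ + K₂, by positivity, by positivity, fun s hs => ?_⟩
    rw [Polynomial.eval_add, Polynomial.eval_add, add_sub_add_comm]
    calc _ ≤ _ := abs_add_le _ _
      _ ≤ C₁ * s * Real.exp (K₁ * s) + C₂ * s * Real.exp (K₂ * s) :=
          add_le_add (h₁ s hs) (h₂ s hs)
      _ ≤ C₁ * s * Real.exp ((K₁ + K₂) * s) + C₂ * s * Real.exp ((K₁ + K₂) * s) := by
          gcongr <;> linarith
      _ = _ := by ring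
  | monomial n a =>
    refine ⟨|a| * (2 * n), n, by positivity, by positivity, fun s hs => ?_⟩
    rw [Polynomial.eval_monomial, Polynomial.eval_monomial, ← mul_sub, abs_mul, ← Real.exp_nat_mul,
      ← Real.exp_nat_mul]
    have h0 : 0 ≤ (n : ℝ) * s := by positivity
    have h1 : Real.exp (n * s) - Real.exp (n * -s) ≤ 2 * n * s * Real.exp (n * s) := by
      have h2 := Real.one_sub_le_exp_neg (2 * (n * s))
      have h3 : Real.exp (n * -s) = Real.exp (n * s) * Real.exp (-(2 * (n * s))) := by
        rw [← Real.exp_add]; ring_nf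
      rw [h3]
      nlinarith [Real.exp_pos (n * s)]
    have h4 : Real.exp (n * -s) ≤ Real.exp (n * s) := Real.exp_le_exp.2 (by linarith)
    rw [abs_of_nonneg (show 0 ≤ Real.exp (n * s) - Real.exp (n * -s) by linarith)]
    calc _ ≤ |a| * (2 * n * s * Real.exp (n * s)) := by gcongr
      _ = _ := by ring

/-- The denominator is evaluated at e^{-s} in (0,1), where |φ| is bounded below by compactness of
[0,1]. -/
lemma nearOne_polynomial_ratio {φ : Polynomial ℝ} (hφ : ∀ x ∈ Icc (0 : ℝ) 1, φ.eval x ≠ 0) :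
    ∃ C K : ℝ, NearOne (fun s => φ.eval (Real.exp s) / φ.eval (Real.exp (-s))) C K := by
  obtain ⟨C, K, hC, hK, h⟩ := abs_polynomial_exp_sub_le φ
  obtain ⟨x₀, hx₀, hmin⟩ := isCompact_Icc.exists_isMinOn (s := Icc (0 : ℝ) 1)
    ⟨0, by simp⟩ (f := fun x => |φ.eval x|) (by fun_prop)
  set m := |φ.eval x₀| with hm
  have hm0 : 0 < m := abs_pos.2 (hφ x₀ hx₀)
  refine ⟨C / m, K, ⟨by fun_prop, by positivity, hK, fun s hs => ?_⟩⟩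
  have hmem : Real.exp (-s) ∈ Icc (0 : ℝ) 1 :=
    ⟨(Real.exp_pos _).le, Real.exp_le_one_iff.2 (by linarith)⟩
  have h1 : m ≤ |φ.eval (Real.exp (-s))| := hmin hmem
  have h2 := hφ _ hmem
  rw [div_sub_one h2, abs_div]
  calc _ ≤ C * s * Real.exp (K * s) / m := by
        gcongr
        exact h s hs
    _ = _ := by ring

/-- `argQ`, extended by `0` to all of `ℝ`. -/
def argQ₀ (d : ℝ) : ℝ → ℝ := (Ioi 0).indicator (argQ d)

lemma argQ₀_of_pos (d : ℝ) {s : ℝ} (hs : 0 < s) : argQ₀ d s = argQ d s :=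
  indicator_of_mem (show s ∈ Ioi 0 from hs) _

section

variable {d : ℝ}

lemma exists_holderBound_argQ₀ (hd : d ∈ Ioo (-1 / 2 : ℝ) (1 / 2)) (hd0 : d ≠ 0) :
    ∃ C : ℝ, HolderBound (argQ₀ d) C (regExp d) ∧
    ∀ s, 0 < s → |argQ₀ d s + Real.pi * d| ≤ C * s ^ (1 + regExp d) := by
  obtain ⟨C, hC, h1, h2⟩ := exists_argQ_bounds hd hd0
  refine ⟨C, ⟨hC, regExp_pos hd.1, min_le_left _ _, fun s => ?_, fun r s hr hrs => ?_⟩,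
    fun s hs => ?_⟩
  · rcases lt_or_ge 0 s with hs | hs
    · rw [argQ₀_of_pos d hs]
      exact abs_argQ_le d s
    · rw [argQ₀, indicator_of_notMem (show s ∉ Ioi 0 from not_lt.2 hs), abs_zero]
      exact Real.pi_pos.le
  · rw [argQ₀_of_pos d hr, argQ₀_of_pos d (hr.trans_le hrs)]
    exact h2 r s hr hrs
  · rw [argQ₀_of_pos d hs]
    exact h1 s hs

lemma HolderBound.measurable_argQ₀ {C α : ℝ} (H : HolderBound (argQ₀ d) C α) :
    Measurable (argQ₀ d) := by
  classical
  have h1 : argQ₀ d = (Ioi 0).piecewise (argQ₀ d) 0 := by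
    rw [Set.piecewise_eq_indicator]
    simp only [argQ₀, indicator_indicator, inter_self]
  rw [h1]
  exact H.continuousOn.measurable_piecewise continuousOn_const measurableSet_Ioi

end

/-! ### Explicit real formula for h. -/

lemma integral_one_div_sub_inv {t : ℝ} (ht : t ∈ Ioo (0 : ℝ) 1) :
    ∫ τ in Ioo (0 : ℝ) 1, 1 / (τ - t⁻¹) = Real.log (1 - t) := by
  have ht0 := ht.1
  have h1 : 1 < t⁻¹ := (one_lt_inv₀ ht0).2 ht.2
  have hne : ∀ τ ∈ uIcc (0 : ℝ) 1, τ - t⁻¹ ≠ 0 := fun τ hτ => by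
    rw [uIcc_of_le zero_le_one] at hτ
    linarith [hτ.2]
  -- The argument is negative here; `Real.log` is log|·|, whose derivative is still the reciprocal.
  have hder : ∀ τ ∈ uIcc (0 : ℝ) 1, HasDerivAt (fun τ : ℝ => Real.log (τ - t⁻¹))
      (1 / (τ - t⁻¹)) τ := fun τ hτ =>
    ((hasDerivAt_id τ).sub_const _).log (hne τ hτ)
  rw [← intervalIntegral_eq_Ioo, intervalIntegral.integral_eq_sub_of_hasDerivAt hder]
  · rw [← Real.log_div (hne 1 (by simp)) (hne 0 (by simp))]
    congr 1
    field_simp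
    ring
  · apply ContinuousOn.intervalIntegrable
    exact continuousOn_const.div (by fun_prop) hne

section

variable {η : ℝ → ℝ} (hη : ContinuousOn η (Ioo 0 1)) {M : ℝ}
  (hM : ∀ τ ∈ Ioo (0 : ℝ) 1, |η τ| ≤ M) {t : ℝ} (ht : t ∈ Ioo (0 : ℝ) 1)

include hη ht

lemma integrableOn_diff_quotient {L : ℝ}
    (hL : ∀ τ ∈ Ioo (0 : ℝ) 1, |η τ - η t| ≤ L * |τ - t|) :
    IntegrableOn (fun τ => (η τ - η t) / (τ - t)) (Ioo 0 1) := by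
  have hL0 : 0 ≤ L := by
    have h1 : t / 2 ∈ Ioo (0 : ℝ) 1 := ⟨by linarith [ht.1], by linarith [ht.1, ht.2]⟩
    have h2 := (abs_nonneg _).trans (hL _ h1)
    have h3 : 0 < |t / 2 - t| := abs_pos.2 (by linarith [ht.1])
    exact nonneg_of_mul_nonneg_left h2 h3
  have hm : AEStronglyMeasurable (fun τ => (η τ - η t) / (τ - t)) (volume.restrict (Ioo 0 1)) := by
    have h1 := (hη.aestronglyMeasurable (μ := volume) measurableSet_Ioo).aemeasurable
    have h2 : AEMeasurable (fun τ : ℝ => τ - t) (volume.restrict (Ioo 0 1)) := by fun_prop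
    exact ((h1.sub_const _).div h2).aestronglyMeasurable
  refine (integrable_const L).mono' hm ?_
  filter_upwards [ae_restrict_mem measurableSet_Ioo] with τ hτ
  rw [Real.norm_eq_abs, abs_div]
  exact div_le_of_le_mul₀ (abs_nonneg _) hL0 (hL τ hτ)

include hM

lemma integrableOn_div_sub_inv :
    IntegrableOn (fun τ => η τ / (τ - t⁻¹)) (Ioo 0 1) := by
  have h1 : 1 < t⁻¹ := (one_lt_inv₀ ht.1).2 ht.2
  have hc : ContinuousOn (fun τ => η τ / (τ - t⁻¹)) (Ioo 0 1) :=
    hη.div (by fun_prop) fun τ hτ => by linarith [hτ.2]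
  have hM0 : 0 ≤ M := (abs_nonneg _).trans (hM t ht)
  have h2 : 0 < t⁻¹ - 1 := by linarith
  refine (integrable_const (M / (t⁻¹ - 1))).mono' (hc.aestronglyMeasurable measurableSet_Ioo) ?_
  filter_upwards [ae_restrict_mem measurableSet_Ioo] with τ hτ
  rw [Real.norm_eq_abs, abs_div, abs_of_neg (by linarith [hτ.2] : τ - t⁻¹ < 0)]
  gcongr
  · exact hM τ hτ
  · linarith [hτ.2]

/-- The difference of the Cauchy integral of `η` at `t⁻¹` and of its principal value at `t`. -/
lemma integral_div_sub_inv_sub {L : ℝ}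
    (hL : ∀ τ ∈ Ioo (0 : ℝ) 1, |η τ - η t| ≤ L * |τ - t|) :
    (∫ τ in Ioo (0 : ℝ) 1, η τ / (τ - t⁻¹)) -
      ((∫ τ in Ioo (0 : ℝ) 1, (η τ - η t) / (τ - t)) + η t * Real.log ((1 - t) / t)) =
    -(1 - t ^ 2) * (∫ τ in Ioo (0 : ℝ) 1, (η τ - η t) / ((τ - t) * (1 - t * τ))) +
      η t * Real.log t := by
  have ht0 := ht.1
  have i1 := integrableOn_div_sub_inv hη hM ht
  have i2 := integrableOn_diff_quotient hη ht hL
  have i3 : IntegrableOn (fun τ => η t * (1 / (τ - t⁻¹))) (Ioo 0 1) :=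
    (integrableOn_div_sub_inv (η := fun _ => (1 : ℝ)) continuousOn_const
      (M := 1) (fun _ _ => by simp) ht).const_mul _
  -- The identity behind this is 1/(τ - t⁻¹) - 1/(τ - t) = -(1 - t²)/((τ - t)(1 - tτ)). With t =
  -- e^{-s} the factor 1 - t² is what makes the exponent vanish at s = 0.
  have e1 : -(1 - t ^ 2) * (∫ τ in Ioo (0 : ℝ) 1, (η τ - η t) / ((τ - t) * (1 - t * τ))) =
      ∫ τ in Ioo (0 : ℝ) 1, (η τ / (τ - t⁻¹) - η t * (1 / (τ - t⁻¹)) - (η τ - η t) / (τ - t)) := by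
    rw [← integral_const_mul]
    refine setIntegral_congr_fun measurableSet_Ioo fun τ hτ => ?_
    rcases eq_or_ne τ t with rfl | hne
    · simp [div_eq_mul_inv]
    · have n1 : τ - t ≠ 0 := sub_ne_zero.2 hne
      have n2 : 1 - t * τ ≠ 0 := by
        have : t * τ < 1 := by nlinarith [hτ.1, hτ.2, ht.2]
        linarith
      have n3 : τ - t⁻¹ = -(1 - t * τ) / t := by field_simp; ring
      simp only [n3]
      field_simp
      ring
  have i13 : IntegrableOn (fun τ => η τ / (τ - t⁻¹) - η t * (1 / (τ - t⁻¹))) (Ioo 0 1) :=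
    Integrable.sub i1 i3
  rw [e1, integral_sub i13 i2, integral_sub i1 i3, integral_const_mul, integral_one_div_sub_inv ht,
    Real.log_div (by linarith [ht.2]) ht0.ne']
  ring

end

lemma exp_neg_image_Ioi : (fun r : ℝ => Real.exp (-r)) '' Ioi 0 = Ioo 0 1 := by
  ext τ
  constructor
  · rintro ⟨r, hr, rfl⟩
    exact ⟨Real.exp_pos _, Real.exp_lt_one_iff.2 (neg_lt_zero.2 hr)⟩
  · intro hτ
    exact ⟨-Real.log τ, neg_pos.2 (Real.log_neg hτ.1 hτ.2), by simp [Real.exp_log hτ.1]⟩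

lemma integral_logIntegrand {η E : ℝ → ℝ} (hE : ∀ r, 0 < r → η (Real.exp (-r)) = E r)
    {s : ℝ} (hs : 0 < s) :
    ∫ τ in Ioo (0 : ℝ) 1, (η τ - η (Real.exp (-s))) /
      ((τ - Real.exp (-s)) * (1 - Real.exp (-s) * τ)) = ∫ r, logIntegrand E s r ∂halfLine := by
  rw [← exp_neg_image_Ioi, integral_image_eq_integral_abs_deriv_smul measurableSet_Ioi
    (f' := fun r => -Real.exp (-r))]
  · refine setIntegral_congr_fun measurableSet_Ioi fun r hr => ?_
    simp only [smul_eq_mul, abs_neg, abs_of_pos (Real.exp_pos (-r)), hE r hr, hE s hs]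
    rfl
  · intro r _
    have := (hasDerivAt_neg r).exp
    simpa using this.hasDerivWithinAt
  · intro a _ b _ hab
    simpa using hab

/-- The exponent of `X(e^s) / X^±(e^{-s})`. -/
def ratioExponent (E : ℝ → ℝ) (s : ℝ) : ℝ :=
  1 / Real.pi * (-(1 - Real.exp (-(2 * s))) * (∫ r, logIntegrand E s r ∂halfLine) - s * E s)

lemma X_ofReal (d x : ℝ) :
    X d x = (if 0 < d then (x : ℂ)⁻¹ else 1) *
      (Real.exp (1 / Real.pi * ∫ τ in Ioo (0 : ℝ) 1, eta d τ / (τ - x)) : ℝ) := by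
  have e : X₀ d x = (Real.exp (1 / Real.pi * ∫ τ in Ioo (0 : ℝ) 1, eta d τ / (τ - x)) : ℝ) := by
    rw [X₀, intervalIntegral_eq_Ioo, Complex.ofReal_exp, Complex.ofReal_mul,
      ← integral_complex_ofReal]
    push_cast
    rfl
  unfold X
  split_ifs <;> simp only [e, one_mul]

section

variable {d C α : ℝ} (hd : d ∈ Ioo (-1 / 2 : ℝ) (1 / 2)) (H : HolderBound (argQ₀ d) C α)

include hd

lemma eta_eq_argQ₀ {τ : ℝ} (hτ : τ ∈ Ioo (0 : ℝ) 1) : eta d τ = argQ₀ d (-Real.log τ) := by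
  have h1 : 0 < -Real.log τ := neg_pos.2 (Real.log_neg hτ.1 hτ.2)
  have h2 := eta_exp_neg hd h1
  rwa [neg_neg, Real.exp_log hτ.1, ← argQ₀_of_pos d h1] at h2

include H

lemma continuousOn_eta : ContinuousOn (eta d) (Ioo 0 1) := by
  have h1 : ContinuousOn (fun τ : ℝ => -Real.log τ) (Ioo 0 1) :=
    (Real.continuousOn_log.mono fun τ hτ => hτ.1.ne').neg
  exact (H.continuousOn.comp h1 fun τ hτ => neg_pos.2 (Real.log_neg hτ.1 hτ.2)).congr
    fun τ hτ => eta_eq_argQ₀ hd hτ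

/-- The boundary value `X⁺(t)`, by the Sokhotski–Plemelj formula. -/
lemma tendsto_X_upper {t : ℝ} (ht : t ∈ Ioo (0 : ℝ) 1) :
    Tendsto (X d) (𝓝[{z : ℂ | 0 < z.im}] (t : ℂ))
      (𝓝 ((if 0 < d then (t : ℂ)⁻¹ else 1) *
        ((Real.exp (1 / Real.pi * ((∫ τ in Ioo (0 : ℝ) 1, (eta d τ - eta d t) / (τ - t)) +
          eta d t * Real.log ((1 - t) / t))) : ℝ) * Complex.exp ((eta d t : ℂ) * Complex.I)))) := by
  obtain ⟨L, hL⟩ := H.comp_log_lipschitz ht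
  have h0 := tendsto_cauchy_upper (continuousOn_eta hd H) (M := Real.pi)
    (fun τ _ => Complex.abs_arg_le_pi _) ht (half_pos ht.1) (L := L) fun x hx hxt τ hτ => by
      rw [eta_eq_argQ₀ hd hx, eta_eq_argQ₀ hd hτ]
      exact hL x hx hxt τ hτ
  have h1 := (Complex.continuous_exp.tendsto _).comp (h0.const_mul (1 / Real.pi : ℂ))
  have hpi : (Real.pi : ℂ) ≠ 0 := by exact_mod_cast Real.pi_pos.ne'
  rw [mul_add, Complex.exp_add, show (1 / Real.pi : ℂ) * (((eta d t * Real.pi : ℝ) : ℂ) * Complex.I)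
    = (eta d t : ℂ) * Complex.I by push_cast; field_simp] at h1
  have h2 : Tendsto (X₀ d) (𝓝[{z : ℂ | 0 < z.im}] (t : ℂ)) _ := h1
  have htc : (t : ℂ) ≠ 0 := by exact_mod_cast ht.1.ne'
  rw [Complex.ofReal_exp, Complex.ofReal_mul, Complex.ofReal_div, Complex.ofReal_one]
  by_cases hd1 : 0 < d
  · have e : X d = fun z => z⁻¹ * X₀ d z := by ext z; simp [X, hd1]
    rw [if_pos hd1, e]
    exact ((tendsto_id.mono_left nhdsWithin_le_nhds).inv₀ htc).mul h2
  · have e : X d = X₀ d := by ext z; simp [X, hd1]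
    rw [if_neg hd1, e, one_mul]
    exact h2

/-- An explicit real expression for the function `h`. -/
lemma h_eq (φ : Polynomial ℝ) (q : ℕ) {s : ℝ} (hs : 0 < s) :
    h d φ q s = ((-Real.sin (argQ₀ d s) / Real.sin (Real.pi * d) *
      (φ.eval (Real.exp s) / φ.eval (Real.exp (-s))) *
      Real.exp (if 0 < d then -2 * s else 0) * Real.exp (ratioExponent (argQ₀ d) s) *
      Real.exp (-2 * q * s) : ℝ) : ℂ) := by
  set t := Real.exp (-s) with ht
  have htm : t ∈ Ioo (0 : ℝ) 1 := ⟨Real.exp_pos _, Real.exp_lt_one_iff.2 (neg_lt_zero.2 hs)⟩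
  have hts : Real.exp s = t⁻¹ := by rw [ht, Real.exp_neg, inv_inv]
  have hE : ∀ r, 0 < r → eta d (Real.exp (-r)) = argQ₀ d r := fun r hr => by
    rw [eta_exp_neg hd hr, argQ₀_of_pos d hr]
  obtain ⟨L, hL⟩ := H.comp_log_lipschitz htm
  have hL' : ∀ τ ∈ Ioo (0 : ℝ) 1, |eta d τ - eta d t| ≤ L * |τ - t| := fun τ hτ => by
    rw [eta_eq_argQ₀ hd htm, eta_eq_argQ₀ hd hτ]
    exact hL t htm (by simpa using half_pos htm.1) τ hτ
  have hX := tendsto_X_upper hd H htm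
  have hexp := integral_div_sub_inv_sub (continuousOn_eta hd H) (M := Real.pi)
    (fun τ _ => Complex.abs_arg_le_pi _) htm hL'
  have hlog : ∫ τ in Ioo (0 : ℝ) 1, (eta d τ - eta d t) / ((τ - t) * (1 - t * τ)) =
      ∫ r, logIntegrand (argQ₀ d) s r ∂halfLine := integral_logIntegrand hE hs
  have hlt : Real.log t = -s := by rw [ht, Real.log_exp]
  have ht2 : t ^ 2 = Real.exp (-(2 * s)) := by rw [ht, ← Real.exp_nat_mul]; congr 1; push_cast; ring
  rw [hlog, hlt, ht2] at hexp
  have hes : eta d t = argQ₀ d s := hE s hs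
  have hp := limPlus_eq hX
  have hm := limMinus_eq_conj (X_conj d) hX
  have hx := X_ofReal d t⁻¹
  set a := ∫ τ in Ioo (0 : ℝ) 1, eta d τ / (τ - t⁻¹) with ha
  set b := (∫ τ in Ioo (0 : ℝ) 1, (eta d τ - eta d t) / (τ - t)) +
    eta d t * Real.log ((1 - t) / t) with hb
  have hA : ratioExponent (argQ₀ d) s = 1 / Real.pi * a - 1 / Real.pi * b := by
    rw [ratioExponent, ← mul_sub, hexp, hes]
    ring
  set θ := argQ₀ d s with hθ
  rw [hes] at hp hm
  -- For d > 0 the prefactors z⁻¹ in X(e^s) and X^±(e^{-s}) are t and t⁻¹, with quotient t² =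
  -- e^{-2s}.
  have hκ : (if 0 < d then ((t⁻¹ : ℝ) : ℂ)⁻¹ else 1) / (if 0 < d then (t : ℂ)⁻¹ else 1) =
      ((Real.exp (if 0 < d then -2 * s else 0) : ℝ) : ℂ) := by
    split_ifs
    · rw [show -2 * s = -(2 * s) by ring, ← ht2]
      push_cast
      field_simp
    · simp
  have hconj : (starRingEnd ℂ) ((if 0 < d then (t : ℂ)⁻¹ else 1) *
      ((Real.exp (1 / Real.pi * b) : ℝ) * Complex.exp ((θ : ℂ) * Complex.I))) =
      (if 0 < d then (t : ℂ)⁻¹ else 1) *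
      ((Real.exp (1 / Real.pi * b) : ℝ) * Complex.exp (-((θ : ℂ) * Complex.I))) := by
    rw [map_mul, map_mul, Complex.conj_ofReal, ← Complex.exp_conj]
    congr 1
    · split_ifs <;> simp
    · congr 2
      simp
  rw [hconj] at hm
  have hpre : (if 0 < d then (t : ℂ)⁻¹ else 1) ≠ 0 := by
    have : (t : ℂ) ≠ 0 := by exact_mod_cast htm.1.ne'
    split_ifs <;> simp [this]
  -- The jump of the phase is -2i sin θ, which the normalization 1/(2i sin(πd)) in h turns into the
  -- real ratio -sin θ/sin(πd).
  have hsin : 1 / Complex.exp ((θ : ℂ) * Complex.I) - 1 / Complex.exp (-((θ : ℂ) * Complex.I)) =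
      -(2 * Complex.I * (Real.sin θ : ℂ)) := by
    rw [one_div, one_div, ← Complex.exp_neg, ← Complex.exp_neg, neg_neg, Complex.ofReal_sin,
      Complex.sin, neg_mul]
    linear_combination (Complex.exp (-((θ : ℂ) * Complex.I)) - Complex.exp (θ * Complex.I)) *
      Complex.I_mul_I
  have hdiff : X d (t⁻¹ : ℝ) / limPlus (X d) t - X d (t⁻¹ : ℝ) / limMinus (X d) t =
      ((Real.exp (if 0 < d then -2 * s else 0) * Real.exp (ratioExponent (argQ₀ d) s) : ℝ) : ℂ) *
        (1 / Complex.exp ((θ : ℂ) * Complex.I) - 1 / Complex.exp (-((θ : ℂ) * Complex.I))) := by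
    have hb0 : ((Real.exp (1 / Real.pi * b) : ℝ) : ℂ) ≠ 0 := by
      exact_mod_cast (Real.exp_pos _).ne'
    rw [hx, hp, hm, hA, Real.exp_sub, Complex.ofReal_mul, Complex.ofReal_div, ← hκ]
    field_simp
  unfold h
  rw [← ht, hts, hdiff, hsin]
  have hI : Complex.I ≠ 0 := Complex.I_ne_zero
  push_cast
  field_simp

end

lemma measurable_ratioExponent {E : ℝ → ℝ} (hE : Measurable E) : Measurable (ratioExponent E) := by
  have h1 : Measurable (Function.uncurry (logIntegrand E)) := by
    unfold logIntegrand Function.uncurry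
    fun_prop
  have h2 : Measurable fun s => ∫ r, logIntegrand E s r ∂halfLine :=
    (h1.stronglyMeasurable.integral_prod_right').measurable
  unfold ratioExponent
  fun_prop

section

variable {d : ℝ} (hd : d ∈ Ioo (-1 / 2 : ℝ) (1 / 2)) (hd0 : d ≠ 0)

include hd hd0

/-- Since θ(s) = -πd + O(s^{1+α}), the ratio tends to 1 at the same rate, and s^{1+α} ≤ s e^s
because α lies in (0,1]. -/
lemma nearOne_sin_ratio {C : ℝ} (H : HolderBound (argQ₀ d) C (regExp d))
    (hC : ∀ s, 0 < s → |argQ₀ d s + Real.pi * d| ≤ C * s ^ (1 + regExp d)) :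
    ∃ B K : ℝ, NearOne (fun s => -Real.sin (argQ₀ d s) / Real.sin (Real.pi * d)) B K := by
  have hsin := sin_pi_mul_ne_zero hd hd0
  have hC0 := H.C_nonneg
  have hm := H.measurable_argQ₀
  refine ⟨C / |Real.sin (Real.pi * d)|, 1, ⟨by fun_prop, by positivity, zero_le_one,
    fun s hs => ?_⟩⟩
  have h1 : |-Real.sin (argQ₀ d s) - Real.sin (Real.pi * d)| ≤ C * s ^ (1 + regExp d) := by
    refine le_trans ?_ (hC s hs)
    have := Real.abs_sin_sub_sin_le (argQ₀ d s) (-(Real.pi * d))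
    rw [Real.sin_neg, sub_neg_eq_add, sub_neg_eq_add] at this
    rwa [← neg_add', abs_neg]
  have h2 : s ^ (1 + regExp d) ≤ s * Real.exp (1 * s) := by
    rw [Real.rpow_add hs, Real.rpow_one, one_mul]
    gcongr
    rcases le_total s 1 with h | h
    · exact (Real.rpow_le_one hs.le h H.pos.le).trans (Real.one_le_exp hs.le)
    · calc s ^ regExp d ≤ s ^ (1 : ℝ) := Real.rpow_le_rpow_of_exponent_le h H.le_one
        _ = s := Real.rpow_one s
        _ ≤ _ := by linarith [Real.add_one_le_exp s]
  rw [div_sub_one hsin, abs_div]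
  calc _ ≤ C * (s * Real.exp (1 * s)) / |Real.sin (Real.pi * d)| := by
        gcongr
        exact h1.trans (by gcongr)
    _ = _ := by ring

/-- On `(0, ∞)` the function `h` is real, and it differs from `1` by `O(s)` near `0`. -/
lemma exists_nearOne_h {φ : Polynomial ℝ} (hφ : ∀ x ∈ Icc (0 : ℝ) 1, φ.eval x ≠ 0) (q : ℕ) :
    ∃ (hr : ℝ → ℝ) (C K : ℝ), NearOne hr C K ∧ ∀ s, 0 < s → h d φ q s = (hr s : ℂ) := by
  obtain ⟨C, H, hC⟩ := exists_holderBound_argQ₀ hd hd0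
  obtain ⟨C₁, K₁, h₁⟩ := nearOne_sin_ratio hd hd0 H hC
  obtain ⟨C₂, K₂, h₂⟩ := nearOne_polynomial_ratio hφ
  have h₃ : NearOne (fun s => Real.exp (if 0 < d then -2 * s else 0)) 2 2 := by
    refine NearOne.exp_of_abs_le ?_ zero_le_two fun s hs => ?_
    · split_ifs <;> fun_prop
    · split_ifs
      · rw [abs_mul, abs_of_pos hs, abs_neg, abs_two]
      · simpa using hs.le
  obtain ⟨B, hB, h₄⟩ := H.exists_exponent_bound
  have h₄ := NearOne.exp_of_abs_le (measurable_ratioExponent H.measurable_argQ₀) hB h₄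
  have h₅ : NearOne (fun s => Real.exp (-2 * q * s)) (2 * q) (2 * q) := by
    refine NearOne.exp_of_abs_le (by fun_prop) (by positivity) fun s hs => ?_
    rw [abs_mul, abs_of_pos hs, abs_mul, abs_neg, abs_two, Nat.abs_cast]
  exact ⟨_, _, _, (((h₁.mul h₂).mul h₃).mul h₄).mul h₅, fun s hs => h_eq hd H φ q hs⟩

end

end FGN

end

theorem theorem6p1 (d : ℝ) (hd : d ∈ Set.Ioo (-1 / 2 : ℝ) (1 / 2)) (hd0 : d ≠ 0)
    (φ : Polynomial ℝ) (hφ0 : φ.eval 0 = 1)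
    (hφ : ∀ z : ℂ, ‖z‖ ≤ 1 → Polynomial.aeval z φ ≠ 0) (q : ℕ) :
    ∃ q₁ p₁ : ℝ → ℝ,
      FGN.IsUniqueSolution (Real.sin (Real.pi * d) / Real.pi) FGN.limitKernel (fun _ => 1) q₁ ∧
      FGN.IsUniqueSolution (-(Real.sin (Real.pi * d) / Real.pi)) FGN.limitKernel (fun _ => 1) p₁ ∧
      IntegrableOn (fun τ => q₁ τ * Real.exp (-τ)) (Set.Ioi 0) ∧
      IntegrableOn (fun τ => p₁ τ * Real.exp (-τ)) (Set.Ioi 0) ∧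
      ∀ j : ℕ, j ≤ q + 1 → ∃ (N : ℕ) (u w : ℕ → ℝ → ℝ),
        (∀ n : ℕ, N ≤ n →
          FGN.IsUniqueSolution (Real.sin (Real.pi * d) / Real.pi) (FGN.kernel d φ q n)
            (fun t => Real.exp (j * t)) (u n) ∧
          FGN.IsUniqueSolution (-(Real.sin (Real.pi * d) / Real.pi)) (FGN.kernel d φ q n)
            (fun t => Real.exp (j * t)) (w n)) ∧
        ∀ z : ℂ, z ∉ Complex.ofReal '' Set.Icc (0 : ℝ) 1 →
          (∀ n : ℕ, N ≤ n →
            IntegrableOn (FGN.cauchyIntegrand d φ q n (u n) z) (Set.Ioi 0) ∧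
            IntegrableOn (FGN.cauchyIntegrand d φ q n (w n) z) (Set.Ioi 0)) ∧
          (fun n : ℕ => FGN.S d φ q j n (u n) z
              - (z ^ j + ((Real.sin (Real.pi * d) / Real.pi : ℝ) : ℂ)
                  * ((FGN.expMoment q₁ : ℂ) / (z - 1)) * (n : ℂ)⁻¹))
            =O[atTop] (fun n : ℕ => ((n : ℝ) ^ 2)⁻¹) ∧
          (fun n : ℕ => FGN.D d φ q j n (w n) z
              - (z ^ j - ((Real.sin (Real.pi * d) / Real.pi : ℝ) : ℂ)
                  * ((FGN.expMoment p₁ : ℂ) / (z - 1)) * (n : ℂ)⁻¹))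
            =O[atTop] (fun n : ℕ => ((n : ℝ) ^ 2)⁻¹) := by
  -- The values φ(e^{-s}) in the denominator of h involve only the segment [0,1] of the closed disk.
  have hφ1 : ∀ x ∈ Set.Icc (0 : ℝ) 1, φ.eval x ≠ 0 := fun x hx h0 => by
    refine hφ x ?_ ?_
    · rw [Complex.norm_real, Real.norm_eq_abs, abs_of_nonneg hx.1]
      exact hx.2
    · rw [← Complex.coe_algebraMap, Polynomial.aeval_algebraMap_apply, Polynomial.aeval_def,
        Polynomial.eval₂_eq_eval_map]
      simp [h0]
  obtain ⟨hr, C, K, H, hh⟩ := FGN.exists_nearOne_h hd hd0 hφ1 q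
  exact FGN.theorem_of_nearOne d hd φ q H hh
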